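/- Let $K$ be a field of characteristic $0$ (for instance $\mathbb R$ or $\mathbb C$). **Carnot algebras.** A finite-dimensional Lie algebra $\mathfrak g$ over $K$ is a *Carnot algebra of length $n$* if it has a grading $\mathfrak g=\bigoplus_{i=1}^n\mathfrak g_i$, $[\mathfrak g_i,\mathfrak g_j]\subset\mathfrak g_{i+j}$, with $\mathfrak g_n\neq0$, $[\mathfrak g_1,\mathfrak g_i]=\mathfrak g_{i+1}$ for $1\le i<n$ and $[\mathfrak g_1,\mathfrak g_n]=0$. Write $\mathfrak g^1=\mathfrak g$, $\mathfrak g^{k+1}=[\mathfrak g,\mathfrak g^k]$. A Carnot algebra $\tilde{\mathfrak g}$ of length $N>n$ *extends* a Carnot algebra $\mathfrak g$ of length $n$ if $\tilde{\mathfrak g}/\tilde{\mathfrak g}^{\,n+1}\cong\mathfrak g$; here $\tilde{\mathfrak g}^{\,n+1}=\bigoplus_{i>n}\tilde{\mathfrak g}_i$. If $N=n+1$, then $\tilde{\mathfrak g}$ is called a *Carnot extension* of $\mathfrak g$ (it is a central extension with kernel the top component $\tilde{\mathfrak g}_{n+1}$). Carnot extensions are considered up to isomorphism of Lie algebras. **The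 algebras.** With $E_{ij}$ the matrix units of size $3$, put, for $k\ge0$, $$\begin{aligned} f_{8k+1}&=t^{2k}(E_{12}+E_{23}), & f_{8k+2}&=t^{2k+1}E_{31},\\ f_{8k+3}&=t^{2k+1}(E_{21}-E_{32}), & f_{8k+4}&=t^{2k+1}(E_{11}-2E_{22}+E_{33}),\\ f_{8k+5}&=t^{2k+1}(E_{12}-E_{23}), & f_{8k+6}&=t^{2k+1}E_{13},\\ f_{8k+7}&=t^{2k+2}(E_{21}+E_{32}), & f_{8k+8}&=t^{2k+2}(E_{11}-E_{33}). \end{aligned}$$ The linear span $\mathfrak n_2=\langle f_1,f_2,f_3,\dots\rangle$ is a Lie subalgebra of $\mathfrak{sl}(3,K)\otimes K[t]$. Put $\mathfrak n_2(n)=\mathfrak n_2/\mathfrak n_2^{\,n+1}$. For $N=6m+1$ put $p=8m+1$ and for $N=6m+5$ put $p=8m+6$, where $m\ge1$, and let $\mathfrak n_{2,1}(N)$, $\mathfrak n_{2,2}(N)$, $\mathfrak n_{2,3}(N)$ be the quotients of $\mathfrak n_2$ by the ideals $$\langle f_{p+1},f_{p+2},f_{p+3},\dots\rangle,\qquad \langle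 f_p,f_{p+2},f_{p+3},\dots\rangle,\qquad \langle f_p-f_{p+1},f_{p+2},f_{p+3},\dots\rangle .$$ Let $\mathfrak n_2^3=\mathfrak n_2\oplus Kz$ be the central extension of $\mathfrak n_2$ by the cocycle $f^2\wedge f^3$ (where $f^1,f^2,\dots$ is the basis dual to $f_1,f_2,\dots$), so that $z$ is central, $[f_2,f_3]=z$, and the other brackets of the $f_j$ are those of $\mathfrak n_2$. Put $\mathfrak n_2^3(n)=\mathfrak n_2^3/(\mathfrak n_2^3)^{n+1}$, and let $\mathfrak n_{2,s}^3(N)$, $s=1,2,3$, be the quotients of $\mathfrak n_2^3$ by the ideals spanned by the same vectors as above. **Statement.** Let $n\ge7$. Then $\mathfrak n_2(n)$ is a Carnot algebra of length $n$, and: 1. If $n\not\equiv0,4\pmod 6$, then $\mathfrak n_2(n)$ has, up to isomorphism, exactly one Carnot extension, namely $\mathfrak n_2(n+1)$. 2. If $n\equiv0$ or $n\equiv4\pmod 6$, then $\mathfrak n_2(n)$ has, up to isomorphism, exactly four Carnot extensions, namely the pairwise non-isomorphic algebras $$\mathfrak n_2(n+1),\quad \mathfrak n_{2,1}(n+1),\quad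 \mathfrak n_{2,2}(n+1),\quad \mathfrak n_{2,3}(n+1).$$ Moreover, none of $\mathfrak n_{2,s}(n+1)$, $s=1,2,3$, can be extended to a Carnot algebra of greater length. The same holds with $\mathfrak n_2(\cdot)$ and $\mathfrak n_{2,s}(\cdot)$ replaced throughout by $\mathfrak n_2^3(\cdot)$ and $\mathfrak n_{2,s}^3(\cdot)$. -/

import Mathlib

universe u v

/-! ### Carnot algebras and their extensions -/

section Carnot

variable (K : Type*) [Field K] {L : Type*} [LieRing L] [LieAlgebra K L]

/-- `𝒜` is a grading `L = 𝒜 1 ⊕ ⋯ ⊕ 𝒜 n` of the Lie algebra `L` with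
`[𝒜 1, 𝒜 i] = 𝒜 (i + 1)` for `1 ≤ i < n`, `[𝒜 1, 𝒜 n] = 0` and `𝒜 n ≠ 0`. -/
structure IsCarnotGrading (n : ℕ) (𝒜 : ℕ → Submodule K L) : Prop where
  isInternal : DirectSum.IsInternal 𝒜
  eq_bot : ∀ i, i = 0 ∨ n < i → 𝒜 i = ⊥
  lie_mem : ∀ i j, ∀ x ∈ 𝒜 i, ∀ y ∈ 𝒜 j, ⁅x, y⁆ ∈ 𝒜 (i + j)
  span_lie : ∀ i, 1 ≤ i → i < n →
    Submodule.span K {z | ∃ x ∈ 𝒜 1, ∃ y ∈ 𝒜 i, ⁅x, y⁆ = z} = 𝒜 (i + 1)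
  lie_top : ∀ x ∈ 𝒜 1, ∀ y ∈ 𝒜 n, ⁅x, y⁆ = 0
  top_ne_bot : 𝒜 n ≠ ⊥

variable (L) in
/-- `L` is a Carnot algebra of length (= nil-index) `n`: a finite-dimensional Lie algebra that
has a Carnot grading of length `n`. -/
def IsCarnot (n : ℕ) : Prop :=
  Module.Finite K L ∧ ∃ 𝒜 : ℕ → Submodule K L, IsCarnotGrading K n 𝒜

variable (L) in
/-- `E` is a Carnot algebra of length `N` that extends the Carnot algebra `L` of length `n`:
there is a surjective homomorphism `E → L` whose kernel is the sum of the homogeneous components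
of `E` of degree greater than `n`. For a Carnot algebra this sum is the term
`E ^ (n + 1)` of the lower central series `E ^ 1 = E`, `E ^ (k + 1) = [E, E ^ k]`, which Mathlib
numbers from zero. -/
def CarnotExtends (n N : ℕ) (E : Type*) [LieRing E] [LieAlgebra K E] : Prop :=
  IsCarnot K E N ∧ ∃ π : E →ₗ⁅K⁆ L, Function.Surjective π ∧
    π.ker = LieModule.lowerCentralSeries K E E n

variable (L) in
/-- `E` is a Carnot extension of the Carnot algebra `L` of length `n`: it is a Carnot algebra of
length `n + 1` that sits in an exact sequence `0 → E_{n+1} → E → L → 0`, in which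
`E_{n+1} = E ^ (n + 1)` is the (central) top homogeneous component of `E`. -/
def IsCarnotExtension (n : ℕ) (E : Type*) [LieRing E] [LieAlgebra K E] : Prop :=
  CarnotExtends K L n (n + 1) E

end Carnot

/-! ### The Lie algebra `𝔫₂` -/

section NTwo

open Polynomial

attribute [local instance] LieRing.ofAssociativeRing

variable (K : Type*) [Field K]

/-- The integer matrix that is the coefficient of the power of `t` in `f_j`, for `j` modulo `8`. -/
def fBase : Fin 8 → Matrix (Fin 3) (Fin 3) ℤ
  | 0 => !![1, 0, 0; 0, 0, 0; 0, 0, -1]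
  | 1 => !![0, 1, 0; 0, 0, 1; 0, 0, 0]
  | 2 => !![0, 0, 0; 0, 0, 0; 1, 0, 0]
  | 3 => !![0, 0, 0; 1, 0, 0; 0, -1, 0]
  | 4 => !![1, 0, 0; 0, -2, 0; 0, 0, 1]
  | 5 => !![0, 1, 0; 0, 0, -1; 0, 0, 0]
  | 6 => !![0, 0, 1; 0, 0, 0; 0, 0, 0]
  | 7 => !![0, 0, 0; 1, 0, 0; 0, 1, 0]

/-- The difference between the exponent of `t` in `f_{8k+s}` and `2k`. -/
def fShift : Fin 8 → ℕ := ![0, 0, 1, 1, 1, 1, 1, 2]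

/-- The exponent of `t` in `f_{8k+s}`: it is `2k` for `s = 0, 1`, it is `2k + 1` for
`2 ≤ s ≤ 6`, and it is `2k + 2` for `s = 7`. -/
def fExp (j : ℕ) : ℕ := 2 * (j / 8) + fShift (Fin.ofNat 8 j)

/-- The matrices `f_j` with entries in `K[t]`. Only `f_1, f_2, …` are used for `𝔫₂`. -/
noncomputable def fMat (j : ℕ) : Matrix (Fin 3) (Fin 3) K[X] :=
  (X ^ fExp j : K[X]) • (fBase (Fin.ofNat 8 j)).map (Int.cast : ℤ → K[X])

/-- The structure constants `d_{q,l}`, which depend on `q, l` modulo `8`. -/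
def dTable : Fin 8 → Fin 8 → ℤ :=
  ![![0, 1, -2, -1, 0, 1, 2, -1],
    ![-1, 0, 1, 1, -3, -2, 0, 1],
    ![2, -1, 0, 0, 0, 1, -1, 0],
    ![1, -1, 0, 0, 3, -1, 1, -2],
    ![0, 3, 0, -3, 0, 3, 0, -3],
    ![-1, 2, -1, 1, -3, 0, 0, 1],
    ![-2, 0, 1, -1, 0, 0, 0, 1],
    ![1, -1, 0, 2, 3, -1, -1, 0]]

/-- The structure constant `d_{q,l}`. -/
def dCoef (q l : ℕ) : ℤ := dTable (Fin.ofNat 8 q) (Fin.ofNat 8 l)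

theorem lie_fBase (s u : Fin 8) : ⁅fBase s, fBase u⁆ = dTable s u • fBase (s + u) := by
  rw [Ring.lie_def]
  revert s u
  decide

theorem fExp_add (q l : ℕ) (h : dCoef q l ≠ 0) : fExp (q + l) = fExp q + fExp l := by
  have key : ∀ s u : Fin 8, dTable s u ≠ 0 →
      2 * ((s.val + u.val) / 8) + fShift (s + u) = fShift s + fShift u := by decide
  have h2 := key (Fin.ofNat 8 q) (Fin.ofNat 8 l) h
  have h3 : Fin.ofNat 8 (q + l) = Fin.ofNat 8 q + Fin.ofNat 8 l := by
    simp [Fin.ext_iff, Fin.ofNat, Fin.val_add]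
  have h4 : (Fin.ofNat 8 q).val = q % 8 := rfl
  have h5 : (Fin.ofNat 8 l).val = l % 8 := rfl
  rw [h4, h5] at h2
  simp only [fExp, h3]
  omega

theorem lie_fMat (q l : ℕ) : ⁅fMat K q, fMat K l⁆ = (dCoef q l : K) • fMat K (q + l) := by
  have h3 : Fin.ofNat 8 (q + l) = Fin.ofNat 8 q + Fin.ofNat 8 l := by
    simp [Fin.ext_iff, Fin.ofNat, Fin.val_add]
  let φ : Matrix (Fin 3) (Fin 3) ℤ →+* Matrix (Fin 3) (Fin 3) K[X] :=
    (Int.castRingHom K[X]).mapMatrix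
  have hφ (A : Matrix (Fin 3) (Fin 3) ℤ) : A.map (Int.cast : ℤ → K[X]) = φ A := rfl
  have h2 : φ (fBase (Fin.ofNat 8 q)) * φ (fBase (Fin.ofNat 8 l)) -
      φ (fBase (Fin.ofNat 8 l)) * φ (fBase (Fin.ofNat 8 q)) =
      dCoef q l • φ (fBase (Fin.ofNat 8 (q + l))) := by
    rw [← map_mul, ← map_mul, ← map_sub, ← Ring.lie_def, lie_fBase, map_zsmul, h3, dCoef]
  rw [fMat, fMat, Ring.lie_def, smul_mul_smul_comm, smul_mul_smul_comm, mul_comm (X ^ fExp l),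
    ← smul_sub, hφ, hφ, h2, Int.cast_smul_eq_zsmul, smul_comm, fMat, hφ]
  by_cases h : dCoef q l = 0
  · simp [h]
  · rw [fExp_add q l h, pow_add]

/-- The Lie algebra `𝔫₂`: the linear span of `f_1, f_2, f_3, …` in the matrices over `K[t]`. -/
noncomputable def n2 : LieSubalgebra K (Matrix (Fin 3) (Fin 3) K[X]) where
  toSubmodule := Submodule.span K {x | ∃ j, 1 ≤ j ∧ fMat K j = x}
  lie_mem' := by
    intro x y hx hy
    induction hx, hy using Submodule.span_induction₂ with
    | mem_mem x y hx hy =>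
      obtain ⟨i, hi, rfl⟩ := hx
      obtain ⟨j, hj, rfl⟩ := hy
      rw [lie_fMat]
      exact Submodule.smul_mem _ _ (Submodule.subset_span ⟨i + j, by omega, rfl⟩)
    | zero_left y hy => simp
    | zero_right x hx => simp
    | add_left x y z _ _ _ hx hy => rw [add_lie]; exact Submodule.add_mem _ hx hy
    | add_right x y z _ _ _ hx hy => rw [lie_add]; exact Submodule.add_mem _ hx hy
    | smul_left r x y _ _ h => rw [smul_lie]; exact Submodule.smul_mem _ _ h
    | smul_right r x y _ _ h => rw [lie_smul]; exact Submodule.smul_mem _ _ h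

/-- `𝔫₂(n) = 𝔫₂ / 𝔫₂ ^ (n + 1)`, where `𝔫₂ ^ (n + 1)` is the term of the lower central series
that Mathlib numbers by `n`. -/
abbrev n2Quot (n : ℕ) : Type _ := n2 K ⧸ LieModule.lowerCentralSeries K (n2 K) (n2 K) n

/-- The index `p` of the first one of the two basis vectors `f_p, f_{p+1}` of natural degree `N`,
where `N = 6m + 1` (then `p = 8m + 1`) or `N = 6m + 5` (then `p = 8m + 6`). -/
def firstIdx (N : ℕ) : ℕ := if N % 6 = 1 then 8 * (N / 6) + 1 else 8 * (N / 6) + 6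

/-- Spanning sets, in terms of `p = firstIdx N`, of three ideals of `𝔫₂`: for `s = 0, 1, 2` these
are `f_{p+1}`, or `f_p`, or `f_p - f_{p+1}`, and all `f_j` with `j ≥ p + 2`. -/
noncomputable def idealGen (N : ℕ) (s : Fin 3) : Set (Matrix (Fin 3) (Fin 3) K[X]) :=
  {![fMat K (firstIdx N + 1), fMat K (firstIdx N),
    fMat K (firstIdx N) - fMat K (firstIdx N + 1)] s} ∪
  {x | ∃ j, firstIdx N + 2 ≤ j ∧ fMat K j = x}

theorem lie_mem_span_idealGen (N : ℕ) (s : Fin 3)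
    {x y : Matrix (Fin 3) (Fin 3) K[X]} (hx : x ∈ n2 K)
    (hy : y ∈ Submodule.span K (idealGen K N s)) :
    ⁅x, y⁆ ∈ Submodule.span K (idealGen K N s) := by
  have hx' : x ∈ Submodule.span K {x | ∃ j, 1 ≤ j ∧ fMat K j = x} := hx
  clear hx
  have big (i j : ℕ) (h : firstIdx N + 2 ≤ i + j) :
      ⁅fMat K i, fMat K j⁆ ∈ Submodule.span K (idealGen K N s) := by
    rw [lie_fMat]
    exact Submodule.smul_mem _ _ (Submodule.subset_span (Or.inr ⟨i + j, h, rfl⟩))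
  have zero : ⁅fMat K 1, fMat K (firstIdx N)⁆ = 0 := by
    have h1 : Fin.ofNat 8 (firstIdx N) = 1 ∨ Fin.ofNat 8 (firstIdx N) = 6 := by
      simp only [Fin.ext_iff, Fin.ofNat, firstIdx]
      split_ifs <;> simp
    have h2 : dCoef 1 (firstIdx N) = 0 := by
      rcases h1 with h1 | h1 <;> rw [dCoef, h1] <;> decide
    rw [lie_fMat, h2]
    simp
  have first (i : ℕ) (hi : 1 ≤ i) :
      ⁅fMat K i, fMat K (firstIdx N)⁆ ∈ Submodule.span K (idealGen K N s) := by
    rcases hi.eq_or_lt with rfl | hi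
    · rw [zero]
      exact Submodule.zero_mem _
    · exact big _ _ (by omega)
  induction hx', hy using Submodule.span_induction₂ with
  | mem_mem x y hx hy =>
    obtain ⟨i, hi, rfl⟩ := hx
    rcases hy with hy | ⟨j, hj, rfl⟩
    · rw [Set.mem_singleton_iff] at hy
      subst hy
      fin_cases s
      · exact big _ _ (by omega)
      · exact first i hi
      · change ⁅fMat K i, fMat K (firstIdx N) - fMat K (firstIdx N + 1)⁆ ∈ _
        rw [lie_sub]
        exact Submodule.sub_mem _ (first i hi) (big _ _ (by omega))
    · exact big _ _ (by omega)
  | zero_left y hy => simp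
  | zero_right x hx => simp
  | add_left x y z _ _ _ hx hy => rw [add_lie]; exact Submodule.add_mem _ hx hy
  | add_right x y z _ _ _ hx hy => rw [lie_add]; exact Submodule.add_mem _ hx hy
  | smul_left r x y _ _ h => rw [smul_lie]; exact Submodule.smul_mem _ _ h
  | smul_right r x y _ _ h => rw [lie_smul]; exact Submodule.smul_mem _ _ h

/-- The three ideals of `𝔫₂` (for `s = 0, 1, 2`) spanned by `f_{p+1}`, `f_p`, `f_p - f_{p+1}`
respectively and by all `f_j` with `j ≥ p + 2`, where `p = firstIdx N`. -/
noncomputable def n2Ideal (N : ℕ) (_hN : 7 ≤ N ∧ (N % 6 = 1 ∨ N % 6 = 5)) (s : Fin 3) :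
    LieIdeal K (n2 K) where
  toSubmodule := (Submodule.span K (idealGen K N s)).comap (n2 K).toSubmodule.subtype
  lie_mem := by
    intro x m hm
    exact lie_mem_span_idealGen K N s x.2 hm

/-- The algebra `𝔫_{2,s}(N)`, `N = 6m + 1` or `N = 6m + 5` with `m ≥ 1`; the index `s = 1, 2, 3`
is written as `0, 1, 2`. -/
abbrev n2S (N : ℕ) (hN : 7 ≤ N ∧ (N % 6 = 1 ∨ N % 6 = 5)) (s : Fin 3) : Type _ :=
  n2 K ⧸ n2Ideal K N hN s

/-! ### The central extension `𝔫₂³` of `𝔫₂` -/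

/-- The coordinate functional that takes the coefficient of `t ^ e` in the entry `(r, c)`. -/
noncomputable def entryCoeff (r c : Fin 3) (e : ℕ) : n2 K →ₗ[K] K where
  toFun x := (x.1 r c).coeff e
  map_add' x y := by simp
  map_smul' a x := by simp

theorem coeff_fMat (j : ℕ) (r c : Fin 3) (e : ℕ) :
    (fMat K j r c).coeff e = if e = fExp j then (fBase (Fin.ofNat 8 j) r c : K) else 0 := by
  rw [fMat, Matrix.smul_apply, Matrix.map_apply, smul_eq_mul, Polynomial.coeff_X_pow_mul',
    ← Polynomial.C_eq_intCast, Polynomial.coeff_C]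
  split_ifs <;> first | rfl | omega

/-- The functional `f^1` of the basis dual to `f_1, f_2, …`. -/
noncomputable def fDual1 : n2 K →ₗ[K] K := entryCoeff K 0 1 0

/-- The functional `f^2` of the basis dual to `f_1, f_2, …`. -/
noncomputable def fDual2 : n2 K →ₗ[K] K := entryCoeff K 2 0 1

/-- The functional `f^3` of the basis dual to `f_1, f_2, …`. -/
noncomputable def fDual3 : n2 K →ₗ[K] K := entryCoeff K 1 0 1

theorem fDual_fMat (j : ℕ) (hj : 1 ≤ j) (h : fMat K j ∈ n2 K) :
    fDual1 K ⟨fMat K j, h⟩ = (if j = 1 then 1 else 0) ∧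
    fDual2 K ⟨fMat K j, h⟩ = (if j = 2 then 1 else 0) ∧
    fDual3 K ⟨fMat K j, h⟩ = (if j = 3 then 1 else 0) := by
  change (fMat K j 0 1).coeff 0 = _ ∧ (fMat K j 2 0).coeff 1 = _ ∧ (fMat K j 1 0).coeff 1 = _
  rw [coeff_fMat, coeff_fMat, coeff_fMat]
  obtain ⟨a, s, hs, rfl⟩ : ∃ a s, s < 8 ∧ j = 8 * a + s :=
    ⟨j / 8, j % 8, Nat.mod_lt _ (by norm_num), by omega⟩
  have h1 : (8 * a + s) / 8 = a := by omega
  have h2 : Fin.ofNat 8 (8 * a + s) = Fin.ofNat 8 s := by simp [Fin.ofNat]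
  rw [fExp, h1, h2]
  clear h h1 h2
  interval_cases s <;> simp [fBase, fShift, Fin.ofNat] <;> omega

theorem mem_n2_induction {P : n2 K → n2 K → Prop}
    (basis : ∀ i j (hi : 1 ≤ i) (hj : 1 ≤ j), P ⟨fMat K i, Submodule.subset_span ⟨i, hi, rfl⟩⟩
      ⟨fMat K j, Submodule.subset_span ⟨j, hj, rfl⟩⟩)
    (zero_left : ∀ y, P 0 y) (zero_right : ∀ x, P x 0)
    (add_left : ∀ x y z, P x z → P y z → P (x + y) z)
    (add_right : ∀ x y z, P x y → P x z → P x (y + z))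
    (smul_left : ∀ (r : K) x y, P x y → P (r • x) y)
    (smul_right : ∀ (r : K) x y, P x y → P x (r • y)) (x y : n2 K) : P x y := by
  obtain ⟨x, hx⟩ := x
  obtain ⟨y, hy⟩ := y
  have hx' : x ∈ Submodule.span K {x | ∃ j, 1 ≤ j ∧ fMat K j = x} := hx
  have hy' : y ∈ Submodule.span K {x | ∃ j, 1 ≤ j ∧ fMat K j = x} := hy
  suffices h : ∀ (hx : x ∈ n2 K) (hy : y ∈ n2 K), P ⟨x, hx⟩ ⟨y, hy⟩ from h hx hy
  clear hx hy
  induction hx', hy' using Submodule.span_induction₂ with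
  | mem_mem x y hx hy =>
    obtain ⟨i, hi, rfl⟩ := hx
    obtain ⟨j, hj, rfl⟩ := hy
    exact fun _ _ => basis i j hi hj
  | zero_left y hy => exact fun _ _ => zero_left _
  | zero_right x hx => exact fun _ _ => zero_right _
  | add_left x y z hx hy hz h1 h2 => exact fun _ hz => add_left _ _ _ (h1 hx hz) (h2 hy hz)
  | add_right x y z hx hy hz h1 h2 => exact fun hx _ => add_right _ _ _ (h1 hx hy) (h2 hx hz)
  | smul_left r x y hx hy h => exact fun _ hy => smul_left r _ _ (h hx hy)
  | smul_right r x y hx hy h => exact fun hx _ => smul_right r _ _ (h hx hy)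

theorem fDual_lie (x y : n2 K) : fDual2 K ⁅x, y⁆ = 0 ∧
    fDual3 K ⁅x, y⁆ = fDual1 K x * fDual2 K y - fDual2 K x * fDual1 K y := by
  refine mem_n2_induction K
    (P := fun x y => fDual2 K ⁅x, y⁆ = 0 ∧
      fDual3 K ⁅x, y⁆ = fDual1 K x * fDual2 K y - fDual2 K x * fDual1 K y)
    ?_ ?_ ?_ ?_ ?_ ?_ ?_ x y
  · intro i j hi hj
    have hij : fMat K (i + j) ∈ n2 K := Submodule.subset_span ⟨i + j, by omega, rfl⟩
    have key : (⁅(⟨fMat K i, Submodule.subset_span ⟨i, hi, rfl⟩⟩ : n2 K),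
        (⟨fMat K j, Submodule.subset_span ⟨j, hj, rfl⟩⟩ : n2 K)⁆ : n2 K) =
        (dCoef i j : K) • ⟨fMat K (i + j), hij⟩ := Subtype.ext (lie_fMat K i j)
    obtain ⟨-, h2, h3⟩ := fDual_fMat K (i + j) (by omega) hij
    obtain ⟨i1, i2, -⟩ := fDual_fMat K i hi (Submodule.subset_span ⟨i, hi, rfl⟩)
    obtain ⟨j1, j2, -⟩ := fDual_fMat K j hj (Submodule.subset_span ⟨j, hj, rfl⟩)
    rw [key, map_smul, map_smul, h2, h3, i1, i2, j1, j2]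
    have d11 : dCoef 1 1 = 0 := by decide
    have d12 : dCoef 1 2 = 1 := by decide
    have d21 : dCoef 2 1 = -1 := by decide
    by_cases hi3 : i ≤ 2 ∧ j ≤ 2
    · obtain ⟨hi3, hj3⟩ := hi3
      interval_cases i <;> interval_cases j <;> simp [d11, d12, d21]
    · have e2 : i + j ≠ 2 := by omega
      by_cases e3 : i + j = 3
      · omega
      · have : ¬ (i = 1 ∧ j = 2) := by omega
        have : ¬ (i = 2 ∧ j = 1) := by omega
        simp only [e2, e3, if_false, smul_zero, true_and]
        split_ifs <;> first | omega | simp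
  · intro y; simp
  · intro x; simp
  · rintro x y z ⟨h1, h2⟩ ⟨h3, h4⟩
    simp only [add_lie, map_add, h1, h2, h3, h4]
    exact ⟨by ring, by ring⟩
  · rintro x y z ⟨h1, h2⟩ ⟨h3, h4⟩
    simp only [lie_add, map_add, h1, h2, h3, h4]
    exact ⟨by ring, by ring⟩
  · rintro r x y ⟨h1, h2⟩
    simp only [smul_lie, map_smul, h1, h2, smul_eq_mul]
    exact ⟨by ring, by ring⟩
  · rintro r x y ⟨h1, h2⟩
    simp only [lie_smul, map_smul, h1, h2, smul_eq_mul]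
    exact ⟨by ring, by ring⟩

open LieModule.Cohomology in
/-- The 2-cocycle `f^2 ∧ f^3` on `𝔫₂` with values in the trivial module `K`. -/
noncomputable def n2Cocycle : twoCocycle K (n2 K) (TrivialLieModule K (n2 K) K) :=
  ⟨⟨LinearMap.mk₂ K (fun x y => (TrivialLieModule.equiv K (n2 K) K).symm
      (fDual2 K x * fDual3 K y - fDual3 K x * fDual2 K y))
      (fun x y z => by rw [← map_add]; congr 1; simp only [map_add]; ring)
      (fun r x y => by rw [← map_smul]; congr 1; simp only [map_smul, smul_eq_mul]; ring)
      (fun x y z => by rw [← map_add]; congr 1; simp only [map_add]; ring)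
      (fun r x y => by rw [← map_smul]; congr 1; simp only [map_smul, smul_eq_mul]; ring),
    fun x => by
      rw [LinearMap.mk₂_apply, mul_comm, sub_self, map_zero]⟩, by
    rw [mem_twoCocycle_iff_of_trivial]
    intro x y z
    change (TrivialLieModule.equiv K (n2 K) K).symm _ =
      (TrivialLieModule.equiv K (n2 K) K).symm _ + (TrivialLieModule.equiv K (n2 K) K).symm _
    rw [← map_add]
    congr 1
    simp only [(fDual_lie K _ _).1, (fDual_lie K _ _).2]
    ring⟩

/-- The Lie algebra `𝔫₂³`: the one-dimensional central extension of `𝔫₂` that is defined by the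
cocycle `f^2 ∧ f^3`. Its elements are pairs `(x, c)`, which stand for `x + c z`. -/
abbrev n2Cube : Type _ := LieAlgebra.ofTwoCocycle (n2Cocycle K)

/-- `𝔫₂³(n) = 𝔫₂³ / (𝔫₂³) ^ (n + 1)`, where `(𝔫₂³) ^ (n + 1)` is the term of the lower central
series that Mathlib numbers by `n`. -/
abbrev n2CubeQuot (n : ℕ) : Type _ :=
  n2Cube K ⧸ LieModule.lowerCentralSeries K (n2Cube K) (n2Cube K) n

/-- The linear section `x ↦ (x, 0)` of the projection `𝔫₂³ → 𝔫₂`, which sends `f_j` to `f_j`. -/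
noncomputable def n2Section : n2 K →ₗ[K] n2Cube K where
  toFun x := LieAlgebra.ofProd (n2Cocycle K) (x, 0)
  map_add' x y := by rw [← LieAlgebra.of_add, Prod.mk_add_mk, add_zero]
  map_smul' r x := by rw [RingHom.id_apply, ← LieAlgebra.of_smul, Prod.smul_mk, smul_zero]

theorem fDual_eq_zero (N : ℕ) (hN : 7 ≤ N ∧ (N % 6 = 1 ∨ N % 6 = 5)) (s : Fin 3) (x : n2 K)
    (hx : x ∈ n2Ideal K N hN s) : fDual2 K x = 0 ∧ fDual3 K x = 0 := by
  have hx' : x.1 ∈ Submodule.span K (idealGen K N s) := hx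
  have hp : 4 ≤ firstIdx N := by
    rw [firstIdx]
    split_ifs <;> omega
  have basis (j : ℕ) (hj : 4 ≤ j) : (fMat K j 2 0).coeff 1 = 0 ∧ (fMat K j 1 0).coeff 1 = 0 := by
    obtain ⟨-, h2, h3⟩ := fDual_fMat K j (by omega) (Submodule.subset_span ⟨j, by omega, rfl⟩)
    rw [if_neg (by omega)] at h2 h3
    exact ⟨h2, h3⟩
  change (x.1 2 0).coeff 1 = 0 ∧ (x.1 1 0).coeff 1 = 0
  generalize x.1 = y at hx'
  induction hx' using Submodule.span_induction with
  | mem y hy =>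
    rcases hy with hy | ⟨j, hj, rfl⟩
    · rw [Set.mem_singleton_iff] at hy
      subst hy
      fin_cases s
      · exact basis _ (by omega)
      · exact basis _ hp
      · have h1 := basis _ hp
        have h2 := basis (firstIdx N + 1) (by omega)
        simp [h1, h2]
    · exact basis j (by omega)
  | zero => simp
  | add y z _ _ h1 h2 => simp [h1, h2]
  | smul r y _ h => simp [h]

/-- The image of the ideal `n2Ideal K N _ s` of `𝔫₂` under the section `f_j ↦ f_j`: the ideal of
`𝔫₂³` spanned by `f_{p+1}`, `f_p`, `f_p - f_{p+1}` respectively and by all `f_j` with `j ≥ p + 2`,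
where `p = firstIdx N`. -/
noncomputable def n2CubeIdeal (N : ℕ) (hN : 7 ≤ N ∧ (N % 6 = 1 ∨ N % 6 = 5)) (s : Fin 3) :
    LieIdeal K (n2Cube K) where
  toSubmodule := (n2Ideal K N hN s).toSubmodule.map (n2Section K)
  lie_mem := by
    rintro x _ ⟨m, hm, rfl⟩
    have hm' : m ∈ n2Ideal K N hN s := hm
    obtain ⟨h2, h3⟩ := fDual_eq_zero K N hN s m hm'
    refine ⟨⁅((LieAlgebra.ofProd (n2Cocycle K)).symm x).1, m⁆, lie_mem_right K _ _ _ _ hm', ?_⟩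
    rw [LieAlgebra.bracket_ofTwoCocycle]
    change LieAlgebra.ofProd (n2Cocycle K) _ = _
    congr 1
    refine Prod.ext rfl ?_
    change (0 : TrivialLieModule K (n2 K) K) =
      (TrivialLieModule.equiv K (n2 K) K).symm (_ * fDual3 K m - _ * fDual2 K m) + _ - _
    rw [h2, h3]
    simp [trivial_lie_zero]

/-- The algebra `𝔫_{2,s}³(N)`, `N = 6m + 1` or `N = 6m + 5` with `m ≥ 1`; the index `s = 1, 2, 3`
is written as `0, 1, 2`. -/
abbrev n2CubeS (N : ℕ) (hN : 7 ≤ N ∧ (N % 6 = 1 ∨ N % 6 = 5)) (s : Fin 3) : Type _ :=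
  n2Cube K ⧸ n2CubeIdeal K N hN s

end NTwo

theorem succ_deg {n : ℕ} (hn : 7 ≤ n) (h : n % 6 = 0 ∨ n % 6 = 4) :
    7 ≤ n + 1 ∧ ((n + 1) % 6 = 1 ∨ (n + 1) % 6 = 5) := by
  omega

/-! The algebra $\mathfrak n_2$ is the positive part of the twisted affine algebra of type
$A_2^{(2)}$. It is generated by $f_1, f_2$ with the Serre relations $[f_2,[f_1,f_2]]=0$ and
$(\mathrm{ad} f_1)^5f_2=0$; for $\mathfrak n_2^3$ the first one is weakened to the centrality of
$[f_2,[f_1,f_2]]$. That these relations suffice (`lieRel_genSeq`) is shown by induction on the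
weight $q+l$ of a bracket $[f_q,f_l]$: the Jacobi identity reduces weight $M$ to $[f_1,f_{M-1}]$ and
$[f_2,f_{M-2}]$, one of which defines $f_M$ while the other is forced.

In the natural grading, where $f_1$ and $f_2$ have degree 1, all these relations live in degrees at
most 6. A Carnot algebra that extends a truncation of length at least 6 therefore still satisfies
them, and is a graded image of the whole infinite algebra (`exists_graded_hom`). The Carnot grading
of the extension need not match that of the quotient. It suffices that the lower central series is
the degree filtration of every Carnot grading, so a homogeneous element that lies deeper than its
own degree is zero.

A Carnot extension is thus determined by the proper subspace of the component of degree $n+1$ that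
dies in it. If that component is a line, the subspace is zero. It is a plane $\langle
f_p,f_{p+1}\rangle$ exactly when $n+1\equiv1,5$ modulo 6; then the subspace is zero or a line, and
the torus that rescales $f_2$ moves each line to that of $f_p$, $f_{p+1}$ or $f_p-f_{p+1}$.

Killing a line also kills $f_{p+2}$, which spans the next degree, so nothing longer exists
(`not_carnotExtends`). For non-isomorphism, the graded part of an isomorphism preserves the Serre
relations, which forces it to be diagonal on $f_1,f_2$ and hence on every $f_j$
(`exists_scalars_of_equiv`); diagonal maps do not mix the three lines. -/

/-! ### Serre presentation of `𝔫₂` and `𝔫₂³` -/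

section Presentation

/-- The structure constants of the cocycle `f^2 ∧ f^3`. -/
def wCoef (q l : ℕ) : ℤ := if q = 2 ∧ l = 3 then 1 else if q = 3 ∧ l = 2 then -1 else 0

theorem wCoef_eq_zero {q l : ℕ} (h : q + l ≠ 5) : wCoef q l = 0 := by
  rw [wCoef, if_neg (by omega), if_neg (by omega)]

theorem ofNat8_add (q l : ℕ) : Fin.ofNat 8 (q + l) = Fin.ofNat 8 q + Fin.ofNat 8 l := by
  simp [Fin.ext_iff, Fin.ofNat, Fin.val_add]

theorem dCoef_mul_add (q k s : ℕ) : dCoef q (8 * k + s) = dCoef q s := by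
  rw [dCoef, dCoef]; congr 1; simp [Fin.ofNat]

/-- The Jacobi identity for `f_1, f_b, f_c` in terms of structure constants, a finite check modulo
8. -/
theorem dCoef_one_step (b c : ℕ) :
    dCoef b c * dCoef 1 (b + c) - dCoef 1 c * dCoef b (1 + c) =
      dCoef 1 b * dCoef (1 + b) c := by
  have key : ∀ s u : Fin 8, dTable s u * dTable 1 (s + u) - dTable 1 u * dTable s (1 + u) =
      dTable 1 s * dTable (1 + s) u := by decide
  simp only [dCoef, ofNat8_add]
  exact key _ _

theorem dCoef_two_step (b c : ℕ) :
    dCoef b c * dCoef 2 (b + c) - dCoef 2 c * dCoef b (2 + c) =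
      dCoef 2 b * dCoef (2 + b) c := by
  have key : ∀ s u : Fin 8, dTable s u * dTable 2 (s + u) - dTable 2 u * dTable s (2 + u) =
      dTable 2 s * dTable (2 + s) u := by decide
  simp only [dCoef, ofNat8_add]
  exact key _ _

theorem dCoef_antisymm (b c : ℕ) : dCoef b c = - dCoef c b := by
  have key : ∀ s u : Fin 8, dTable s u = - dTable u s := by decide
  exact key _ _

/-- Every `f_j` with `j ≥ 3` is a nonzero multiple of `[f_1, f_{j-1}]` or `[f_2, f_{j-2}]`. -/
theorem dCoef_ne_zero (b : ℕ) : dCoef 1 (b + 1) ≠ 0 ∨ dCoef 2 b ≠ 0 := by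
  have key : ∀ s : Fin 8, dTable 1 (s + 1) ≠ 0 ∨ dTable 2 s ≠ 0 := by decide
  simp only [dCoef, ofNat8_add]
  exact key _

/-- The trace form of `f_s` and `f_{-s}`. -/
def kTable : Fin 8 → ℤ := ![2, 2, 1, 2, 6, 2, 1, 2]

/-- The first identity is Jacobi in total weight zero; the other two express the invariance of the
trace form. Together they make both `dCoef b c` and `b * kTable b` solutions of the Jacobi recursion
in `lie_low_zero`. -/
theorem kTable_one_step (s u : Fin 8) (h : 1 + s + u = 0) :
    dTable 1 s * dTable (1 + s) u = dTable s u - dTable 1 u * dTable s (1 + u) ∧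
    dTable s u * 2 = dTable 1 s * kTable (1 + s) ∧
    - (dTable 1 u * kTable s) = dTable 1 s * kTable (1 + s) := by
  revert s u; decide

theorem kTable_two_step (s u : Fin 8) (h : 2 + s + u = 0) :
    dTable 2 s * dTable (2 + s) u = - dTable s u - dTable 2 u * dTable s (2 + u) ∧
    dTable s u = dTable 2 s * kTable (2 + s) ∧
    - (dTable 2 u * kTable s) = dTable 2 s * kTable (2 + s) := by
  revert s u; decide

variable {K : Type u} [Field K] {E : Type v} [LieRing E] [LieAlgebra K E]

/-- The brackets `[e_q, e_l]` are as in `𝔫₂`, up to the multiple `w` of the cocycle. -/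
def LieRel (K : Type u) [Field K] {E : Type v} [LieRing E] [LieAlgebra K E] (e : ℕ → E) (w : E)
    (q l : ℕ) : Prop :=
  ⁅e q, e l⁆ = (dCoef q l : K) • e (q + l) + (wCoef q l : K) • w

/-- The inner brackets have weight below `M`, hence are known, and their multiples of the central
`w` drop out. What remains is a linear relation among the unknown brackets of weight `M`. -/
theorem jacobi_lieRel {e : ℕ → E} {w : E} (hw : ∀ x : E, ⁅x, w⁆ = 0) {M : ℕ}
    (ih : ∀ q l, 1 ≤ q → 1 ≤ l → q + l < M → LieRel K e w q l)
    (a b c : ℕ) (ha : 1 ≤ a) (hb : 1 ≤ b) (hc : 1 ≤ c) (h : a + b + c = M) :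
    (dCoef a b : K) • ⁅e (a + b), e c⁆ =
      (dCoef b c : K) • ⁅e a, e (b + c)⁆ - (dCoef a c : K) • ⁅e b, e (a + c)⁆ := by
  have hw' (x : E) : ⁅w, x⁆ = 0 := by rw [← lie_skew, hw, neg_zero]
  have j := lie_lie (e a) (e b) (e c)
  rw [ih a b ha hb (by omega), ih b c hb hc (by omega), ih a c ha hc (by omega)] at j
  simpa [hw, hw'] using j

/-- Once `[e_1, e_{M-1}]` and `[e_2, e_{M-2}]` are right, all brackets of weight `M` are. -/
theorem lieRel_of_low [CharZero K] {e : ℕ → E} {w : E} (hw : ∀ x : E, ⁅x, w⁆ = 0) {M : ℕ} (hM : 6 ≤ M)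
    (ih : ∀ q l, 1 ≤ q → 1 ≤ l → q + l < M → LieRel K e w q l)
    (h1 : LieRel K e w 1 (M - 1)) (h2 : LieRel K e w 2 (M - 2))
    (b c : ℕ) (hb : 1 ≤ b) (hc : 1 ≤ c) (h : b + c = M) : LieRel K e w b c := by
  induction b using Nat.strong_induction_on generalizing c with
  | _ b hi =>
    obtain rfl | rfl | hb3 : b = 1 ∨ b = 2 ∨ 3 ≤ b := by omega
    · rwa [show c = M - 1 by omega]
    · rwa [show c = M - 2 by omega]
    have h0 : (wCoef b c : K) = 0 := by rw [wCoef_eq_zero (by omega), Int.cast_zero]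
    obtain ⟨b, rfl⟩ : ∃ j, b = j + 2 := ⟨b - 2, by omega⟩
    -- `e (b + 2)` is a multiple of `⁅e 1, e (b + 1)⁆` or of `⁅e 2, e b⁆`. Jacobi turns its bracket
    -- with `e c` into a low bracket `h1` or `h2` and a bracket with a smaller first index.
    rcases dCoef_ne_zero b with hd | hd
    · have j := jacobi_lieRel hw ih 1 (b + 1) c le_rfl (by omega) hc (by omega)
      have x := hi (b + 1) (by omega) (1 + c) (by omega) (by omega) (by omega)
      rw [LieRel, wCoef_eq_zero (by omega), Int.cast_zero, zero_smul, add_zero,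
        show b + 1 + (1 + c) = M by omega] at x
      rw [LieRel, wCoef_eq_zero (by omega), Int.cast_zero, zero_smul, add_zero,
        show 1 + (M - 1) = M by omega] at h1
      rw [show b + 1 + c = M - 1 by omega, h1, x, show 1 + (b + 1) = b + 2 by omega] at j
      have := dCoef_one_step (b + 1) c
      rw [show 1 + (b + 1) = b + 2 by omega, show b + 1 + c = M - 1 by omega] at this
      have this' := congrArg (Int.cast : ℤ → K) this
      push_cast at this'
      have hd' : (dCoef 1 (b + 1) : K) ≠ 0 := by exact_mod_cast hd
      rw [LieRel, h0, zero_smul, add_zero, h]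
      apply smul_right_injective E hd'
      simp only
      rw [j, smul_smul, smul_smul, smul_smul, ← sub_smul, this']
    · have j := jacobi_lieRel hw ih 2 b c (by omega) (by omega) hc (by omega)
      have x := hi b (by omega) (2 + c) (by omega) (by omega) (by omega)
      rw [LieRel, wCoef_eq_zero (by omega), Int.cast_zero, zero_smul, add_zero,
        show b + (2 + c) = M by omega] at x
      rw [LieRel, wCoef_eq_zero (by omega), Int.cast_zero, zero_smul, add_zero,
        show 2 + (M - 2) = M by omega] at h2
      rw [show b + c = M - 2 by omega, h2, x, show 2 + b = b + 2 by omega] at j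
      have := dCoef_two_step b c
      rw [show 2 + b = b + 2 by omega, show b + c = M - 2 by omega] at this
      have this' := congrArg (Int.cast : ℤ → K) this
      push_cast at this'
      have hd' : (dCoef 2 b : K) ≠ 0 := by exact_mod_cast hd
      rw [LieRel, h0, zero_smul, add_zero, h]
      apply smul_right_injective E hd'
      simp only
      rw [j, smul_smul, smul_smul, smul_smul, ← sub_smul, this']

/-- In weight `M ≡ 0` modulo `8`, the Jacobi identity leaves a two-dimensional space of brackets,
which is cut down by the antisymmetry of the bracket. -/
theorem lie_low_zero [CharZero K] {e : ℕ → E} {w : E} (hw : ∀ x : E, ⁅x, w⁆ = 0) {k : ℕ}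
    (ih : ∀ q l, 1 ≤ q → 1 ≤ l → q + l < 8 * k + 8 → LieRel K e w q l) :
    ⁅e 2, e (8 * k + 6)⁆ = - ⁅e 1, e (8 * k + 7)⁆ := by
  -- New coordinates on the two unknown brackets: `α` carries the solution `dCoef` (values 1 and -1
  -- at the indices 1 and 2), `β` the solution `b * kTable b` (value 2 at both).
  obtain ⟨α, β, hα, hβ⟩ : ∃ α β : E, ⁅e 1, e (8 * k + 7)⁆ = α + (2 : K) • β ∧
      ⁅e 2, e (8 * k + 6)⁆ = - α + (2 : K) • β := by
    refine ⟨(1 / 2 : K) • (⁅e 1, e (8 * k + 7)⁆ - ⁅e 2, e (8 * k + 6)⁆),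
      (1 / 4 : K) • (⁅e 1, e (8 * k + 7)⁆ + ⁅e 2, e (8 * k + 6)⁆), by module, by module⟩
  have all (b c : ℕ) (hb : 1 ≤ b) (hc : 1 ≤ c) (h : b + c = 8 * k + 8) :
      ⁅e b, e c⁆ = (dCoef b c : K) • α + ((b : K) * (kTable (Fin.ofNat 8 b) : K)) • β := by
    induction b using Nat.strong_induction_on generalizing c with
    | _ b hi =>
      obtain rfl | rfl | hb3 : b = 1 ∨ b = 2 ∨ 3 ≤ b := by omega
      · obtain rfl : c = 8 * k + 7 := by omega
        rw [hα, dCoef_mul_add, show dCoef 1 7 = 1 by decide,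
          show kTable (Fin.ofNat 8 1) = 2 by decide]
        push_cast; module
      · obtain rfl : c = 8 * k + 6 := by omega
        rw [hβ, dCoef_mul_add, show dCoef 2 6 = -1 by decide,
          show kTable (Fin.ofNat 8 2) = 1 by decide]
        push_cast; module
      obtain ⟨b, rfl⟩ : ∃ j, b = j + 2 := ⟨b - 2, by omega⟩
      rcases dCoef_ne_zero b with hd | hd
      · have j := jacobi_lieRel hw ih 1 (b + 1) c le_rfl (by omega) hc (by omega)
        have x := hi (b + 1) (by omega) (1 + c) (by omega) (by omega) (by omega)
        have hs : 1 + Fin.ofNat 8 (b + 1) + Fin.ofNat 8 c = 0 := by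
          have : Fin.ofNat 8 (1 + (b + 1) + c) = 0 := by
            rw [show 1 + (b + 1) + c = 8 * k + 8 by omega]; simp [Fin.ofNat]
          rwa [ofNat8_add, ofNat8_add] at this
        obtain ⟨i1, i2, i3⟩ := kTable_one_step _ _ hs
        rw [show (1 : Fin 8) = Fin.ofNat 8 1 from rfl, ← ofNat8_add, ← ofNat8_add] at i1
        rw [show (1 : Fin 8) = Fin.ofNat 8 1 from rfl, ← ofNat8_add] at i2 i3
        change dCoef 1 (b + 1) * dCoef (1 + (b + 1)) c =
          dCoef (b + 1) c - dCoef 1 c * dCoef (b + 1) (1 + c) at i1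
        change dCoef (b + 1) c * 2 = dCoef 1 (b + 1) * _ at i2
        change -(dCoef 1 c * _) = dCoef 1 (b + 1) * _ at i3
        rw [show b + 1 + c = 8 * k + 7 by omega, hα, x] at j
        rw [show 1 + (b + 1) = b + 2 by omega] at j i1 i2 i3
        have hd' : (dCoef 1 (b + 1) : K) ≠ 0 := by exact_mod_cast hd
        have i1' := congrArg (Int.cast : ℤ → K) i1
        have i2' := congrArg (Int.cast : ℤ → K) i2
        have i3' := congrArg (Int.cast : ℤ → K) i3
        push_cast at i1' i2' i3'
        apply smul_right_injective E hd'
        simp only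
        rw [j]
        push_cast
        -- The factor `b + 2` of `β` splits as `1 + (b + 1)`: the 1 comes from `⁅e 1, e (8 * k +
        -- 7)⁆`, the rest from the bracket with first index `b + 1`.
        linear_combination (norm := module) (-i1') • α + (i2' + ((b : K) + 1) * i3') • β
      · have j := jacobi_lieRel hw ih 2 b c (by omega) (by omega) hc (by omega)
        have x := hi b (by omega) (2 + c) (by omega) (by omega) (by omega)
        have hs : 2 + Fin.ofNat 8 b + Fin.ofNat 8 c = 0 := by
          have : Fin.ofNat 8 (2 + b + c) = 0 := by
            rw [show 2 + b + c = 8 * k + 8 by omega]; simp [Fin.ofNat]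
          rwa [ofNat8_add, ofNat8_add] at this
        obtain ⟨i1, i2, i3⟩ := kTable_two_step _ _ hs
        rw [show (2 : Fin 8) = Fin.ofNat 8 2 from rfl, ← ofNat8_add, ← ofNat8_add] at i1
        rw [show (2 : Fin 8) = Fin.ofNat 8 2 from rfl, ← ofNat8_add] at i2 i3
        change dCoef 2 b * dCoef (2 + b) c = - dCoef b c - dCoef 2 c * dCoef b (2 + c) at i1
        change dCoef b c = dCoef 2 b * _ at i2
        change -(dCoef 2 c * _) = dCoef 2 b * _ at i3
        rw [show b + c = 8 * k + 6 by omega, hβ, x] at j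
        rw [show 2 + b = b + 2 by omega] at j i1 i2 i3
        have hd' : (dCoef 2 b : K) ≠ 0 := by exact_mod_cast hd
        have i1' := congrArg (Int.cast : ℤ → K) i1
        have i2' := congrArg (Int.cast : ℤ → K) i2
        have i3' := congrArg (Int.cast : ℤ → K) i3
        push_cast at i1' i2' i3'
        apply smul_right_injective E hd'
        simp only
        rw [j]
        push_cast
        linear_combination (norm := module) (-i1') • α + (2 * i2' + (b : K) * i3') • β
  -- The second solution is that of the affine central cocycle, which is antisymmetric only in total
  -- weight zero. Comparing the index pairs (1, M - 1) and (M - 1, 1) leaves `2 M β = 0` with `M = 8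
  -- * k + 8`.
  have hlast := all (8 * k + 7) 1 (by omega) le_rfl rfl
  rw [← lie_skew, hα, dCoef_antisymm, dCoef_mul_add, show dCoef 1 7 = 1 by decide,
    show Fin.ofNat 8 (8 * k + 7) = 7 by simp [Fin.ofNat],
    show kTable 7 = 2 by decide] at hlast
  push_cast at hlast
  have h0 : ((2 * (8 * k + 8) : ℕ) : K) • β = 0 := by
    push_cast
    linear_combination (norm := module) -hlast
  have hβ0 : β = 0 := (smul_eq_zero.mp h0).resolve_left (Nat.cast_ne_zero.mpr (by omega))
  rw [hα, hβ, hβ0]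
  module

/-- The sequence generated by `e_1 = x` and `e_2 = y` in the way that `f_1` and `f_2` generate
`𝔫₂`. -/
def genSeq (K : Type u) [Field K] {E : Type v} [LieRing E] [LieAlgebra K E] (x y : E) : ℕ → E
  | 0 => 0
  | 1 => x
  | 2 => y
  | j + 3 => if dCoef 1 (j + 2) = 0 then ((dCoef 2 (j + 1) : K)⁻¹) • ⁅y, genSeq K x y (j + 1)⁆
      else ((dCoef 1 (j + 2) : K)⁻¹) • ⁅x, genSeq K x y (j + 2)⁆

theorem lie_genSeq_one (x y : E) [CharZero K] (j : ℕ) (h : dCoef 1 (j + 2) ≠ 0) :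
    ⁅x, genSeq K x y (j + 2)⁆ = (dCoef 1 (j + 2) : K) • genSeq K x y (j + 3) := by
  rw [genSeq.eq_4, if_neg h, smul_inv_smul₀ (by exact_mod_cast h)]

theorem lie_genSeq_two (x y : E) [CharZero K] (j : ℕ) (h : dCoef 1 (j + 2) = 0) :
    ⁅y, genSeq K x y (j + 1)⁆ = (dCoef 2 (j + 1) : K) • genSeq K x y (j + 3) := by
  have h2 := (dCoef_ne_zero (j + 1)).resolve_left (fun h' => h' h)
  rw [genSeq.eq_4, if_pos h, smul_inv_smul₀ (by exact_mod_cast h2)]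

/-- In weights other than `0, 2, 7` modulo `8`, the bracket `[e_2, e_{M-2}]` is determined by the
Serre relation of degree `3`. -/
theorem lie_two_of_one [CharZero K] {e : ℕ → E} {w : E} (hw : ∀ x : E, ⁅x, w⁆ = 0) {M : ℕ}
    (hM : 6 ≤ M) (ih : ∀ q l, 1 ≤ q → 1 ≤ l → q + l < M → LieRel K e w q l)
    (hr : M % 8 ≠ 0 ∧ M % 8 ≠ 2 ∧ M % 8 ≠ 7)
    (h1 : LieRel K e w 1 (M - 1)) : LieRel K e w 2 (M - 2) := by
  have t1 := jacobi_lieRel hw ih 1 2 (M - 3) (by omega) (by omega) (by omega) (by omega)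
  have t2 := jacobi_lieRel hw ih 2 3 (M - 5) (by omega) (by omega) (by omega) (by omega)
  rw [LieRel, wCoef_eq_zero (by omega), Int.cast_zero, zero_smul, add_zero] at h1 ⊢
  rw [show 1 + (M - 1) = M by omega] at h1
  rw [show 2 + (M - 2) = M by omega]
  rw [show 2 + (M - 3) = M - 1 by omega, show 1 + (M - 3) = M - 2 by omega, h1,
    show dCoef 1 2 = 1 by decide] at t1
  rw [show 3 + (M - 5) = M - 2 by omega, show 2 + (M - 5) = M - 3 by omega,
    show dCoef 2 3 = 0 by decide] at t2
  simp only [Int.cast_zero, zero_smul, Int.cast_one, one_smul, Nat.reduceAdd] at t1 t2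
  -- The left side of `t2` is zero because `dCoef 2 3 = 0` and `w` is central. After the
  -- substitution, `⁅e 2, e (M - 2)⁆` has the coefficient $d_{3,M-5}+d_{2,M-5}d_{1,M-3}$, which
  -- vanishes exactly for the excluded residues 0, 2, 7 of `M`.
  rw [t1] at t2
  generalize ⁅e 2, e (M - 2)⁆ = Y at *
  clear h1 t1 ih
  obtain ⟨k, s, hk, hs⟩ : ∃ k s, M = 8 * k + s ∧ (s = 6 ∨ s = 9 ∨ s = 11 ∨ s = 12 ∨ s = 13) := by
    refine ⟨(M - 6) / 8, (M - 6) % 8 + 6, by omega, by omega⟩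
  rcases hs with rfl | rfl | rfl | rfl | rfl
  · rw [show M - 5 = 8 * k + 1 by omega, show M - 2 = 8 * k + 4 by omega,
      show M - 3 = 8 * k + 3 by omega, show M - 1 = 8 * k + 5 by omega] at *
    simp only [dCoef_mul_add] at *
    simp only [show dCoef 3 1 = -1 by decide, show dCoef 2 1 = -1 by decide,
      show dCoef 2 3 = 0 by decide, show dCoef 1 3 = 1 by decide, show dCoef 1 5 = -2 by decide,
      show dCoef 2 4 = 0 by decide] at *
    push_cast at *
    linear_combination (norm := module) (1 / 2 : K) • t2
  · rw [show M - 5 = 8 * k + 4 by omega, show M - 2 = 8 * k + 7 by omega,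
      show M - 3 = 8 * k + 6 by omega, show M - 1 = 8 * k + 8 by omega] at *
    simp only [dCoef_mul_add] at *
    simp only [show dCoef 3 4 = 3 by decide, show dCoef 2 4 = 0 by decide,
      show dCoef 2 7 = 0 by decide, show dCoef 1 6 = 0 by decide, show dCoef 1 8 = -1 by decide,
      show dCoef 2 6 = -1 by decide] at *
    push_cast at *
    linear_combination (norm := module) (-1 / 3 : K) • t2
  · rw [show M - 5 = 8 * k + 6 by omega, show M - 2 = 8 * k + 9 by omega,
      show M - 3 = 8 * k + 8 by omega, show M - 1 = 8 * k + 10 by omega] at *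
    simp only [dCoef_mul_add] at *
    simp only [show dCoef 3 6 = 1 by decide, show dCoef 2 6 = -1 by decide,
      show dCoef 2 9 = -1 by decide, show dCoef 1 8 = -1 by decide, show dCoef 1 10 = 1 by decide,
      show dCoef 2 8 = 2 by decide] at *
    push_cast at *
    linear_combination (norm := module) (-1 / 2 : K) • t2
  · rw [show M - 5 = 8 * k + 7 by omega, show M - 2 = 8 * k + 10 by omega,
      show M - 3 = 8 * k + 9 by omega, show M - 1 = 8 * k + 11 by omega] at *
    simp only [dCoef_mul_add] at *
    simp only [show dCoef 3 7 = -2 by decide, show dCoef 2 7 = 0 by decide,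
      show dCoef 2 10 = 0 by decide, show dCoef 1 9 = 0 by decide, show dCoef 1 11 = 1 by decide,
      show dCoef 2 9 = -1 by decide] at *
    push_cast at *
    linear_combination (norm := module) (1 / 2 : K) • t2
  · rw [show M - 5 = 8 * k + 8 by omega, show M - 2 = 8 * k + 11 by omega,
      show M - 3 = 8 * k + 10 by omega, show M - 1 = 8 * k + 12 by omega] at *
    simp only [dCoef_mul_add] at *
    simp only [show dCoef 3 8 = 1 by decide, show dCoef 2 8 = 2 by decide,
      show dCoef 2 11 = 0 by decide, show dCoef 1 10 = 1 by decide, show dCoef 1 12 = -3 by decide,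
      show dCoef 2 10 = 0 by decide] at *
    push_cast at *
    linear_combination (norm := module) (-1 / 3 : K) • t2

/-- In weights `2, 7` modulo `8`, the bracket `[e_1, e_{M-1}]` vanishes by the Serre relation of
degree `6`. -/
theorem lie_one_eq_zero [CharZero K] {e : ℕ → E} {w : E} (hw : ∀ x : E, ⁅x, w⁆ = 0) {M : ℕ}
    (hM : 8 ≤ M) (ih : ∀ q l, 1 ≤ q → 1 ≤ l → q + l < M → LieRel K e w q l)
    (hr : M % 8 = 2 ∨ M % 8 = 7) : ⁅e 1, e (M - 1)⁆ = 0 := by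
  have t2 := jacobi_lieRel hw ih 1 2 (M - 3) (by omega) (by omega) (by omega) (by omega)
  have t3 := jacobi_lieRel hw ih 1 3 (M - 4) (by omega) (by omega) (by omega) (by omega)
  have t4 := jacobi_lieRel hw ih 1 4 (M - 5) (by omega) (by omega) (by omega) (by omega)
  have t5 := jacobi_lieRel hw ih 1 5 (M - 6) (by omega) (by omega) (by omega) (by omega)
  have t6 := jacobi_lieRel hw ih 1 6 (M - 7) (by omega) (by omega) (by omega) (by omega)
  rw [show 2 + (M - 3) = M - 1 by omega, show 1 + (M - 3) = M - 2 by omega,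
    show dCoef 1 2 = 1 by decide] at t2
  rw [show 3 + (M - 4) = M - 1 by omega, show 1 + (M - 4) = M - 3 by omega,
    show dCoef 1 3 = 1 by decide] at t3
  rw [show 4 + (M - 5) = M - 1 by omega, show 1 + (M - 5) = M - 4 by omega,
    show dCoef 1 4 = -3 by decide] at t4
  rw [show 5 + (M - 6) = M - 1 by omega, show 1 + (M - 6) = M - 5 by omega,
    show dCoef 1 5 = -2 by decide] at t5
  rw [show 6 + (M - 7) = M - 1 by omega, show 1 + (M - 7) = M - 6 by omega,
    show dCoef 1 6 = 0 by decide] at t6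
  simp only [Nat.reduceAdd] at *
  generalize ⁅e 1, e (M - 1)⁆ = X1 at *
  generalize ⁅e 2, e (M - 2)⁆ = X2 at *
  generalize ⁅e 3, e (M - 3)⁆ = X3 at *
  generalize ⁅e 4, e (M - 4)⁆ = X4 at *
  generalize ⁅e 5, e (M - 5)⁆ = X5 at *
  generalize ⁅e 6, e (M - 6)⁆ = X6 at *
  generalize ⁅e (1 + 6), e (M - 7)⁆ = X7 at *
  clear ih
  -- The relations express `X6` as a multiple of `X1`, and `t6` closes the chain since `dCoef 1 6 =
  -- 0` kills its left side. The outcome is `5 X1 = 0` for `s = 10` and `3 X1 = 0` for `s = 15`.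
  obtain ⟨k, s, hk, hs⟩ : ∃ k s, M = 8 * k + s ∧ (s = 10 ∨ s = 15) := by
    refine ⟨(M - 8) / 8, (M - 8) % 8 + 8, by omega, by omega⟩
  rcases hs with rfl | rfl
  · rw [show M - 3 = 8 * k + 7 by omega] at t2
    rw [show M - 4 = 8 * k + 6 by omega] at t3
    rw [show M - 5 = 8 * k + 5 by omega] at t4
    rw [show M - 6 = 8 * k + 4 by omega] at t5
    rw [show M - 7 = 8 * k + 3 by omega] at t6
    simp only [dCoef_mul_add] at *
    simp only [show dCoef 2 7 = 0 by decide, show dCoef 1 7 = 1 by decide,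
      show dCoef 3 6 = 1 by decide, show dCoef 1 6 = 0 by decide,
      show dCoef 4 5 = 3 by decide, show dCoef 1 5 = -2 by decide,
      show dCoef 5 4 = -3 by decide, show dCoef 1 4 = -3 by decide,
      show dCoef 6 3 = -1 by decide, show dCoef 1 3 = 1 by decide] at *
    push_cast at *
    linear_combination (norm := module) (1 / 5 : K) • t6 + (1 / 10 : K) • t5 - (1 / 10 : K) • t4 - (1 / 5 : K) • t3
  · rw [show M - 3 = 8 * k + 12 by omega] at t2
    rw [show M - 4 = 8 * k + 11 by omega] at t3
    rw [show M - 5 = 8 * k + 10 by omega] at t4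
    rw [show M - 6 = 8 * k + 9 by omega] at t5
    rw [show M - 7 = 8 * k + 8 by omega] at t6
    simp only [dCoef_mul_add] at *
    simp only [show dCoef 2 12 = 0 by decide, show dCoef 1 12 = -3 by decide,
      show dCoef 3 11 = 0 by decide, show dCoef 1 11 = 1 by decide,
      show dCoef 4 10 = 0 by decide, show dCoef 1 10 = 1 by decide,
      show dCoef 5 9 = 2 by decide, show dCoef 1 9 = 0 by decide,
      show dCoef 6 8 = -2 by decide, show dCoef 1 8 = -1 by decide] at *
    push_cast at *
    linear_combination (norm := module) (1 / 3 : K) • t6 - (1 / 6 : K) • t5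

/-- Two elements that satisfy the Serre relations of `𝔫₂`, or of `𝔫₂³`, generate a Lie algebra
with the brackets of that algebra. -/
theorem lieRel_genSeq [CharZero K] {x y w : E} (hw : ∀ v : E, ⁅v, w⁆ = 0) (h3 : ⁅y, ⁅x, y⁆⁆ = w)
    (h6 : ⁅x, ⁅x, ⁅x, ⁅x, ⁅x, y⁆⁆⁆⁆⁆ = 0) (q l : ℕ) (hq : 1 ≤ q) (hl : 1 ≤ l) :
    LieRel K (genSeq K x y) w q l := by
  have e3 : ⁅x, y⁆ = genSeq K x y 3 := by
    have := lie_genSeq_one (K := K) x y 0 (by decide)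
    simpa [show dCoef 1 2 = 1 by decide, genSeq.eq_3] using this
  have e4 : ⁅x, genSeq K x y 3⁆ = genSeq K x y 4 := by
    have := lie_genSeq_one (K := K) x y 1 (by decide)
    simpa [show dCoef 1 3 = 1 by decide] using this
  have e5 : ⁅x, genSeq K x y 4⁆ = (-3 : K) • genSeq K x y 5 := by
    have := lie_genSeq_one (K := K) x y 2 (by decide)
    simpa [show dCoef 1 4 = -3 by decide] using this
  have e6 : ⁅x, genSeq K x y 5⁆ = (-2 : K) • genSeq K x y 6 := by
    have := lie_genSeq_one (K := K) x y 3 (by decide)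
    simpa [show dCoef 1 5 = -2 by decide] using this
  -- The relation of degree 6, read as the bracket of weight 7; this is the one weight that
  -- `lie_one_eq_zero` does not reach.
  have e7 : ⁅x, genSeq K x y 6⁆ = 0 := by
    rw [e3, e4, e5, lie_smul, e6, lie_smul, lie_smul] at h6
    simpa using h6
  rw [e3] at h3
  have e1 : genSeq K x y 1 = x := rfl
  have e2 : genSeq K x y 2 = y := rfl
  obtain ⟨M, hM⟩ : ∃ M, q + l = M := ⟨_, rfl⟩
  induction M using Nat.strong_induction_on generalizing q l with
  | _ M ih =>
    have ih' : ∀ q l, 1 ≤ q → 1 ≤ l → q + l < M → LieRel K (genSeq K x y) w q l :=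
      fun q l hq hl h => ih _ h q l hq hl rfl
    rcases Nat.lt_or_ge M 6 with h | hM6
    -- Weights below 6 are read off from the definition of the first terms; `w` occurs only in
    -- weight 5.
    · have anti (v v' : E) : ⁅v, v'⁆ = - ⁅v', v⁆ := (lie_skew _ _).symm
      have : q < 6 := by omega
      have : l < 6 := by omega
      interval_cases q <;> interval_cases l <;> first | omega | skip
      all_goals simp only [LieRel, dCoef, Fin.ofNat, dTable, wCoef, e1, e2]
      all_goals simp [e3, e4, e5, h3, anti y x, anti _ x, anti _ y]
    · obtain ⟨j, rfl⟩ : ∃ j, M = j + 3 := ⟨M - 3, by omega⟩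
      have r1 : LieRel K (genSeq K x y) w 1 (j + 2) ↔
          ⁅x, genSeq K x y (j + 2)⁆ = (dCoef 1 (j + 2) : K) • genSeq K x y (j + 3) := by
        rw [LieRel, wCoef_eq_zero (by omega), Int.cast_zero, zero_smul, add_zero, e1,
          show 1 + (j + 2) = j + 3 by omega]
      have r2 : LieRel K (genSeq K x y) w 2 (j + 1) ↔
          ⁅y, genSeq K x y (j + 1)⁆ = (dCoef 2 (j + 1) : K) • genSeq K x y (j + 3) := by
        rw [LieRel, wCoef_eq_zero (by omega), Int.cast_zero, zero_smul, add_zero, e2,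
          show 2 + (j + 1) = j + 3 by omega]
      have key : ∀ s : Fin 8, dTable 1 s = 0 ↔ s = 1 ∨ s = 6 := by decide
      have key' : dCoef 1 (j + 2) = 0 ↔ (j + 3) % 8 = 2 ∨ (j + 3) % 8 = 7 := by
        refine (key (Fin.ofNat 8 (j + 2))).trans ?_
        simp only [Fin.ext_iff, Fin.ofNat]
        change (j + 2) % 8 = 1 ∨ (j + 2) % 8 = 6 ↔ _
        omega
      -- One of the two low brackets holds by the definition of `genSeq`. The other one follows from
      -- the relation of degree 6 if `dCoef 1 (j + 2) = 0`, and otherwise from the relation of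
      -- degree 3, or from antisymmetry in weight 0 modulo 8.
      by_cases h1 : dCoef 1 (j + 2) = 0
      · refine lieRel_of_low hw hM6 ih' (r1.mpr ?_) (r2.mpr (lie_genSeq_two x y j h1)) q l hq hl hM
        rw [h1, Int.cast_zero, zero_smul]
        rcases hM6.eq_or_lt with h | h
        · omega
        · obtain rfl | h : j = 4 ∨ 5 ≤ j := by omega
          · exact e7
          · exact lie_one_eq_zero hw (by omega) ih' (key'.mp h1)
      · have h1' := r1.mpr (lie_genSeq_one x y j h1)
        refine lieRel_of_low hw hM6 ih' h1' ?_ q l hq hl hM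
        by_cases h0 : (j + 3) % 8 = 0
        · obtain ⟨k, rfl⟩ : ∃ k, j = 8 * k + 5 := ⟨j / 8, by omega⟩
          have := lie_low_zero hw (k := k) ih'
          refine r2.mpr (this.trans ?_)
          rw [e1, lie_genSeq_one x y (8 * k + 5) h1, ← neg_smul,
            show 8 * k + 5 + 2 = 8 * k + 7 by omega, show 8 * k + 5 + 1 = 8 * k + 6 by omega,
            dCoef_mul_add, dCoef_mul_add,
            show dCoef 1 7 = 1 by decide, show dCoef 2 6 = -1 by decide]
          push_cast; rfl
        · exact lie_two_of_one hw hM6 ih' ⟨h0, by omega, by omega⟩ h1'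

end Presentation

/-! ### The natural grading and the lower central series -/

section Model

/-- The natural degree of `f_j`. -/
def natDeg (j : ℕ) : ℕ :=
  6 * (j / 8) + if j % 8 ≤ 1 then j % 8 else if j % 8 = 7 then 5 else j % 8 - 1

/-- The index `j` weighs `f_1` by 1 and `f_2` by 2, the natural degree weighs both by 1; both are
additive on nonzero brackets. Hence `j - natDeg j` counts the factors `f_2` in `f_j`. -/
theorem natDeg_add {q l : ℕ} (h : dCoef q l ≠ 0) : natDeg (q + l) = natDeg q + natDeg l := by
  have key : ∀ s u : Fin 8, dTable s u ≠ 0 →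
      natDeg (s.val + u.val) = natDeg s.val + natDeg u.val := by decide
  have h2 := key (Fin.ofNat 8 q) (Fin.ofNat 8 l) h
  have e : ∀ k s, natDeg (8 * k + s) = 6 * k + natDeg s := by
    intro k s
    rw [natDeg, natDeg, Nat.mul_add_mod, Nat.mul_add_div (by norm_num)]
    omega
  obtain ⟨k, s, hs, rfl⟩ : ∃ k s, s < 8 ∧ q = 8 * k + s := ⟨q / 8, q % 8, by omega, by omega⟩
  obtain ⟨k', s', hs', rfl⟩ : ∃ k s, s < 8 ∧ l = 8 * k + s := ⟨l / 8, l % 8, by omega, by omega⟩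
  have v1 : (Fin.ofNat 8 (8 * k + s)).val = s := by simp [Fin.ofNat]; omega
  have v2 : (Fin.ofNat 8 (8 * k' + s')).val = s' := by simp [Fin.ofNat]; omega
  rw [v1, v2] at h2
  rw [show 8 * k + s + (8 * k' + s') = 8 * (k + k') + (s + s') by ring, e, e, e, h2]
  ring

theorem natDeg_pos {j : ℕ} (h : 1 ≤ j) : 1 ≤ natDeg j := by
  rw [natDeg]; split_ifs <;> omega

theorem natDeg_eq_one {j : ℕ} (h : natDeg j = 1) : j = 1 ∨ j = 2 := by
  rw [natDeg] at h; split_ifs at h <;> omega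

/-- A Lie algebra with the basis `f_1, f_2, …` and brackets of `𝔫₂`, if `z = 0`, or with the basis
`z, f_1, f_2, …` and brackets of `𝔫₂³`. The maps `C` and `cz` give the coordinates. -/
structure NTwoModel (K : Type u) [Field K] (G : Type v) [LieRing G] [LieAlgebra K G] where
  f : ℕ → G
  z : G
  C : G →ₗ[K] ℕ →₀ K
  cz : G →ₗ[K] K
  C_f : ∀ j, 1 ≤ j → C (f j) = Finsupp.single j 1
  C_z : C z = 0
  cz_f : ∀ j, 1 ≤ j → cz (f j) = 0
  z_or : cz z = 1 ∨ (z = 0 ∧ ∀ x, cz x = 0)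
  C_zero : ∀ x, C x 0 = 0
  eq_sum : ∀ x, x = Finsupp.linearCombination K f (C x) + cz x • z
  lie_f : ∀ q l, 1 ≤ q → 1 ≤ l → LieRel K f z q l
  lie_z : ∀ x : G, ⁅x, z⁆ = 0

namespace NTwoModel

variable {K : Type u} [Field K] {G : Type v} [LieRing G] [LieAlgebra K G] (M : NTwoModel K G)

/-- The span of the basis vectors whose degree satisfies `p`. -/
def sp (p : ℕ → Prop) : Submodule K G :=
  Submodule.span K {x | (∃ j, 1 ≤ j ∧ p (natDeg j) ∧ M.f j = x) ∨ (p 3 ∧ M.z = x)}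

theorem f_mem_sp {p : ℕ → Prop} {j : ℕ} (hj : 1 ≤ j) (h : p (natDeg j)) : M.f j ∈ M.sp p :=
  Submodule.subset_span (Or.inl ⟨j, hj, h, rfl⟩)

theorem z_mem_sp {p : ℕ → Prop} (h : p 3) : M.z ∈ M.sp p :=
  Submodule.subset_span (Or.inr ⟨h, rfl⟩)

theorem sp_le {p : ℕ → Prop} {S : Submodule K G} (hf : ∀ j, 1 ≤ j → p (natDeg j) → M.f j ∈ S)
    (hz : p 3 → M.z ∈ S) : M.sp p ≤ S := by
  refine Submodule.span_le.mpr ?_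
  rintro _ (⟨j, hj, h, rfl⟩ | ⟨h, rfl⟩)
  · exact hf j hj h
  · exact hz h

theorem mem_sp {p : ℕ → Prop} {x : G} :
    x ∈ M.sp p ↔ (∀ j, ¬ p (natDeg j) → M.C x j = 0) ∧ (¬ p 3 → M.cz x = 0) := by
  constructor
  · intro hx
    induction hx using Submodule.span_induction with
    | mem x h =>
      rcases h with ⟨j, hj, h, rfl⟩ | ⟨h, rfl⟩
      · refine ⟨fun i hi => ?_, fun _ => M.cz_f j hj⟩
        rw [M.C_f j hj, Finsupp.single_apply, if_neg]
        rintro rfl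
        exact hi h
      · exact ⟨fun i _ => by rw [M.C_z]; rfl, fun h' => absurd h h'⟩
    | zero => simp
    | add x y _ _ hx hy =>
      exact ⟨fun j hj => by simp [hx.1 j hj, hy.1 j hj], fun h => by simp [hx.2 h, hy.2 h]⟩
    | smul r x _ hx => exact ⟨fun j hj => by simp [hx.1 j hj], fun h => by simp [hx.2 h]⟩
  · rintro ⟨h1, h2⟩
    rw [M.eq_sum x, Finsupp.linearCombination_apply, Finsupp.sum]
    refine add_mem (Submodule.sum_mem _ fun j hj => Submodule.smul_mem _ _ ?_) ?_
    · have hj' := Finsupp.mem_support_iff.mp hj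
      refine M.f_mem_sp ?_ ?_
      · by_contra h
        exact hj' (by rw [show j = 0 by omega]; exact M.C_zero x)
      · by_contra h
        exact hj' (h1 j h)
    · by_cases h : p 3
      · exact Submodule.smul_mem _ _ (M.z_mem_sp h)
      · rw [h2 h, zero_smul]; exact zero_mem _

theorem sp_mono {p q : ℕ → Prop} (h : ∀ k, p k → q k) : M.sp p ≤ M.sp q :=
  M.sp_le (fun _ hj hp => M.f_mem_sp hj (h _ hp)) (fun hp => M.z_mem_sp (h _ hp))

theorem sp_top {x : G} {p : ℕ → Prop} (h : ∀ k, 1 ≤ k → p k) : x ∈ M.sp p := by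
  refine M.mem_sp.mpr ⟨fun j hj => ?_, fun h3 => absurd (h 3 (by norm_num)) h3⟩
  obtain rfl : j = 0 := by
    by_contra h'
    exact hj (h _ (natDeg_pos (by omega)))
  exact M.C_zero x

theorem ext {x y : G} (h : M.C x = M.C y) (h' : M.cz x = M.cz y) : x = y := by
  rw [M.eq_sum x, M.eq_sum y, h, h']

theorem z_lie (x : G) : ⁅M.z, x⁆ = 0 := by rw [← lie_skew, M.lie_z, neg_zero]

theorem lie_mem_sp {p q r : ℕ → Prop} (h : ∀ a b, p a → q b → r (a + b)) {x y : G}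
    (hx : x ∈ M.sp p) (hy : y ∈ M.sp q) : ⁅x, y⁆ ∈ M.sp r := by
  induction hx, hy using Submodule.span_induction₂ with
  | mem_mem x y hx hy =>
    rcases hx with ⟨i, hi, hp, rfl⟩ | ⟨-, rfl⟩
    · rcases hy with ⟨j, hj, hq, rfl⟩ | ⟨-, rfl⟩
      · rw [M.lie_f i j hi hj]
        refine add_mem ?_ ?_
        · by_cases hd : dCoef i j = 0
          · simp [hd]
          · exact Submodule.smul_mem _ _
              (M.f_mem_sp (by omega) (by rw [natDeg_add hd]; exact h _ _ hp hq))
        · have key : natDeg 2 + natDeg 3 = 3 ∧ natDeg 3 + natDeg 2 = 3 := by decide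
          have := h _ _ hp hq
          rw [wCoef]
          split_ifs with h1 h2
          · rw [h1.1, h1.2, key.1] at this
            exact Submodule.smul_mem _ _ (M.z_mem_sp this)
          · rw [h2.1, h2.2, key.2] at this
            exact Submodule.smul_mem _ _ (M.z_mem_sp this)
          · simp
      · rw [M.lie_z]; exact zero_mem _
    · rw [M.z_lie]; exact zero_mem _
  | zero_left y hy => simp
  | zero_right x hx => simp
  | add_left x y z _ _ _ hx hy => rw [add_lie]; exact Submodule.add_mem _ hx hy
  | add_right x y z _ _ _ hx hy => rw [lie_add]; exact Submodule.add_mem _ hx hy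
  | smul_left r x y _ _ h => rw [smul_lie]; exact Submodule.smul_mem _ _ h
  | smul_right r x y _ _ h => rw [lie_smul]; exact Submodule.smul_mem _ _ h

/-- Supports induction on `j`: each basis vector is reached from a smaller index by a generator, and
the natural degree goes up by exactly one. -/
theorem f_eq_lie [CharZero K] {j : ℕ} (hj : 3 ≤ j) :
    ∃ i l, (i = 1 ∨ i = 2) ∧ 1 ≤ l ∧ l < j ∧ i + l = j ∧ natDeg l + 1 = natDeg j ∧
      dCoef i l ≠ 0 ∧ M.f j = (dCoef i l : K)⁻¹ • ⁅M.f i, M.f l⁆ := by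
  obtain ⟨b, rfl⟩ : ∃ b, j = b + 2 := ⟨j - 2, by omega⟩
  rcases dCoef_ne_zero b with hd | hd
  · refine ⟨1, b + 1, Or.inl rfl, by omega, by omega, by omega, ?_, hd, ?_⟩
    · have := natDeg_add hd
      rw [show 1 + (b + 1) = b + 2 by omega, show natDeg 1 = 1 by decide] at this
      omega
    · have hw : wCoef 1 (b + 1) = 0 := by rw [wCoef, if_neg (by omega), if_neg (by omega)]
      rw [M.lie_f 1 (b + 1) le_rfl (by omega), hw, Int.cast_zero, zero_smul, add_zero,
        inv_smul_smul₀ (by exact_mod_cast hd), show 1 + (b + 1) = b + 2 by omega]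
  · refine ⟨2, b, Or.inr rfl, by omega, by omega, by omega, ?_, hd, ?_⟩
    · have := natDeg_add hd
      rw [show 2 + b = b + 2 by omega, show natDeg 2 = 1 by decide] at this
      omega
    -- The cocycle could interfere only at `b = 3`, where `dCoef 2 3 = 0` contradicts `hd`.
    · have hw : wCoef 2 b = 0 := by
        rw [wCoef, if_neg, if_neg (by omega)]
        rintro ⟨-, rfl⟩
        exact hd (by decide)
      rw [M.lie_f 2 b (by omega) (by omega), hw, Int.cast_zero, zero_smul, add_zero,
        inv_smul_smul₀ (by exact_mod_cast hd), show 2 + b = b + 2 by omega]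

theorem lie_f_two_three : ⁅M.f 2, M.f 3⁆ = M.z := by
  rw [M.lie_f 2 3 (by norm_num) (by norm_num), show dCoef 2 3 = 0 by decide,
    show wCoef 2 3 = 1 by decide]
  simp

/-- `𝔫₂` is generated in degree `1`. -/
theorem sp_succ [CharZero K] {k : ℕ} (hk : 1 ≤ k) :
    Submodule.span K {v | ∃ x ∈ M.sp (· = 1), ∃ y ∈ M.sp (· = k), ⁅x, y⁆ = v} =
      M.sp (· = k + 1) := by
  refine le_antisymm (Submodule.span_le.mpr ?_) (M.sp_le ?_ ?_)
  · rintro _ ⟨x, hx, y, hy, rfl⟩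
    exact M.lie_mem_sp (fun a b ha hb => by omega) hx hy
  · intro j hj h
    obtain ⟨i, l, hi, hl, -, -, hdeg, -, e⟩ := M.f_eq_lie (j := j) (by
      by_contra h'
      obtain rfl | rfl : j = 1 ∨ j = 2 := by omega
      · rw [show natDeg 1 = 1 by decide] at h; omega
      · rw [show natDeg 2 = 1 by decide] at h; omega)
    have hi1 : natDeg i = 1 := by rcases hi with rfl | rfl <;> decide
    rw [e]
    exact Submodule.smul_mem _ _ (Submodule.subset_span
      ⟨_, M.f_mem_sp (by omega) hi1, _, M.f_mem_sp hl (by omega), rfl⟩)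
  · intro h
    rw [← M.lie_f_two_three]
    exact Submodule.subset_span ⟨_, M.f_mem_sp (by norm_num) (by decide), _,
      M.f_mem_sp (by norm_num) (by rw [show natDeg 3 = 2 by decide]; omega), rfl⟩

/-- Generation in degree 1 makes the lower central series equal to the degree filtration. The index
`n` starts from zero, hence the strict inequality. -/
theorem mem_lowerCentralSeries [CharZero K] (n : ℕ) (x : G) :
    x ∈ LieModule.lowerCentralSeries K G G n ↔ x ∈ M.sp (n < ·) := by
  induction n generalizing x with
  | zero => simpa using M.sp_top (fun k hk => by omega)
  | succ n ih =>
    rw [LieModule.lowerCentralSeries_succ, ← LieSubmodule.mem_toSubmodule,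
      LieSubmodule.lieIdeal_oper_eq_linear_span']
    constructor
    · intro hx
      refine (Submodule.span_le (p := M.sp (n + 1 < ·))).mpr ?_ hx
      rintro _ ⟨a, -, b, hb, rfl⟩
      exact M.lie_mem_sp (p := (1 ≤ ·)) (fun a b ha hb => by omega)
        (M.sp_top fun k hk => hk) ((ih b).mp hb)
    · intro hx
      have step : ∀ k, n + 1 < k → M.sp (· = k) ≤ Submodule.span K
          {m | ∃ x ∈ (⊤ : LieIdeal K G), ∃ y ∈ LieModule.lowerCentralSeries K G G n, ⁅x, y⁆ = m} := by
        intro k hk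
        obtain ⟨k, rfl⟩ : ∃ l, k = l + 1 := ⟨k - 1, by omega⟩
        rw [← M.sp_succ (by omega)]
        refine Submodule.span_mono ?_
        rintro _ ⟨a, -, b, hb, rfl⟩
        refine ⟨a, trivial, b, (ih b).mpr (M.sp_mono (fun l hl => ?_) hb), rfl⟩
        omega
      exact M.sp_le (fun j hj h => step _ h (M.f_mem_sp hj rfl)) (fun h => step _ h (M.z_mem_sp rfl))
        hx

/-- The projection to the homogeneous component of degree `k`. -/
noncomputable def proj (k : ℕ) : G →ₗ[K] G :=
  Finsupp.linearCombination K M.f ∘ₗ Finsupp.lsum K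
    (fun j => if natDeg j = k then Finsupp.lsingle j else 0) ∘ₗ M.C +
  if k = 3 then M.cz.smulRight M.z else 0

theorem proj_f (k : ℕ) {j : ℕ} (hj : 1 ≤ j) :
    M.proj k (M.f j) = if natDeg j = k then M.f j else 0 := by
  have h : (if k = 3 then M.cz.smulRight M.z else 0 : G →ₗ[K] G) (M.f j) = 0 := by
    split_ifs <;> simp [M.cz_f j hj]
  rw [proj, LinearMap.add_apply, h, LinearMap.comp_apply, LinearMap.comp_apply, M.C_f j hj]
  split_ifs with h <;> simp [h]

theorem proj_z (k : ℕ) : M.proj k M.z = if k = 3 then M.z else 0 := by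
  rw [proj, LinearMap.add_apply, LinearMap.comp_apply, LinearMap.comp_apply, M.C_z]
  rcases M.z_or with h | ⟨h, h'⟩
  · split_ifs <;> simp [h]
  · split_ifs <;> simp [h]

theorem induction_linear {P : G → Prop} (x : G) (hf : ∀ j, 1 ≤ j → P (M.f j)) (hz : P M.z)
    (h0 : P 0) (hadd : ∀ x y, P x → P y → P (x + y)) (hs : ∀ (r : K) x, P x → P (r • x)) :
    P x := by
  have hx : x ∈ M.sp (fun _ => True) := M.sp_top (fun _ _ => trivial)
  induction hx using Submodule.span_induction with
  | mem x h =>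
    rcases h with ⟨j, hj, -, rfl⟩ | ⟨-, rfl⟩
    · exact hf j hj
    · exact hz
  | zero => exact h0
  | add x y _ _ hx hy => exact hadd x y hx hy
  | smul r x _ hx => exact hs r x hx

theorem C_proj (k : ℕ) (x : G) (j : ℕ) :
    M.C (M.proj k x) j = if natDeg j = k then M.C x j else 0 := by
  refine M.induction_linear (P := fun x => M.C (M.proj k x) j = if natDeg j = k then M.C x j else 0)
    x ?_ ?_ ?_ ?_ ?_
  · intro i hi
    rw [M.proj_f k hi]
    split_ifs with h1 h2 h2
    · rfl
    · rw [M.C_f i hi, Finsupp.single_apply, if_neg (by rintro rfl; exact h2 h1)]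
    · rw [M.C_f i hi, Finsupp.single_apply, if_neg (by rintro rfl; exact h1 h2)]; simp
    · simp
  · rw [proj_z]; split_ifs <;> simp [M.C_z]
  · simp
  · intro x y hx hy; rw [map_add, map_add, map_add, Finsupp.add_apply, hx, hy]; split_ifs <;> simp
  · intro r x hx; rw [map_smul, map_smul, map_smul, Finsupp.smul_apply, hx]; split_ifs <;> simp

theorem cz_proj (k : ℕ) (x : G) : M.cz (M.proj k x) = if k = 3 then M.cz x else 0 := by
  refine M.induction_linear (P := fun x => M.cz (M.proj k x) = if k = 3 then M.cz x else 0) x ?_ ?_ ?_ ?_ ?_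
  · intro i hi
    rw [M.proj_f k hi, M.cz_f i hi]
    split_ifs <;> simp [M.cz_f i hi]
  · rw [proj_z]; split_ifs <;> simp
  · simp
  · intro x y hx hy; rw [map_add, map_add, map_add, hx, hy]; split_ifs <;> simp
  · intro r x hx; rw [map_smul, map_smul, map_smul, hx]; split_ifs <;> simp

theorem proj_mem (k : ℕ) (x : G) : M.proj k x ∈ M.sp (· = k) := by
  refine M.mem_sp.mpr ⟨fun j hj => ?_, fun h => ?_⟩
  · rw [C_proj, if_neg hj]
  · rw [cz_proj, if_neg (by omega)]

theorem proj_eq_self {k : ℕ} {x : G} (hx : x ∈ M.sp (· = k)) : M.proj k x = x := by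
  obtain ⟨h1, h2⟩ := M.mem_sp.mp hx
  refine M.ext (Finsupp.ext fun j => ?_) ?_
  · rw [C_proj]; split_ifs with h
    · rfl
    · exact (h1 j h).symm
  · rw [cz_proj]; split_ifs with h
    · rfl
    · exact (h2 (by omega)).symm

theorem proj_eq_zero {k l : ℕ} (hkl : k ≠ l) {x : G} (hx : x ∈ M.sp (· = l)) :
    M.proj k x = 0 := by
  obtain ⟨h1, h2⟩ := M.mem_sp.mp hx
  refine M.ext (Finsupp.ext fun j => ?_) ?_
  · rw [C_proj, map_zero]; split_ifs with h
    · exact h1 j (by omega)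
    · rfl
  · rw [cz_proj, map_zero]; split_ifs with h
    · exact h2 (by omega)
    · rfl

theorem sub_proj_mem {k : ℕ} {x : G} (hx : x ∈ M.sp (k < ·)) :
    x - M.proj (k + 1) x ∈ M.sp (k + 1 < ·) := by
  obtain ⟨h1, h2⟩ := M.mem_sp.mp hx
  refine M.mem_sp.mpr ⟨fun j hj => ?_, fun h => ?_⟩
  · rw [map_sub, Finsupp.sub_apply, C_proj]
    split_ifs with h
    · exact sub_self _
    · rw [h1 j (by omega), sub_zero]
  · rw [map_sub, cz_proj]
    split_ifs with h'
    · exact sub_self _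
    · rw [h2 (by omega), sub_zero]

/-- The homomorphism defined by a system of elements with the relations of the basis. -/
theorem exists_lift {E : Type*} [LieRing E] [LieAlgebra K E] (e : ℕ → E) (w : E)
    (hw : ∀ x : E, ⁅x, w⁆ = 0) (hwz : M.z = 0 → w = 0)
    (he : ∀ q l, 1 ≤ q → 1 ≤ l → LieRel K e w q l) :
    ∃ Ψ : G →ₗ⁅K⁆ E, (∀ j, 1 ≤ j → Ψ (M.f j) = e j) ∧ Ψ M.z = w := by
  let T : G →ₗ[K] E := Finsupp.linearCombination K e ∘ₗ M.C + M.cz.smulRight w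
  have hTf (j : ℕ) (hj : 1 ≤ j) : T (M.f j) = e j := by
    simp [T, M.C_f j hj, M.cz_f j hj]
  have hTz : T M.z = w := by
    rcases M.z_or with h | ⟨h, -⟩
    · simp [T, M.C_z, h]
    · rw [hwz h, h, map_zero]
  have hw' (x : E) : ⁅w, x⁆ = 0 := by rw [← lie_skew, hw, neg_zero]
  refine ⟨{ T with map_lie' := ?_ }, hTf, hTz⟩
  intro x y
  change T ⁅x, y⁆ = ⁅T x, T y⁆
  refine M.induction_linear (P := fun x => T ⁅x, y⁆ = ⁅T x, T y⁆) x ?_ ?_ ?_ ?_ ?_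
  · intro i hi
    refine M.induction_linear (P := fun y => T ⁅M.f i, y⁆ = ⁅T (M.f i), T y⁆) y ?_ ?_ ?_ ?_ ?_
    · intro j hj
      rw [M.lie_f i j hi hj, map_add, map_smul, map_smul, hTf _ hi, hTf _ hj, hTf _ (by omega),
        hTz, he i j hi hj]
    · rw [M.lie_z, map_zero, hTz, hw]
    · simp
    · intro x y hx hy; rw [lie_add, map_add, map_add, lie_add, hx, hy]
    · intro r x hx; rw [lie_smul, map_smul, map_smul, lie_smul, hx]
  · rw [M.z_lie, map_zero, hTz, hw']
  · simp
  · intro x y hx hy; rw [add_lie, map_add, map_add, add_lie, hx, hy]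
  · intro r x hx; rw [smul_lie, map_smul, map_smul, smul_lie, hx]

end NTwoModel
end Model

/-! ### Quotients, Carnot gradings and the degree filtration -/

section Quotients

variable {K : Type*} [Field K] {G : Type*} [LieRing G] [LieAlgebra K G]

/-- The quotient map as a homomorphism of Lie algebras. -/
def quotMk (J : LieIdeal K G) : G →ₗ⁅K⁆ G ⧸ J :=
  { J.toSubmodule.mkQ with map_lie' := rfl }

theorem quotMk_surjective (J : LieIdeal K G) : Function.Surjective (quotMk J) :=
  J.toSubmodule.mkQ_surjective

theorem quotMk_eq_zero {J : LieIdeal K G} {x : G} : quotMk J x = 0 ↔ x ∈ J :=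
  Submodule.Quotient.mk_eq_zero J.toSubmodule

/-- The homomorphism between the quotients by two ideals one of which contains the other. -/
def quotFactor {J J' : LieIdeal K G} (h : J ≤ J') : G ⧸ J →ₗ⁅K⁆ G ⧸ J' :=
  { Submodule.mapQ J.toSubmodule J'.toSubmodule LinearMap.id h with
    map_lie' := by rintro ⟨x⟩ ⟨y⟩; rfl }

theorem quotFactor_quotMk {J J' : LieIdeal K G} (h : J ≤ J') (x : G) :
    quotFactor h (quotMk J x) = quotMk J' x := rfl

theorem nonempty_equiv_quot {E : Type*} [LieRing E] [LieAlgebra K E] (Ψ : G →ₗ⁅K⁆ E)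
    (hΨ : Function.Surjective Ψ) (J : LieIdeal K G) (hJ : ∀ x, Ψ x = 0 ↔ x ∈ J) :
    Nonempty (E ≃ₗ⁅K⁆ G ⧸ J) := by
  obtain rfl : Ψ.ker = J := by ext x; rw [LieHom.mem_ker, hJ]
  have e := Ψ.quotKerEquivRange
  rw [(LieHom.range_eq_top Ψ).mpr hΨ] at e
  exact ⟨LieSubalgebra.topEquiv.symm.trans e.symm⟩

variable {E : Type*} [LieRing E] [LieAlgebra K E] {Q : Type*} [LieRing Q] [LieAlgebra K Q]

theorem map_mem_lcs (f : E →ₗ⁅K⁆ Q) {k : ℕ} {x : E}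
    (hx : x ∈ LieModule.lowerCentralSeries K E E k) :
    f x ∈ LieModule.lowerCentralSeries K Q Q k :=
  LieIdeal.map_lowerCentralSeries_le k (LieIdeal.mem_map hx)

theorem exists_lift_lcs {f : E →ₗ⁅K⁆ Q} (hf : Function.Surjective f) {k : ℕ} {y : Q}
    (hy : y ∈ LieModule.lowerCentralSeries K Q Q k) :
    ∃ x ∈ LieModule.lowerCentralSeries K E E k, f x = y := by
  rw [← LieIdeal.lowerCentralSeries_map_eq k hf] at hy
  obtain ⟨x, hx⟩ := LieIdeal.mem_map_of_surjective hf hy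
  exact ⟨x, x.2, hx⟩

theorem lie_top_mem_lcs {k : ℕ} (x : E) {y : E} (hy : y ∈ LieModule.lowerCentralSeries K E E k) :
    ⁅x, y⁆ ∈ LieModule.lowerCentralSeries K E E (k + 1) := by
  rw [LieModule.lowerCentralSeries_succ]
  exact LieSubmodule.lie_mem_lie trivial hy

/-- Induction on `a` with the Jacobi identity. The extra 1 in the index comes from numbering the
series from zero. -/
theorem lie_mem_lcs {a b : ℕ} {x y : E} (hx : x ∈ LieModule.lowerCentralSeries K E E a)
    (hy : y ∈ LieModule.lowerCentralSeries K E E b) :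
    ⁅x, y⁆ ∈ LieModule.lowerCentralSeries K E E (a + b + 1) := by
  induction a generalizing x y b with
  | zero => rw [zero_add]; exact lie_top_mem_lcs x hy
  | succ a ih =>
    rw [LieModule.lowerCentralSeries_succ, ← LieSubmodule.mem_toSubmodule,
      LieSubmodule.lieIdeal_oper_eq_linear_span'] at hx
    induction hx using Submodule.span_induction with
    | mem x h =>
      obtain ⟨u, -, v, hv, rfl⟩ := h
      rw [lie_lie]
      refine sub_mem ?_ ?_
      · have := lie_top_mem_lcs u (ih hv hy)
        rwa [show a + b + 1 + 1 = a + 1 + b + 1 by omega] at this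
      · have := ih hv (lie_top_mem_lcs u hy)
        rwa [show a + (b + 1) + 1 = a + 1 + b + 1 by omega] at this
    | zero => rw [zero_lie]; exact zero_mem _
    | add x x' _ _ h h' => rw [add_lie]; exact add_mem h h'
    | smul r x _ h => rw [smul_lie]; exact SMulMemClass.smul_mem r h

namespace IsCarnotGrading

variable {N : ℕ} {𝒜 : ℕ → Submodule K E} (h : IsCarnotGrading K N 𝒜)
include h

theorem mem_lcs {k : ℕ} {x : E} (hx : x ∈ 𝒜 (k + 1)) :
    x ∈ LieModule.lowerCentralSeries K E E k := by
  induction k generalizing x with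
  | zero => rw [LieModule.lowerCentralSeries_zero]; trivial
  | succ k ih =>
    rcases Nat.lt_or_ge (k + 1) N with hk | hk
    · rw [← h.span_lie (k + 1) (by omega) hk] at hx
      refine (Submodule.span_le
        (p := (LieModule.lowerCentralSeries K E E (k + 1)).toSubmodule)).mpr ?_ hx
      rintro _ ⟨u, -, v, hv, rfl⟩
      exact lie_top_mem_lcs u (ih hv)
    · rw [h.eq_bot _ (Or.inr (by omega))] at hx
      rw [(Submodule.mem_bot K).mp hx]
      exact zero_mem _

theorem iSup_eq_top : iSup 𝒜 = ⊤ := h.isInternal.submodule_iSup_eq_top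

/-- Together with `mem_lcs` this shows that all Carnot gradings of `E` have the same degree
filtration, namely the lower central series. -/
theorem mem_tail {k : ℕ} {x : E} (hx : x ∈ LieModule.lowerCentralSeries K E E k) :
    x ∈ ⨆ i, ⨆ (_ : k < i), 𝒜 i := by
  induction k generalizing x with
  | zero =>
    have hx : x ∈ iSup 𝒜 := by rw [h.iSup_eq_top]; trivial
    refine (iSup_le fun i => ?_ : iSup 𝒜 ≤ _) hx
    rcases Nat.eq_zero_or_pos i with rfl | hi
    · rw [h.eq_bot 0 (Or.inl rfl)]; exact bot_le
    · exact le_iSup₂_of_le i hi le_rfl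
  | succ k ih =>
    rw [LieModule.lowerCentralSeries_succ, ← LieSubmodule.mem_toSubmodule,
      LieSubmodule.lieIdeal_oper_eq_linear_span'] at hx
    refine (Submodule.span_le (p := ⨆ i, ⨆ (_ : k + 1 < i), 𝒜 i)).mpr ?_ hx
    rintro _ ⟨u, -, v, hv, rfl⟩
    have hu : u ∈ iSup 𝒜 := by rw [h.iSup_eq_top]; trivial
    have hv' := ih hv
    induction hu using Submodule.iSup_induction' with
    | mem i u hu =>
      rcases Nat.eq_zero_or_pos i with rfl | hi
      · rw [h.eq_bot 0 (Or.inl rfl)] at hu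
        rw [(Submodule.mem_bot K).mp hu, zero_lie]; exact zero_mem _
      have : (⨆ i, ⨆ (_ : k < i), 𝒜 i) ≤
          (⨆ i, ⨆ (_ : k + 1 < i), 𝒜 i).comap (LieAlgebra.ad K E u) := by
        refine iSup₂_le fun j hj y hy => ?_
        exact (le_iSup₂_of_le (i + j) (by omega) le_rfl : 𝒜 (i + j) ≤ _) (h.lie_mem i j u hu y hy)
      exact this hv'
    | zero => rw [zero_lie]; exact zero_mem _
    | add u u' _ _ h h' => rw [add_lie]; exact add_mem h h'

/-- `lowerCentralSeries k` consists of the degrees above `k`, which meet `𝒜 k` trivially. This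
replaces any compatibility between the gradings of different algebras. -/
theorem eq_zero {k : ℕ} {x : E} (hx : x ∈ 𝒜 k)
    (hx' : x ∈ LieModule.lowerCentralSeries K E E k) : x = 0 := by
  have hd := h.isInternal.submodule_iSupIndep k
  refine Submodule.disjoint_def.mp hd x hx ?_
  exact (iSup₂_le fun i hi => le_iSup₂_of_le i (by omega) le_rfl :
    (⨆ i, ⨆ (_ : k < i), 𝒜 i) ≤ _) (h.mem_tail hx')

theorem lcs_eq_zero {x : E} (hx : x ∈ LieModule.lowerCentralSeries K E E N) : x = 0 := by
  refine (Submodule.mem_bot K).mp ((iSup₂_le fun i hi => ?_ :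
    (⨆ i, ⨆ (_ : N < i), 𝒜 i) ≤ ⊥) (h.mem_tail hx))
  rw [h.eq_bot i (Or.inr hi)]

theorem exists_component_one (x : E) :
    ∃ y ∈ 𝒜 1, x - y ∈ LieModule.lowerCentralSeries K E E 1 := by
  have hx : x ∈ iSup 𝒜 := by rw [h.iSup_eq_top]; trivial
  induction hx using Submodule.iSup_induction' with
  | mem i x hx =>
    obtain rfl | rfl | hi : i = 0 ∨ i = 1 ∨ 2 ≤ i := by omega
    · rw [h.eq_bot 0 (Or.inl rfl)] at hx
      exact ⟨0, zero_mem _, by rw [(Submodule.mem_bot K).mp hx, sub_zero]; exact zero_mem _⟩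
    · exact ⟨x, hx, by rw [sub_self]; exact zero_mem _⟩
    · obtain ⟨i, rfl⟩ : ∃ j, i = j + 1 := ⟨i - 1, by omega⟩
      refine ⟨0, zero_mem _, ?_⟩
      rw [sub_zero]
      exact LieModule.antitone_lowerCentralSeries K E E (by omega : 1 ≤ i) (h.mem_lcs hx)
  | zero => exact ⟨0, zero_mem _, by rw [sub_zero]; exact zero_mem _⟩
  | add x x' _ _ h h' =>
    obtain ⟨y, hy, e⟩ := h
    obtain ⟨y', hy', e'⟩ := h'
    refine ⟨y + y', add_mem hy hy', ?_⟩
    rw [add_sub_add_comm]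
    exact add_mem e e'

theorem subalgebra_eq_top {S : LieSubalgebra K E} (hS : 𝒜 1 ≤ S.toSubmodule) : S = ⊤ := by
  have all : ∀ i, 𝒜 i ≤ S.toSubmodule := by
    intro i
    induction i with
    | zero => rw [h.eq_bot 0 (Or.inl rfl)]; exact bot_le
    | succ i ih =>
      rcases Nat.eq_zero_or_pos i with rfl | hi
      · exact hS
      rcases Nat.lt_or_ge i N with hN | hN
      · rw [← h.span_lie i hi hN, Submodule.span_le]
        rintro _ ⟨u, hu, v, hv, rfl⟩
        exact S.lie_mem (hS hu) (ih hv)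
      · rw [h.eq_bot _ (Or.inr (by omega))]; exact bot_le
  have : (⊤ : Submodule K E) ≤ S.toSubmodule := by rw [← h.iSup_eq_top]; exact iSup_le all
  exact eq_top_iff.mpr fun x _ => this trivial

end IsCarnotGrading

namespace NTwoModel

variable (M : NTwoModel K G) [CharZero K]

/-- A crude bound, used only to see that the quotients are finite-dimensional. -/
theorem lt_natDeg {N j : ℕ} (h : 2 * N < j) : N < natDeg j := by
  rw [natDeg]; split_ifs <;> omega

theorem isCarnotGrading_quot {N : ℕ} (J : LieIdeal K G)
    (hP : ∀ k, ∀ x ∈ J, M.proj k x ∈ J) (hF : ∀ x ∈ M.sp (N < ·), x ∈ J)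
    (hN : ∃ x ∈ M.sp (· = N), x ∉ J) :
    IsCarnotGrading K N (fun k => (M.sp (· = k)).map (quotMk J : G →ₗ[K] G ⧸ J)) := by
  have zero_of {k : ℕ} (hk : k = 0 ∨ N < k) {x : G} (hx : x ∈ M.sp (· = k)) : x ∈ J := by
    rcases hk with rfl | hk
    · obtain rfl : x = 0 := by
        obtain ⟨h1, h2⟩ := M.mem_sp.mp hx
        refine M.ext (Finsupp.ext fun j => ?_) ?_
        · rcases Nat.eq_zero_or_pos j with rfl | hj
          · exact (M.C_zero x).trans (M.C_zero 0).symm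
          · rw [map_zero]
            exact h1 j (by have := natDeg_pos hj; omega)
        · rw [map_zero]; exact h2 (by norm_num)
      exact zero_mem _
    · exact hF x (M.sp_mono (fun l hl => by omega) hx)
  refine ⟨?_, ?_, ?_, ?_, ?_, ?_⟩
  · rw [DirectSum.isInternal_submodule_iff_iSupIndep_and_iSup_eq_top]
    constructor
    · intro i
      have hPi : J.toSubmodule ≤ J.toSubmodule.comap (M.proj i) := fun x hx => hP i x hx
      -- The projection descends to the quotient, where it is the identity on the component `i` and
      -- zero on the others; this gives independence.
      let p := Submodule.mapQ J.toSubmodule J.toSubmodule (M.proj i) hPi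
      have hp (x : G) : p (quotMk J x) = quotMk J (M.proj i x) := rfl
      rw [Submodule.disjoint_def]
      rintro _ ⟨x, hx, rfl⟩ h2
      have hle : (⨆ j, ⨆ (_ : j ≠ i), (M.sp (· = j)).map (quotMk J : G →ₗ[K] G ⧸ J)) ≤
          LinearMap.ker p := by
        refine iSup₂_le fun j hj => ?_
        rintro _ ⟨y, hy, rfl⟩
        rw [LinearMap.mem_ker]
        change p (quotMk J y) = 0
        rw [hp, M.proj_eq_zero hj.symm hy, map_zero]
      have := hle h2
      rw [LinearMap.mem_ker] at this
      change p (quotMk J x) = 0 at this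
      rwa [hp, M.proj_eq_self hx] at this
    · rw [eq_top_iff]
      rintro y -
      obtain ⟨x, rfl⟩ := quotMk_surjective J y
      refine M.induction_linear (P := fun x => quotMk J x ∈ _) x ?_ ?_ ?_ ?_ ?_
      · exact fun j hj => Submodule.mem_iSup_of_mem (natDeg j) ⟨_, M.f_mem_sp hj rfl, rfl⟩
      · exact Submodule.mem_iSup_of_mem 3 ⟨_, M.z_mem_sp rfl, rfl⟩
      · rw [map_zero]; exact zero_mem _
      · intro x y hx hy; rw [map_add]; exact add_mem hx hy
      · intro r x hx; rw [map_smul]; exact Submodule.smul_mem _ _ hx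
  · intro i hi
    rw [eq_bot_iff]
    rintro _ ⟨x, hx, rfl⟩
    exact (Submodule.mem_bot K).mpr (quotMk_eq_zero.mpr (zero_of hi hx))
  · rintro i j _ ⟨x, hx, rfl⟩ _ ⟨y, hy, rfl⟩
    exact ⟨⁅x, y⁆, M.lie_mem_sp (fun a b ha hb => by omega) hx hy, LieHom.map_lie _ _ _⟩
  · intro i hi _
    rw [← M.sp_succ hi, Submodule.map_span]
    congr 1
    ext v
    constructor
    · rintro ⟨_, ⟨x, hx, rfl⟩, _, ⟨y, hy, rfl⟩, rfl⟩
      exact ⟨⁅x, y⁆, ⟨x, hx, y, hy, rfl⟩, LieHom.map_lie _ _ _⟩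
    · rintro ⟨_, ⟨x, hx, y, hy, rfl⟩, rfl⟩
      exact ⟨_, ⟨x, hx, rfl⟩, _, ⟨y, hy, rfl⟩, (LieHom.map_lie _ _ _).symm⟩
  · rintro _ ⟨x, hx, rfl⟩ _ ⟨y, hy, rfl⟩
    refine (LieHom.map_lie (quotMk J) _ _).symm.trans (quotMk_eq_zero.mpr ?_)
    exact hF _ (M.lie_mem_sp (fun a b ha hb => by omega) hx hy)
  · obtain ⟨x, hx, hxJ⟩ := hN
    intro h
    refine hxJ (quotMk_eq_zero.mp ((Submodule.mem_bot K).mp ?_))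
    rw [← h]
    exact ⟨x, hx, rfl⟩

theorem isCarnot_quot {N : ℕ} (J : LieIdeal K G)
    (hP : ∀ k, ∀ x ∈ J, M.proj k x ∈ J) (hF : ∀ x ∈ M.sp (N < ·), x ∈ J)
    (hN : ∃ x ∈ M.sp (· = N), x ∉ J) : IsCarnot K (G ⧸ J) N := by
  refine ⟨⟨?_⟩, _, M.isCarnotGrading_quot J hP hF hN⟩
  rw [Submodule.fg_def]
  refine ⟨insert (quotMk J M.z) ((fun j => quotMk J (M.f j)) '' Set.Iic (2 * N)),
    ((Set.finite_Iic _).image _).insert _, ?_⟩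
  rw [eq_top_iff]
  rintro y -
  obtain ⟨x, rfl⟩ := quotMk_surjective J y
  refine M.induction_linear (P := fun x => quotMk J x ∈ _) x ?_ ?_ ?_ ?_ ?_
  · intro j hj
    rcases Nat.lt_or_ge (2 * N) j with h | h
    · rw [quotMk_eq_zero.mpr (hF _ (M.f_mem_sp hj (lt_natDeg h)))]; exact zero_mem _
    · exact Submodule.subset_span (Or.inr ⟨j, h, rfl⟩)
  · exact Submodule.subset_span (Or.inl rfl)
  · rw [map_zero]; exact zero_mem _
  · intro x y hx hy; rw [map_add]; exact add_mem hx hy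
  · intro r x hx; rw [map_smul]; exact Submodule.smul_mem _ _ hx

end NTwoModel

/-- The kernel of `G ⧸ J → G ⧸ J'` is the image of `J'`, and surjections carry the lower central
series onto the lower central series. -/
theorem carnotExtends_quot {n N : ℕ} {J J' : LieIdeal K G} (hJ : J ≤ J')
    (hJ' : J' = LieModule.lowerCentralSeries K G G n) (h : IsCarnot K (G ⧸ J) N) :
    CarnotExtends K (G ⧸ J') n N (G ⧸ J) := by
  refine ⟨h, quotFactor hJ, ?_, ?_⟩
  · intro y
    obtain ⟨x, rfl⟩ := quotMk_surjective J' y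
    exact ⟨quotMk J x, rfl⟩
  · ext y
    obtain ⟨x, rfl⟩ := quotMk_surjective J y
    rw [LieHom.mem_ker, quotFactor_quotMk, quotMk_eq_zero]
    constructor
    · intro hx
      rw [hJ'] at hx
      exact map_mem_lcs _ hx
    · intro hx
      obtain ⟨x', hx', e⟩ := exists_lift_lcs (quotMk_surjective J) hx
      rw [← sub_eq_zero, ← map_sub, quotMk_eq_zero] at e
      have := sub_mem (hJ' ▸ hx' : x' ∈ J') (hJ e)
      rwa [sub_sub_cancel] at this

end Quotients

/-! ### Extensions as graded images of `𝔫₂` or `𝔫₂³` -/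

section GradedHom

variable {K : Type*} [Field K] {G : Type*} [LieRing G] [LieAlgebra K G]
  {E : Type*} [LieRing E] [LieAlgebra K E] {Q : Type*} [LieRing Q] [LieAlgebra K Q]

/-- `y` is homogeneous of degree `k`, and its image agrees with that of `g` up to terms of higher
degree. -/
def HomogLift (θ : G →ₗ⁅K⁆ Q) (π : E →ₗ⁅K⁆ Q) (𝒜 : ℕ → Submodule K E) (k : ℕ) (g : G) (y : E) :
    Prop :=
  y ∈ 𝒜 k ∧ π y - θ g ∈ LieModule.lowerCentralSeries K Q Q k

variable {θ : G →ₗ⁅K⁆ Q} {π : E →ₗ⁅K⁆ Q} {𝒜 : ℕ → Submodule K E} {N : ℕ}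

theorem HomogLift.add {k : ℕ} {g g' : G} {y y' : E} (h : HomogLift θ π 𝒜 k g y)
    (h' : HomogLift θ π 𝒜 k g' y') : HomogLift θ π 𝒜 k (g + g') (y + y') := by
  refine ⟨add_mem h.1 h'.1, ?_⟩
  rw [map_add, map_add, add_sub_add_comm]
  exact add_mem h.2 h'.2

theorem HomogLift.smul {k : ℕ} {g : G} {y : E} (r : K) (h : HomogLift θ π 𝒜 k g y) :
    HomogLift θ π 𝒜 k (r • g) (r • y) := by
  refine ⟨Submodule.smul_mem _ _ h.1, ?_⟩
  rw [map_smul, map_smul, ← smul_sub]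
  exact SMulMemClass.smul_mem r h.2

theorem HomogLift.lie (hA : IsCarnotGrading K N 𝒜) {j k : ℕ} (hj : 1 ≤ j) (hk : 1 ≤ k)
    {g g' : G} {y y' : E} (h : HomogLift θ π 𝒜 j g y) (h' : HomogLift θ π 𝒜 k g' y') :
    HomogLift θ π 𝒜 (j + k) ⁅g, g'⁆ ⁅y, y'⁆ := by
  refine ⟨hA.lie_mem _ _ _ h.1 _ h'.1, ?_⟩
  obtain ⟨j, rfl⟩ : ∃ i, j = i + 1 := ⟨j - 1, by omega⟩
  obtain ⟨k, rfl⟩ : ∃ i, k = i + 1 := ⟨k - 1, by omega⟩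
  -- In each summand one factor is an error term, which lies one step deeper than its degree
  -- requires.
  have e : π ⁅y, y'⁆ - θ ⁅g, g'⁆ = ⁅π y - θ g, π y'⁆ + ⁅π y - (π y - θ g), π y' - θ g'⁆ := by
    rw [LieHom.map_lie, LieHom.map_lie, sub_sub_cancel, lie_sub, sub_lie]; abel
  have m1 : π y ∈ LieModule.lowerCentralSeries K Q Q j := map_mem_lcs π (hA.mem_lcs h.1)
  have m2 : π y' ∈ LieModule.lowerCentralSeries K Q Q k := map_mem_lcs π (hA.mem_lcs h'.1)
  have m3 : π y - (π y - θ g) ∈ LieModule.lowerCentralSeries K Q Q j :=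
    sub_mem m1 (LieModule.antitone_lowerCentralSeries K Q Q (Nat.le_succ j) h.2)
  rw [e]
  refine add_mem ?_ ?_
  · have := lie_mem_lcs h.2 m2
    rwa [show j + 1 + k + 1 = j + 1 + (k + 1) by omega] at this
  · have := lie_mem_lcs m3 h'.2
    rwa [show j + (k + 1) + 1 = j + 1 + (k + 1) by omega] at this

/-- Relations of `Q` of degree at most `m` lift to `E`: `π y` lies one step deeper than degree `k`,
the kernel of `π` has only degrees above `m`, so `y` is both of degree `k` and of degree above `k`.
-/
theorem HomogLift.eq_zero (hA : IsCarnotGrading K N 𝒜) {m : ℕ} (hπ : Function.Surjective π)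
    (hker : ∀ x, π x = 0 → x ∈ LieModule.lowerCentralSeries K E E m) {k : ℕ} (hk : k ≤ m) {g : G}
    (hg : θ g = 0) {y : E} (h : HomogLift θ π 𝒜 k g y) : y = 0 := by
  obtain ⟨h1, h2⟩ := h
  rw [hg, sub_zero] at h2
  obtain ⟨x, hx, e⟩ := exists_lift_lcs hπ h2
  have := LieModule.antitone_lowerCentralSeries K E E hk
    (hker (y - x) (by rw [map_sub, e, sub_self]))
  refine hA.eq_zero h1 ?_
  have := add_mem this hx
  rwa [sub_add_cancel] at this

theorem exists_homogLift_one (hA : IsCarnotGrading K N 𝒜) (hπ : Function.Surjective π) (g : G) :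
    ∃ y, HomogLift θ π 𝒜 1 g y := by
  obtain ⟨x, hx⟩ := hπ (θ g)
  obtain ⟨y, hy, e⟩ := hA.exists_component_one x
  refine ⟨y, hy, ?_⟩
  rw [← hx, ← map_sub, ← neg_sub, map_neg]
  exact neg_mem (map_mem_lcs π e)

/-- The centralizer of `w` is a subalgebra, and `𝒜 1` generates `E`. -/
theorem eq_zero_of_generators (hA : IsCarnotGrading K N 𝒜) {x y w : E}
    (hxy : 𝒜 1 ≤ Submodule.span K {x, y}) (hx : ⁅x, w⁆ = 0) (hy : ⁅y, w⁆ = 0) (v : E) :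
    ⁅v, w⁆ = 0 := by
  let S : LieSubalgebra K E :=
    { carrier := {v | ⁅v, w⁆ = 0}
      add_mem' := fun {a b} ha hb => by
        change ⁅a + b, w⁆ = 0
        rw [add_lie, show ⁅a, w⁆ = 0 from ha, show ⁅b, w⁆ = 0 from hb, add_zero]
      zero_mem' := zero_lie w
      smul_mem' := fun r a ha => by
        change ⁅r • a, w⁆ = 0
        rw [smul_lie, show ⁅a, w⁆ = 0 from ha, smul_zero]
      lie_mem' := fun {a b} ha hb => by
        change ⁅⁅a, b⁆, w⁆ = 0
        rw [lie_lie, show ⁅a, w⁆ = 0 from ha, show ⁅b, w⁆ = 0 from hb, lie_zero, lie_zero, sub_zero] }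
  have hS : S = ⊤ := by
    refine hA.subalgebra_eq_top (hxy.trans (Submodule.span_le.mpr ?_))
    rintro _ (rfl | rfl)
    · exact hx
    · exact hy
  have : v ∈ S := by rw [hS]; trivial
  exact this

/-- A Carnot algebra that agrees with a quotient of `𝔫₂` or `𝔫₂³` up to degree `6` at least is the
image of that algebra under a graded homomorphism. -/
theorem NTwoModel.exists_graded_hom [CharZero K] (M : NTwoModel K G) (θ : G →ₗ⁅K⁆ Q)
    (hθ : Function.Surjective θ) (π : E →ₗ⁅K⁆ Q) (hπ : Function.Surjective π) {m : ℕ} (hm : 6 ≤ m)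
    (hker : ∀ x, π x = 0 → x ∈ LieModule.lowerCentralSeries K E E m)
    (hA : IsCarnotGrading K N 𝒜) :
    ∃ Ψ : G →ₗ⁅K⁆ E, Function.Surjective Ψ ∧
      ∀ k, ∀ g ∈ M.sp (· = k), HomogLift θ π 𝒜 k g (Ψ g) := by
  obtain ⟨x, hx⟩ := exists_homogLift_one (θ := θ) hA hπ (M.f 1)
  obtain ⟨y, hy⟩ := exists_homogLift_one (θ := θ) hA hπ (M.f 2)
  have w0 : ∀ q l, q + l ≠ 5 → (wCoef q l : K) = 0 := fun q l h => by
    rw [wCoef_eq_zero h, Int.cast_zero]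
  have b3 : ⁅M.f 1, M.f 2⁆ = M.f 3 := by
    rw [M.lie_f 1 2 (by norm_num) (by norm_num), w0 _ _ (by norm_num),
      show dCoef 1 2 = 1 by decide]; simp
  have b4 : ⁅M.f 1, M.f 3⁆ = M.f 4 := by
    rw [M.lie_f 1 3 (by norm_num) (by norm_num), w0 _ _ (by norm_num),
      show dCoef 1 3 = 1 by decide]; simp
  have b5 : ⁅M.f 1, M.f 4⁆ = (-3 : K) • M.f 5 := by
    rw [M.lie_f 1 4 (by norm_num) (by norm_num), show dCoef 1 4 = -3 by decide,
      show wCoef 1 4 = 0 by decide]; simp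
  have b6 : ⁅M.f 1, M.f 5⁆ = (-2 : K) • M.f 6 := by
    rw [M.lie_f 1 5 (by norm_num) (by norm_num), w0 _ _ (by norm_num),
      show dCoef 1 5 = -2 by decide]; simp
  have b7 : ⁅M.f 1, M.f 6⁆ = 0 := by
    rw [M.lie_f 1 6 (by norm_num) (by norm_num), w0 _ _ (by norm_num),
      show dCoef 1 6 = 0 by decide]; simp
  have l2 := hx.lie hA le_rfl le_rfl hy
  have l3 := hy.lie hA le_rfl (by norm_num) l2
  have l3' := hx.lie hA le_rfl (by norm_num) l2
  have l4 := hx.lie hA le_rfl (by norm_num) l3'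
  have l5 := hx.lie hA le_rfl (by norm_num) l4
  have l6 := hx.lie hA le_rfl (by norm_num) l5
  rw [b3, M.lie_f_two_three] at l3
  -- The Serre relation has degree 6, which is at most `m`, so it survives in `E`.
  have h6 : ⁅x, ⁅x, ⁅x, ⁅x, ⁅x, y⁆⁆⁆⁆⁆ = 0 :=
    l6.eq_zero hA hπ hker (by omega) (by rw [b3, b4, b5, lie_smul, b6, lie_smul, lie_smul, b7]; simp)
  -- An element of `𝒜 1` and the combination of `x` and `y` that lifts the same vector differ by a
  -- homogeneous lift of zero.
  have hspan : 𝒜 1 ≤ Submodule.span K {x, y} := by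
    intro v hv
    obtain ⟨g, hg⟩ := hθ (π v)
    have hg1 : M.proj 1 g = M.C g 1 • M.f 1 + M.C g 2 • M.f 2 := by
      refine M.ext (Finsupp.ext fun j => ?_) ?_
      · rw [M.C_proj, map_add, map_smul, map_smul, M.C_f 1 le_rfl, M.C_f 2 (by norm_num)]
        simp only [Finsupp.add_apply, Finsupp.smul_apply, Finsupp.single_apply, smul_eq_mul]
        by_cases h1 : j = 1
        · subst h1; simp [show natDeg 1 = 1 by decide]
        by_cases h2 : j = 2
        · subst h2; simp [show natDeg 2 = 1 by decide]
        rw [if_neg (fun h => (natDeg_eq_one h).elim h1 h2), if_neg (Ne.symm h1),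
          if_neg (Ne.symm h2)]
        simp
      · rw [M.cz_proj, map_add, map_smul, map_smul, M.cz_f 1 le_rfl, M.cz_f 2 (by norm_num)]
        simp
    have hg2 : g - M.proj 1 g ∈ LieModule.lowerCentralSeries K G G 1 :=
      (M.mem_lowerCentralSeries 1 _).mpr (M.sub_proj_mem (k := 0) (M.sp_top fun k hk => hk))
    have hl : HomogLift θ π 𝒜 1 (M.proj 1 g) v := by
      refine ⟨hv, ?_⟩
      rw [← hg, ← map_sub]
      exact map_mem_lcs θ hg2
    rw [hg1] at hl
    have := hl.add (((hx.smul (M.C g 1)).add (hy.smul (M.C g 2))).smul (-1))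
    have := this.eq_zero hA hπ hker (by omega) (by
      rw [neg_one_smul, add_neg_cancel, map_zero])
    rw [neg_one_smul, add_neg_eq_zero] at this
    rw [this]
    exact add_mem (Submodule.smul_mem _ _ (Submodule.subset_span (Or.inl rfl)))
      (Submodule.smul_mem _ _ (Submodule.subset_span (Or.inr rfl)))
  -- The centrality of `⁅y, ⁅x, y⁆⁆` is a relation of degree 4. It covers both algebras, as `z` is
  -- zero in `𝔫₂` and central in `𝔫₂³`.
  have hw1 : ⁅x, ⁅y, ⁅x, y⁆⁆⁆ = 0 := (hx.lie hA le_rfl (by norm_num) l3).eq_zero hA hπ hker (by omega)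
    (by rw [M.lie_z, map_zero])
  have hw2 : ⁅y, ⁅y, ⁅x, y⁆⁆⁆ = 0 := (hy.lie hA le_rfl (by norm_num) l3).eq_zero hA hπ hker (by omega)
    (by rw [M.lie_z, map_zero])
  have hw := eq_zero_of_generators hA hspan hw1 hw2
  obtain ⟨Ψ, hf, hz⟩ := M.exists_lift (genSeq K x y) ⁅y, ⁅x, y⁆⁆ hw
    (fun h => l3.eq_zero hA hπ hker (by omega) (by rw [h, map_zero]))
    (fun q l hq hl => lieRel_genSeq hw rfl h6 q l hq hl)
  have hf1 : Ψ (M.f 1) = x := hf 1 le_rfl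
  have hf2 : Ψ (M.f 2) = y := hf 2 (by norm_num)
  refine ⟨Ψ, ?_, ?_⟩
  · have : Ψ.range = ⊤ := by
      refine hA.subalgebra_eq_top (hspan.trans (Submodule.span_le.mpr ?_))
      rintro _ (rfl | rfl)
      · exact ⟨_, hf1⟩
      · exact ⟨_, hf2⟩
    exact (LieHom.range_eq_top Ψ).mp this
  · have hfj (j : ℕ) (hj : 1 ≤ j) : HomogLift θ π 𝒜 (natDeg j) (M.f j) (Ψ (M.f j)) := by
      induction j using Nat.strong_induction_on with
      | _ j ih =>
        obtain rfl | rfl | h3 : j = 1 ∨ j = 2 ∨ 3 ≤ j := by omega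
        · rw [hf1]; exact hx
        · rw [hf2]; exact hy
        · obtain ⟨i, l, hi, hl, hlj, -, hdeg, -, e⟩ := M.f_eq_lie h3
          have hli : HomogLift θ π 𝒜 1 (M.f i) (Ψ (M.f i)) := by
            rcases hi with rfl | rfl
            · rw [hf1]; exact hx
            · rw [hf2]; exact hy
          have := (hli.lie hA le_rfl (natDeg_pos hl) (ih l hlj hl)).smul (dCoef i l : K)⁻¹
          rwa [← LieHom.map_lie, ← map_smul, ← e, add_comm, hdeg] at this
    intro k g hg
    induction hg using Submodule.span_induction with
    | mem g h =>
      rcases h with ⟨j, hj, rfl, rfl⟩ | ⟨rfl, rfl⟩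
      · exact hfj j hj
      · rw [hz]; exact l3
    | zero => exact ⟨by rw [map_zero]; exact zero_mem _, by simp⟩
    | add g g' _ _ h h' => rw [map_add]; exact h.add h'
    | smul r g _ h => rw [map_smul]; exact h.smul r

end GradedHom

/-! ### Classification of the Carnot extensions -/

section Classification

theorem natDeg_eq_iff_double {N : ℕ} (hN : N % 6 = 1 ∨ N % 6 = 5) (j : ℕ) :
    natDeg j = N ↔ j = firstIdx N ∨ j = firstIdx N + 1 := by
  rw [natDeg, firstIdx]
  split_ifs <;> omega

theorem natDeg_eq_iff_single {N : ℕ} (h1 : 1 ≤ N) (hN : N % 6 ≠ 1 ∧ N % 6 ≠ 5) :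
    ∃ q, 1 ≤ q ∧ ∀ j, natDeg j = N ↔ j = q := by
  refine ⟨8 * (N / 6) + if N % 6 = 0 then 0 else N % 6 + 1, by split_ifs <;> omega, fun j => ?_⟩
  rw [natDeg]
  split_ifs <;> omega

theorem exists_natDeg_eq {N : ℕ} (h1 : 1 ≤ N) : ∃ j, 1 ≤ j ∧ natDeg j = N := by
  by_cases h : N % 6 ≠ 1 ∧ N % 6 ≠ 5
  · obtain ⟨q, hq, h⟩ := natDeg_eq_iff_single h1 h
    exact ⟨q, hq, (h q).mpr rfl⟩
  · refine ⟨firstIdx N, ?_, (natDeg_eq_iff_double (by omega) _).mpr (Or.inl rfl)⟩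
    rw [firstIdx]; split_ifs <;> omega

theorem one_le_firstIdx (N : ℕ) : 1 ≤ firstIdx N := by
  rw [firstIdx]; split_ifs <;> omega

theorem natDeg_le (j : ℕ) : natDeg j ≤ j := by
  rw [natDeg]; split_ifs <;> omega

theorem natDeg_eq_succ_double {N : ℕ} (hN : N % 6 = 1 ∨ N % 6 = 5) (j : ℕ) :
    natDeg j = N + 1 ↔ j = firstIdx N + 2 := by
  rw [natDeg, firstIdx]
  split_ifs <;> omega

namespace NTwoModel

variable {K : Type*} [Field K] {G : Type*} [LieRing G] [LieAlgebra K G] (M : NTwoModel K G)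

theorem f_notMem_sp {p : ℕ → Prop} {j : ℕ} (hj : 1 ≤ j) (h : ¬ p (natDeg j)) : M.f j ∉ M.sp p := by
  intro hf
  have := (M.mem_sp.mp hf).1 j h
  rw [M.C_f j hj, Finsupp.single_eq_same] at this
  exact one_ne_zero this

theorem smul_f_mem_sp {p : ℕ → Prop} {j : ℕ} (hj : 1 ≤ j) (h : ¬ p (natDeg j)) {r : K}
    (hr : r • M.f j ∈ M.sp p) : r = 0 := by
  by_contra h0
  exact M.f_notMem_sp hj h ((Submodule.smul_mem_iff _ h0).mp hr)

theorem mem_sp_single {k q : ℕ} (hq : 1 ≤ q) (h : ∀ j, natDeg j = k ↔ j = q) (hk : k ≠ 3) {g : G}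
    (hg : g ∈ M.sp (· = k)) : g = M.C g q • M.f q := by
  obtain ⟨h1, h2⟩ := M.mem_sp.mp hg
  refine M.ext (Finsupp.ext fun j => ?_) ?_
  · rw [map_smul, M.C_f q hq, Finsupp.smul_apply, Finsupp.single_apply, smul_eq_mul]
    split_ifs with hj
    · rw [hj, mul_one]
    · rw [mul_zero]; exact h1 j (fun h' => hj ((h j).mp h').symm)
  · rw [map_smul, M.cz_f q hq, smul_zero]; exact h2 (by omega)

theorem mem_sp_double {k p : ℕ} (hp : 1 ≤ p) (h : ∀ j, natDeg j = k ↔ j = p ∨ j = p + 1)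
    (hk : k ≠ 3) {g : G} (hg : g ∈ M.sp (· = k)) :
    g = M.C g p • M.f p + M.C g (p + 1) • M.f (p + 1) := by
  obtain ⟨h1, h2⟩ := M.mem_sp.mp hg
  refine M.ext (Finsupp.ext fun j => ?_) ?_
  · rw [map_add, map_smul, map_smul, M.C_f p hp, M.C_f (p + 1) (by omega), Finsupp.add_apply,
      Finsupp.smul_apply, Finsupp.smul_apply, Finsupp.single_apply, Finsupp.single_apply]
    by_cases e1 : p = j
    · subst e1; simp
    by_cases e2 : p + 1 = j
    · subst e2; simp
    rw [if_neg e1, if_neg e2, h1 j (fun h' => ((h j).mp h').elim (Ne.symm e1) (Ne.symm e2))]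
    simp
  · rw [map_add, map_smul, map_smul, M.cz_f p hp, M.cz_f _ (by omega), h2 (by omega)]
    simp

theorem comb_eq_zero {p : ℕ} (hp : 1 ≤ p) {a b : K} (h : a • M.f p + b • M.f (p + 1) = 0) :
    a = 0 ∧ b = 0 := by
  have e := congrArg M.C h
  rw [map_add, map_smul, map_smul, M.C_f p hp, M.C_f _ (by omega), map_zero] at e
  have e1 := DFunLike.congr_fun e p
  have e2 := DFunLike.congr_fun e (p + 1)
  simpa using And.intro e1 e2

theorem proj_eq_zero_of_lt {k n : ℕ} (hk : k ≤ n) {x : G} (hx : x ∈ M.sp (n < ·)) :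
    M.proj k x = 0 := by
  obtain ⟨h1, h2⟩ := M.mem_sp.mp hx
  refine M.ext (Finsupp.ext fun j => ?_) ?_
  · rw [M.C_proj, map_zero]
    split_ifs with h
    · exact h1 j (by omega)
    · rfl
  · rw [M.cz_proj, map_zero]
    split_ifs with h
    · exact h2 (by omega)
    · rfl

theorem proj_mem_sp_lt {k n : ℕ} {x : G} (hx : x ∈ M.sp (n < ·)) :
    M.proj k x ∈ M.sp (n < ·) := by
  rcases Nat.lt_or_ge n k with h | h
  · exact M.sp_mono (fun l hl => by omega) (M.proj_mem k x)
  · rw [M.proj_eq_zero_of_lt h hx]; exact zero_mem _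

/-- The ideal `J` is spanned by the vector `w` of degree `N` and by all vectors of higher degree. -/
def IsTop (N : ℕ) (w : G) (J : LieIdeal K G) : Prop :=
  w ∈ M.sp (· = N) ∧ J.toSubmodule = Submodule.span K {w} ⊔ M.sp (N < ·)

/-- The choice `w = 0` treats the truncations on the same footing as the three exceptional ideals.
-/
theorem isTop_lcs [CharZero K] (N : ℕ) :
    M.IsTop N 0 (LieModule.lowerCentralSeries K G G N) := by
  refine ⟨zero_mem _, ?_⟩
  rw [Submodule.span_zero_singleton, bot_sup_eq]
  ext x
  exact M.mem_lowerCentralSeries N x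

variable {M}

theorem IsTop.mem {N : ℕ} {w : G} {J : LieIdeal K G} (h : M.IsTop N w J) : w ∈ J := by
  rw [← LieSubmodule.mem_toSubmodule, h.2]
  exact Submodule.mem_sup_left (Submodule.mem_span_singleton_self w)

theorem IsTop.mem_of_lt {N : ℕ} {w : G} {J : LieIdeal K G} (h : M.IsTop N w J) {x : G}
    (hx : x ∈ M.sp (N < ·)) : x ∈ J := by
  rw [← LieSubmodule.mem_toSubmodule, h.2]
  exact Submodule.mem_sup_right hx

theorem IsTop.mem_iff {n : ℕ} {w : G} {J : LieIdeal K G} (h : M.IsTop (n + 1) w J) {x : G} :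
    x ∈ J ↔ x ∈ M.sp (n < ·) ∧ M.proj (n + 1) x ∈ Submodule.span K {w} := by
  rw [← LieSubmodule.mem_toSubmodule, h.2]
  constructor
  · intro hx
    obtain ⟨u, hu, v, hv, rfl⟩ := Submodule.mem_sup.mp hx
    obtain ⟨r, rfl⟩ := Submodule.mem_span_singleton.mp hu
    refine ⟨add_mem (Submodule.smul_mem _ _ (M.sp_mono (fun l hl => by omega) h.1))
      (M.sp_mono (fun l hl => by omega) hv), ?_⟩
    rw [map_add, map_smul, M.proj_eq_self h.1, M.proj_eq_zero_of_lt le_rfl hv, add_zero]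
    exact hu
  · rintro ⟨h1, h2⟩
    rw [← add_sub_cancel (M.proj (n + 1) x) x]
    exact Submodule.add_mem_sup h2 (M.sub_proj_mem h1)

theorem IsTop.proj_mem {n : ℕ} {w : G} {J : LieIdeal K G} (h : M.IsTop (n + 1) w J) (k : ℕ) {x : G}
    (hx : x ∈ J) : M.proj k x ∈ J := by
  obtain ⟨h1, h2⟩ := h.mem_iff.mp hx
  rcases eq_or_ne k (n + 1) with rfl | hk
  · refine h.mem_iff.mpr ⟨M.proj_mem_sp_lt h1, ?_⟩
    rwa [M.proj_eq_self (M.proj_mem _ _)]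
  · refine h.mem_iff.mpr ⟨M.proj_mem_sp_lt h1, ?_⟩
    rw [M.proj_eq_zero hk.symm (M.proj_mem _ _)]
    exact zero_mem _

theorem IsTop.isCarnotGrading [CharZero K] {n : ℕ} {w : G} {J : LieIdeal K G}
    (h : M.IsTop (n + 1) w J) (hN : ∃ x ∈ M.sp (· = n + 1), x ∉ J) :
    IsCarnotGrading K (n + 1) (fun k => (M.sp (· = k)).map (quotMk J : G →ₗ[K] G ⧸ J)) := by
  exact M.isCarnotGrading_quot J (fun k x hx => h.proj_mem k hx) (fun x hx => h.mem_of_lt hx) hN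

theorem IsTop.isCarnot [CharZero K] {n : ℕ} {w : G} {J : LieIdeal K G}
    (h : M.IsTop (n + 1) w J) (hN : ∃ x ∈ M.sp (· = n + 1), x ∉ J) :
    IsCarnot K (G ⧸ J) (n + 1) := by
  exact M.isCarnot_quot J (fun k x hx => h.proj_mem k hx) (fun x hx => h.mem_of_lt hx) hN

theorem IsTop.isCarnotExtension [CharZero K] {n : ℕ} {w : G} {J : LieIdeal K G}
    (h : M.IsTop (n + 1) w J) (hN : ∃ x ∈ M.sp (· = n + 1), x ∉ J) :
    IsCarnotExtension K (G ⧸ LieModule.lowerCentralSeries K G G n) n (G ⧸ J) :=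
  carnotExtends_quot (fun x hx => (M.mem_lowerCentralSeries n x).mpr (h.mem_iff.mp hx).1) rfl
    (h.isCarnot hN)

variable (M)

theorem exists_notMem_lcs [CharZero K] {n : ℕ} (hn : 1 ≤ n) :
    ∃ x ∈ M.sp (· = n), x ∉ LieModule.lowerCentralSeries K G G n := by
  obtain ⟨j, hj, h⟩ := exists_natDeg_eq hn
  refine ⟨M.f j, M.f_mem_sp hj h, fun h' => ?_⟩
  exact M.f_notMem_sp hj (by omega) ((M.mem_lowerCentralSeries n _).mp h')

theorem isCarnot_lcs [CharZero K] (M : NTwoModel K G) {n : ℕ} (hn : 1 ≤ n) :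
    IsCarnot K (G ⧸ LieModule.lowerCentralSeries K G G n) n := by
  obtain ⟨n, rfl⟩ : ∃ k, n = k + 1 := ⟨n - 1, by omega⟩
  exact (M.isTop_lcs (n + 1)).isCarnot (M.exists_notMem_lcs hn)

theorem isCarnotExtension_lcs [CharZero K] (M : NTwoModel K G) (n : ℕ) :
    IsCarnotExtension K (G ⧸ LieModule.lowerCentralSeries K G G n) n
      (G ⧸ LieModule.lowerCentralSeries K G G (n + 1)) :=
  (M.isTop_lcs (n + 1)).isCarnotExtension (M.exists_notMem_lcs (by omega))

variable {E : Type*} [LieRing E] [LieAlgebra K E] {Q : Type*} [LieRing Q] [LieAlgebra K Q]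

/-- Take a preimage in the lower central series and drop its terms of higher degree: the resulting
error is homogeneous of degree `k + 1` and lies deeper, hence is zero. -/
theorem exists_homog_preimage [CharZero K] {N : ℕ} {𝒜 : ℕ → Submodule K E}
    (hA : IsCarnotGrading K N 𝒜) {Ψ : G →ₗ⁅K⁆ E} (hΨ : Function.Surjective Ψ)
    (hg : ∀ k, ∀ g ∈ M.sp (· = k), Ψ g ∈ 𝒜 k) {k : ℕ} {y : E} (hy : y ∈ 𝒜 (k + 1)) :
    ∃ g ∈ M.sp (· = k + 1), Ψ g = y := by
  obtain ⟨g, h1, rfl⟩ := exists_lift_lcs hΨ (hA.mem_lcs hy)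
  refine ⟨M.proj (k + 1) g, M.proj_mem _ _, ?_⟩
  have h2 := M.sub_proj_mem ((M.mem_lowerCentralSeries k g).mp h1)
  rw [← M.mem_lowerCentralSeries] at h2
  have h3 := map_mem_lcs Ψ h2
  have h4 := hA.eq_zero (sub_mem hy (hg _ _ (M.proj_mem (k + 1) g))) (by rwa [← map_sub])
  exact (sub_eq_zero.mp h4).symm

/-- Every Carnot extension of a truncation of `𝔫₂` is the quotient of `𝔫₂` by an ideal that is
determined by its component of degree `n + 1`. -/
theorem exists_hom_of_extension [CharZero K] {n : ℕ} (hn : 6 ≤ n)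
    (hE : IsCarnotExtension K (G ⧸ LieModule.lowerCentralSeries K G G n) n E) :
    ∃ Ψ : G →ₗ⁅K⁆ E, Function.Surjective Ψ ∧
      (∀ x, Ψ x = 0 ↔ x ∈ M.sp (n < ·) ∧ Ψ (M.proj (n + 1) x) = 0) ∧
      ∃ g ∈ M.sp (· = n + 1), Ψ g ≠ 0 := by
  obtain ⟨⟨-, 𝒜, hA⟩, π, hπ, hker⟩ := hE
  have hker' : ∀ x, π x = 0 → x ∈ LieModule.lowerCentralSeries K E E n := fun x hx => by
    rw [← hker, LieHom.mem_ker]; exact hx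
  obtain ⟨Ψ, hΨ, hg⟩ := M.exists_graded_hom (quotMk (LieModule.lowerCentralSeries K G G n))
    (quotMk_surjective _) π hπ hn hker' hA
  -- `E` has length `n + 1`, so everything of degree above `n + 1` dies.
  have high : ∀ x ∈ M.sp (n < ·), Ψ x = Ψ (M.proj (n + 1) x) := by
    intro x hx
    have := M.sub_proj_mem hx
    rw [← M.mem_lowerCentralSeries] at this
    have := hA.lcs_eq_zero (map_mem_lcs Ψ this)
    rwa [map_sub, sub_eq_zero] at this
  refine ⟨Ψ, hΨ, fun x => ⟨fun hx => ?_, fun ⟨h1, h2⟩ => (high x h1).trans h2⟩, ?_⟩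
  · have key : ∀ k, k ≤ n → x ∈ M.sp (k < ·) := by
      intro k
      induction k with
      | zero => exact fun _ => M.sp_top fun k hk => hk
      | succ k ih =>
        intro hk
        have h1 := ih (by omega)
        have h2 := M.sub_proj_mem h1
        have h3 := hg (k + 1) _ (M.proj_mem (k + 1) x)
        have h4 : Ψ (M.proj (k + 1) x) = 0 := by
          refine hA.eq_zero h3.1 ?_
          have := map_mem_lcs Ψ ((M.mem_lowerCentralSeries _ _).mpr h2)
          rw [map_sub, hx, zero_sub] at this
          exact neg_mem_iff.mp this
        have h5 := h3.2
        rw [h4, map_zero, zero_sub] at h5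
        obtain ⟨v, hv, e⟩ := exists_lift_lcs (quotMk_surjective _) (neg_mem_iff.mp h5)
        rw [← sub_eq_zero, ← map_sub, quotMk_eq_zero, M.mem_lowerCentralSeries] at e
        rw [M.mem_lowerCentralSeries] at hv
        have h6 : M.proj (k + 1) x ∈ M.sp (k + 1 < ·) := by
          have := sub_mem hv (M.sp_mono (fun l hl => by omega : ∀ l, n < l → k + 1 < l) e)
          rwa [sub_sub_cancel] at this
        have := add_mem h2 h6
        rwa [sub_add_cancel] at this
    exact ⟨key n le_rfl, (high x (key n le_rfl)).symm.trans hx⟩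
  · obtain ⟨y, hy, hy0⟩ := (Submodule.ne_bot_iff _).mp hA.top_ne_bot
    obtain ⟨g, hg1, hg2⟩ := M.exists_homog_preimage hA hΨ (fun k g h => (hg k g h).1) hy
    exact ⟨g, hg1, by rwa [hg2]⟩

/-- Reduces the identification of `E` to comparing two subspaces of the component of degree `n + 1`.
-/
theorem equiv_of_ker {n : ℕ} {w : G} {J : LieIdeal K G} (hJ : M.IsTop (n + 1) w J)
    {Ψ : G →ₗ⁅K⁆ E} (hΨ : Function.Surjective Ψ)
    (hker : ∀ x, Ψ x = 0 ↔ x ∈ M.sp (n < ·) ∧ Ψ (M.proj (n + 1) x) = 0)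
    (hw : ∀ g ∈ M.sp (· = n + 1), Ψ g = 0 ↔ g ∈ Submodule.span K {w}) :
    Nonempty (E ≃ₗ⁅K⁆ G ⧸ J) := by
  refine nonempty_equiv_quot Ψ hΨ J fun x => ?_
  rw [hker, hJ.mem_iff, hw _ (M.proj_mem _ _)]

/-- The component of degree `n + 1` is a line on which `Ψ` is not zero, so nothing in it is killed.
-/
theorem extension_unique [CharZero K] (M : NTwoModel K G) {n : ℕ} (hn : 6 ≤ n) (h6 : n % 6 ≠ 0 ∧ n % 6 ≠ 4)
    (hE : IsCarnotExtension K (G ⧸ LieModule.lowerCentralSeries K G G n) n E) :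
    Nonempty (E ≃ₗ⁅K⁆ G ⧸ LieModule.lowerCentralSeries K G G (n + 1)) := by
  obtain ⟨Ψ, hΨ, hker, g, hg, hg0⟩ := M.exists_hom_of_extension hn hE
  obtain ⟨q, hq, hdeg⟩ := natDeg_eq_iff_single (N := n + 1) (by omega) (by omega)
  refine M.equiv_of_ker (M.isTop_lcs (n + 1)) hΨ hker fun x hx => ?_
  rw [Submodule.span_zero_singleton, Submodule.mem_bot]
  refine ⟨fun h => ?_, fun h => by rw [h, map_zero]⟩
  rw [M.mem_sp_single hq hdeg (by omega) hg, map_smul] at hg0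
  rw [M.mem_sp_single hq hdeg (by omega) hx, map_smul] at h
  rw [M.mem_sp_single hq hdeg (by omega) hx, (smul_eq_zero.mp h).resolve_right
    (fun h' => hg0 (by rw [h', smul_zero])), zero_smul]

/-- The torus acts on `𝔫₂` and `𝔫₂³` by automorphisms that scale `f_1` by `1` and `f_2` by `b`. -/
theorem exists_torus {b : K} (hb : b ≠ 0) :
    ∃ τ : G →ₗ⁅K⁆ G, Function.Surjective τ ∧
      (∀ j, 1 ≤ j → τ (M.f j) = b ^ (j - natDeg j) • M.f j) ∧
      (∀ n x, τ x ∈ M.sp (n < ·) ↔ x ∈ M.sp (n < ·)) ∧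
      ∀ k x, M.proj k (τ x) = τ (M.proj k x) := by
  -- The exponent `j - natDeg j` counts the factors `f_2`; the vector `z = ⁅f_2, f_3⁆` contains two
  -- of them.
  obtain ⟨τ, hf, hz⟩ := M.exists_lift (fun j => b ^ (j - natDeg j) • M.f j) (b ^ 2 • M.z)
    (fun x => by rw [lie_smul, M.lie_z, smul_zero]) (fun h => by rw [h, smul_zero]) (by
      intro q l hq hl
      rw [LieRel]
      rw [smul_lie, lie_smul, smul_smul, M.lie_f q l hq hl, smul_add]
      congr 1
      · by_cases hd : dCoef q l = 0
        · rw [hd]; simp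
        · rw [natDeg_add hd, smul_comm, ← pow_add]
          have h1 := natDeg_le q
          have h2 := natDeg_le l
          congr 3
          omega
      · have key : 2 - natDeg 2 + (3 - natDeg 3) = 2 := by decide
        rw [wCoef]
        split_ifs with h1 h2
        · rw [h1.1, h1.2, smul_comm, ← pow_add, key]
        · rw [h2.1, h2.2, smul_comm, ← pow_add, add_comm, key]
        · simp)
  have hC (x : G) (j : ℕ) : M.C (τ x) j = b ^ (j - natDeg j) * M.C x j := by
    refine M.induction_linear (P := fun x => M.C (τ x) j = b ^ (j - natDeg j) * M.C x j) x
      ?_ ?_ ?_ ?_ ?_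
    · intro i hi
      rw [hf i hi, map_smul, M.C_f i hi, Finsupp.smul_apply, Finsupp.single_apply]
      split_ifs with h
      · rw [h, smul_eq_mul]
      · simp
    · rw [hz, map_smul, M.C_z]; simp
    · simp
    · intro x y hx hy
      rw [map_add, map_add, map_add, Finsupp.add_apply, Finsupp.add_apply, hx, hy, mul_add]
    · intro r x hx
      rw [map_smul, map_smul, map_smul, Finsupp.smul_apply, Finsupp.smul_apply, hx, smul_eq_mul,
        smul_eq_mul, mul_left_comm]
  have hcz (x : G) : M.cz (τ x) = b ^ 2 * M.cz x := by
    refine M.induction_linear (P := fun x => M.cz (τ x) = b ^ 2 * M.cz x) x ?_ ?_ ?_ ?_ ?_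
    · intro i hi
      rw [hf i hi, map_smul, M.cz_f i hi, smul_zero, mul_zero]
    · rw [hz, map_smul, smul_eq_mul]
    · simp
    · intro x y hx hy; rw [map_add, map_add, map_add, hx, hy, mul_add]
    · intro r x hx; rw [map_smul, map_smul, map_smul, hx, smul_eq_mul, smul_eq_mul, mul_left_comm]
  refine ⟨τ, ?_, hf, ?_, ?_⟩
  · intro y
    refine M.induction_linear (P := fun y => ∃ x, τ x = y) y ?_ ?_ ?_ ?_ ?_
    · intro j hj
      exact ⟨(b ^ (j - natDeg j))⁻¹ • M.f j, by
        rw [map_smul, hf j hj, inv_smul_smul₀ (pow_ne_zero _ hb)]⟩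
    · exact ⟨(b ^ 2)⁻¹ • M.z, by rw [map_smul, hz, inv_smul_smul₀ (pow_ne_zero _ hb)]⟩
    · exact ⟨0, map_zero τ⟩
    · rintro _ _ ⟨x, rfl⟩ ⟨y, rfl⟩; exact ⟨x + y, map_add τ x y⟩
    · rintro r _ ⟨x, rfl⟩; exact ⟨r • x, map_smul τ r x⟩
  · intro n x
    simp only [M.mem_sp, hC, hcz, mul_eq_zero, pow_ne_zero _ hb, false_or]
  · intro k x
    refine M.ext (Finsupp.ext fun j => ?_) ?_
    · rw [M.C_proj, hC, hC, M.C_proj]; split_ifs <;> simp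
    · rw [M.cz_proj, hcz, hcz, M.cz_proj]; split_ifs <;> simp

/-- The vectors `f_{p+1}`, `f_p`, `f_p - f_{p+1}` for `p = firstIdx N`. -/
def topVec (N : ℕ) (s : Fin 3) : G :=
  ![M.f (firstIdx N + 1), M.f (firstIdx N), M.f (firstIdx N) - M.f (firstIdx N + 1)] s

/-- A linear form that vanishes on `topVec`. -/
def topForm (s : Fin 3) (a b : K) : K := ![a, b, a + b] s

theorem comb_mem_span_topVec (N : ℕ) (s : Fin 3) (a b : K) :
    a • M.f (firstIdx N) + b • M.f (firstIdx N + 1) ∈ Submodule.span K {M.topVec N s} ↔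
      topForm s a b = 0 := by
  rw [Submodule.mem_span_singleton]
  have key (r c d : K) (h : r • (c • M.f (firstIdx N) + d • M.f (firstIdx N + 1)) =
      a • M.f (firstIdx N) + b • M.f (firstIdx N + 1)) : a = r * c ∧ b = r * d := by
    have := M.comb_eq_zero (one_le_firstIdx N) (a := a - r * c) (b := b - r * d) (by
      linear_combination (norm := module) -h)
    exact ⟨sub_eq_zero.mp this.1, sub_eq_zero.mp this.2⟩
  fin_cases s
  · change (∃ r : K, r • M.f (firstIdx N + 1) = _) ↔ a = 0
    constructor
    · rintro ⟨r, h⟩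
      have := (key r 0 1 (by rw [← h]; module)).1
      rwa [mul_zero] at this
    · rintro rfl; exact ⟨b, by module⟩
  · change (∃ r : K, r • M.f (firstIdx N) = _) ↔ b = 0
    constructor
    · rintro ⟨r, h⟩
      have := (key r 1 0 (by rw [← h]; module)).2
      rwa [mul_zero] at this
    · rintro rfl; exact ⟨a, by module⟩
  · change (∃ r : K, r • (M.f (firstIdx N) - M.f (firstIdx N + 1)) = _) ↔ a + b = 0
    constructor
    · rintro ⟨r, h⟩
      have := key r 1 (-1) (by rw [← h]; module)
      rw [this.1, this.2]; ring
    · intro h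
      refine ⟨a, ?_⟩
      rw [eq_neg_of_add_eq_zero_right h]; module

/-- The part of the plane `⟨f_p, f_{p+1}⟩` that dies under `Ψ` is proper: it is one of the two axes,
a line in general position, or zero. The four cases below correspond to these. -/
theorem extension_classification [CharZero K] {n : ℕ} (hn : 6 ≤ n) (h6 : n % 6 = 0 ∨ n % 6 = 4)
    (I : Fin 3 → LieIdeal K G) (hI : ∀ s, M.IsTop (n + 1) (M.topVec (n + 1) s) (I s))
    (hE : IsCarnotExtension K (G ⧸ LieModule.lowerCentralSeries K G G n) n E) :
    Nonempty (E ≃ₗ⁅K⁆ G ⧸ LieModule.lowerCentralSeries K G G (n + 1)) ∨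
      ∃ s, Nonempty (E ≃ₗ⁅K⁆ G ⧸ I s) := by
  obtain ⟨Ψ, hΨ, hker, g, hg, hg0⟩ := M.exists_hom_of_extension hn hE
  have hdeg := natDeg_eq_iff_double (N := n + 1) (by omega)
  have hcomb {x : G} (hx : x ∈ M.sp (· = n + 1)) :=
    M.mem_sp_double (one_le_firstIdx (n + 1)) hdeg (by omega) hx
  have hp := one_le_firstIdx (n + 1)
  have hspan := M.comb_mem_span_topVec (n + 1)
  generalize firstIdx (n + 1) = p at *
  have hp0 : M.f p ∈ M.sp (· = n + 1) := M.f_mem_sp hp ((hdeg p).mpr (Or.inl rfl))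
  have hp1 : M.f (p + 1) ∈ M.sp (· = n + 1) :=
    M.f_mem_sp (by omega) ((hdeg (p + 1)).mpr (Or.inr rfl))
  by_cases h0 : Ψ (M.f p) = 0
  · refine Or.inr ⟨1, M.equiv_of_ker (hI 1) hΨ hker fun x hx => ?_⟩
    rw [hcomb hx, hspan, map_add, map_smul, map_smul, h0, smul_zero, zero_add]
    rw [hcomb hg, map_add, map_smul, map_smul, h0, smul_zero, zero_add] at hg0
    change _ ↔ M.C x (p + 1) = 0
    rw [smul_eq_zero, or_iff_left (fun h => hg0 (by rw [h, smul_zero]))]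
  by_cases h1 : Ψ (M.f (p + 1)) = 0
  · refine Or.inr ⟨0, M.equiv_of_ker (hI 0) hΨ hker fun x hx => ?_⟩
    rw [hcomb hx, hspan, map_add, map_smul, map_smul, h1, smul_zero, add_zero]
    change _ ↔ M.C x p = 0
    rw [smul_eq_zero, or_iff_left h0]
  by_cases h2 : ∃ c : K, Ψ (M.f p) = c • Ψ (M.f (p + 1))
  · obtain ⟨c, hc⟩ := h2
    have hc0 : c ≠ 0 := by rintro rfl; exact h0 (by rw [hc, zero_smul])
    -- Here the line of `f_p - c f_{p+1}` dies. Since `f_p` and `f_{p+1}` have the same degree, the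
    -- torus element with `b = c` scales `f_{p+1}` by `c` more than `f_p`, so after composition the
    -- line of `f_p - f_{p+1}` dies.
    obtain ⟨τ, hτ, hτf, hτn, hτp⟩ := M.exists_torus hc0
    refine Or.inr ⟨2, M.equiv_of_ker (Ψ := Ψ.comp τ) (hI 2) (hΨ.comp hτ) (fun x => ?_)
      fun x hx => ?_⟩
    · rw [LieHom.comp_apply, LieHom.comp_apply, hker, hτn, hτp]
    · have hdp : p - natDeg p + 1 = p + 1 - natDeg (p + 1) := by
        rw [(hdeg p).mpr (Or.inl rfl), (hdeg (p + 1)).mpr (Or.inr rfl)]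
        have := natDeg_le p
        rw [(hdeg p).mpr (Or.inl rfl)] at this
        omega
      have e : (Ψ.comp τ) x = (c ^ (p + 1 - natDeg (p + 1)) * (M.C x p + M.C x (p + 1))) •
          Ψ (M.f (p + 1)) := by
        rw [LieHom.comp_apply]
        nth_rewrite 1 [hcomb hx]
        rw [map_add, map_smul, map_smul, hτf p hp, hτf (p + 1) (by omega), map_add, map_smul,
          map_smul, map_smul, map_smul, hc, ← hdp, pow_succ]
        module
      rw [e]
      nth_rewrite 3 [hcomb hx]
      rw [hspan]
      change _ ↔ M.C x p + M.C x (p + 1) = 0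
      rw [smul_eq_zero, or_iff_left h1, mul_eq_zero, or_iff_right (pow_ne_zero _ hc0)]
  -- The images of `f_p` and `f_{p+1}` are linearly independent, so nothing dies.
  · refine Or.inl (M.equiv_of_ker (M.isTop_lcs (n + 1)) hΨ hker fun x hx => ?_)
    rw [Submodule.span_zero_singleton, Submodule.mem_bot]
    refine ⟨fun h => ?_, fun h => by rw [h, map_zero]⟩
    have h' := h
    rw [hcomb hx, map_add, map_smul, map_smul] at h'
    have ha : M.C x p = 0 := by
      by_contra ha
      refine h2 ⟨-(M.C x p)⁻¹ * M.C x (p + 1), ?_⟩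
      rw [add_eq_zero_iff_eq_neg] at h'
      rw [← inv_smul_smul₀ ha (Ψ (M.f p)), h']
      module
    rw [ha, zero_smul, zero_add] at h'
    rw [hcomb hx, ha, (smul_eq_zero.mp h').resolve_right h1, zero_smul, zero_smul, add_zero]

end NTwoModel
end Classification

/-! ### Dead ends and non-isomorphism -/

section Rigidity

namespace NTwoModel

variable {K : Type*} [Field K] {G : Type*} [LieRing G] [LieAlgebra K G] (M : NTwoModel K G)
variable {E : Type*} [LieRing E] [LieAlgebra K E]

/-- A quotient of `𝔫₂` by a proper piece of its two-dimensional component of degree `n + 1` has no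
prolongation. -/
theorem not_carnotExtends [CharZero K] {n : ℕ} (hn : 6 ≤ n) (h6 : n % 6 = 0 ∨ n % 6 = 4) (s : Fin 3)
    {J : LieIdeal K G} (hJ : M.IsTop (n + 1) (M.topVec (n + 1) s) J) {N : ℕ} (hN : n + 1 < N) :
    ¬ CarnotExtends K (G ⧸ J) (n + 1) N E := by
  rintro ⟨⟨-, 𝒜, hA⟩, π, hπ, hker⟩
  have hker' : ∀ x, π x = 0 → x ∈ LieModule.lowerCentralSeries K E E (n + 1) := fun x hx => by
    rw [← hker, LieHom.mem_ker]; exact hx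
  obtain ⟨Ψ, hΨ, hg⟩ := M.exists_graded_hom (quotMk J) (quotMk_surjective _) π hπ (by omega) hker' hA
  have hw : Ψ (M.topVec (n + 1) s) = 0 :=
    (hg _ _ hJ.1).eq_zero hA hπ hker' le_rfl (quotMk_eq_zero.mpr hJ.mem)
  have hdeg := natDeg_eq_succ_double (N := n + 1) (by omega)
  have hp := one_le_firstIdx (n + 1)
  have hmod : Fin.ofNat 8 (firstIdx (n + 1)) = 1 ∨ Fin.ofNat 8 (firstIdx (n + 1)) = 6 := by
    simp only [Fin.ext_iff, Fin.ofNat, firstIdx]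
    split_ifs <;> simp
  have hp4 : 6 ≤ firstIdx (n + 1) := by rw [firstIdx]; split_ifs <;> omega
  have key1 : ∀ t : Fin 8, t = 1 ∨ t = 6 → dTable 1 t = 0 ∧ dTable 1 (t + 1) ≠ 0 ∧
    dTable 2 t ≠ 0 := by decide
  obtain ⟨d0, d1, d2⟩ := key1 _ hmod
  have d0' : dCoef 1 (firstIdx (n + 1)) = 0 := d0
  have d1' : (dCoef 1 (firstIdx (n + 1) + 1) : K) ≠ 0 := by
    refine Int.cast_ne_zero.mpr ?_
    rw [dCoef, ofNat8_add]
    exact d1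
  have d2' : (dCoef 2 (firstIdx (n + 1)) : K) ≠ 0 := Int.cast_ne_zero.mpr d2
  have b1 : ⁅M.f 1, M.f (firstIdx (n + 1))⁆ = 0 := by
    rw [M.lie_f 1 _ le_rfl hp, d0', wCoef_eq_zero (by omega)]; simp
  have b2 : ⁅M.f 1, M.f (firstIdx (n + 1) + 1)⁆ =
      (dCoef 1 (firstIdx (n + 1) + 1) : K) • M.f (firstIdx (n + 1) + 2) := by
    rw [M.lie_f 1 _ le_rfl (by omega), wCoef_eq_zero (by omega),
      show 1 + (firstIdx (n + 1) + 1) = firstIdx (n + 1) + 2 by omega]; simp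
  have b3 : ⁅M.f 2, M.f (firstIdx (n + 1))⁆ =
      (dCoef 2 (firstIdx (n + 1)) : K) • M.f (firstIdx (n + 1) + 2) := by
    rw [M.lie_f 2 _ (by norm_num) hp, wCoef_eq_zero (by omega), add_comm 2]; simp
  -- One bracket takes the killed vector to a nonzero multiple of `f_{p+2}`: bracketing with `f_1`
  -- does so for `f_{p+1}` and `f_p - f_{p+1}`, while `f_p` needs `f_2` because `⁅f_1, f_p⁆ = 0`.
  have hnext : Ψ (M.f (firstIdx (n + 1) + 2)) = 0 := by
    fin_cases s
    · change Ψ (M.f (firstIdx (n + 1) + 1)) = 0 at hw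
      have := LieHom.map_lie Ψ (M.f 1) (M.f (firstIdx (n + 1) + 1))
      rw [b2, hw, lie_zero, map_smul] at this
      exact (smul_eq_zero.mp this).resolve_left d1'
    · change Ψ (M.f (firstIdx (n + 1))) = 0 at hw
      have := LieHom.map_lie Ψ (M.f 2) (M.f (firstIdx (n + 1)))
      rw [b3, hw, lie_zero, map_smul] at this
      exact (smul_eq_zero.mp this).resolve_left d2'
    · change Ψ (M.f (firstIdx (n + 1)) - M.f (firstIdx (n + 1) + 1)) = 0 at hw
      have := LieHom.map_lie Ψ (M.f 1) (M.f (firstIdx (n + 1)) - M.f (firstIdx (n + 1) + 1))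
      rw [lie_sub, b1, b2, hw, lie_zero, zero_sub, map_neg, map_smul, neg_eq_zero] at this
      exact (smul_eq_zero.mp this).resolve_left d1'
  have hbot : 𝒜 (n + 2) = ⊥ := by
    rw [eq_bot_iff]
    intro y hy
    obtain ⟨g, hg1, rfl⟩ := M.exists_homog_preimage hA hΨ (fun k g h => (hg k g h).1) hy
    rw [M.mem_sp_single (by omega) hdeg (by omega) hg1, map_smul, hnext, smul_zero]
    exact zero_mem _
  -- By generation in degree 1, a zero component forces all later ones to be zero, against `𝒜 N ≠
  -- 0`.
  have hall (i : ℕ) (hi : n + 2 + i ≤ N) : 𝒜 (n + 2 + i) = ⊥ := by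
    induction i with
    | zero => exact hbot
    | succ i ih =>
      rw [← add_assoc, ← hA.span_lie (n + 2 + i) (by omega) (by omega), ih (by omega), eq_bot_iff,
        Submodule.span_le]
      rintro _ ⟨u, -, v, hv, rfl⟩
      rw [(Submodule.mem_bot K).mp hv, lie_zero]
      exact zero_mem _
  refine hA.top_ne_bot ?_
  have := hall (N - (n + 2)) (by omega)
  rwa [show n + 2 + (N - (n + 2)) = N by omega] at this

/-- Isomorphisms between quotients of `𝔫₂` (or `𝔫₂³`) act on the vectors `f_j` by scalars, up to
terms of higher degree. -/
theorem exists_scalars_of_equiv [CharZero K] {n : ℕ} (hn : 6 ≤ n) (J : LieIdeal K G) {w' : G}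
    {J' : LieIdeal K G} (hJ' : M.IsTop (n + 1) w' J') (hN : ∃ x ∈ M.sp (· = n + 1), x ∉ J')
    (φ : (G ⧸ J) ≃ₗ⁅K⁆ G ⧸ J') :
    ∃ u : ℕ → K, (∀ j, 1 ≤ j → u j ≠ 0) ∧ ∀ i j (a b : K), 1 ≤ i → 1 ≤ j → natDeg i = n + 1 →
      natDeg j = n + 1 → a • M.f i + b • M.f j ∈ J →
      (a * u i) • M.f i + (b * u j) • M.f j ∈ J' := by
  have hA := hJ'.isCarnotGrading hN
  have hlow : ∀ x ∈ J', x ∈ M.sp (n < ·) := fun x hx => (hJ'.mem_iff.mp hx).1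
  have hker : ∀ x, (LieHom.id : (G ⧸ J') →ₗ⁅K⁆ G ⧸ J') x = 0 →
      x ∈ LieModule.lowerCentralSeries K (G ⧸ J') (G ⧸ J') (n + 1) := fun x hx => by
    rw [show x = 0 from hx]; exact zero_mem _
  have hid : Function.Surjective (LieHom.id : (G ⧸ J') →ₗ⁅K⁆ G ⧸ J') := fun x => ⟨x, rfl⟩
  -- The isomorphism `φ` need not be graded. Taking `π` to be the identity replaces it by a graded
  -- `Ψ` that agrees with it up to higher degree.
  obtain ⟨Ψ, hΨ, hg⟩ := M.exists_graded_hom (φ.toLieHom.comp (quotMk J))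
    (φ.surjective.comp (quotMk_surjective J)) LieHom.id hid (by omega) hker hA
  have hdeg1 : ∀ j, natDeg j = 1 ↔ j = 1 ∨ j = 1 + 1 := fun j =>
    ⟨natDeg_eq_one, by rintro (rfl | rfl) <;> decide⟩
  have hlin (j : ℕ) (hj : 1 ≤ j) (h1 : natDeg j = 1) :
      ∃ a b : K, Ψ (M.f j) = quotMk J' (a • M.f 1 + b • M.f 2) := by
    obtain ⟨g, hg1, hg2⟩ := (hg 1 _ (M.f_mem_sp hj h1)).1
    refine ⟨M.C g 1, M.C g 2, ?_⟩
    rw [← hg2, ← M.mem_sp_double le_rfl hdeg1 (by norm_num) hg1]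
    rfl
  obtain ⟨a, c, hX⟩ := hlin 1 le_rfl (by decide)
  obtain ⟨b', b, hY⟩ := hlin 2 (by norm_num) (by decide)
  have b12 : ⁅M.f 1, M.f 2⁆ = M.f 3 := by
    rw [M.lie_f 1 2 (by norm_num) (by norm_num), show dCoef 1 2 = 1 by decide,
      show wCoef 1 2 = 0 by decide]; simp
  have b21 : ⁅M.f 2, M.f 1⁆ = -M.f 3 := by rw [← lie_skew, b12]
  have b13 : ⁅M.f 1, M.f 3⁆ = M.f 4 := by
    rw [M.lie_f 1 3 (by norm_num) (by norm_num), show dCoef 1 3 = 1 by decide,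
      show wCoef 1 3 = 0 by decide]; simp
  have b14 : ⁅M.f 1, M.f 4⁆ = (-3 : K) • M.f 5 := by
    rw [M.lie_f 1 4 (by norm_num) (by norm_num), show dCoef 1 4 = -3 by decide,
      show wCoef 1 4 = 0 by decide]; simp
  have b15 : ⁅M.f 1, M.f 5⁆ = (-2 : K) • M.f 6 := by
    rw [M.lie_f 1 5 (by norm_num) (by norm_num), show dCoef 1 5 = -2 by decide,
      show wCoef 1 5 = 0 by decide]; simp
  have b16 : ⁅M.f 1, M.f 6⁆ = 0 := by
    rw [M.lie_f 1 6 (by norm_num) (by norm_num), show dCoef 1 6 = 0 by decide,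
      show wCoef 1 6 = 0 by decide]; simp
  have b17 : ⁅M.f 1, M.f 7⁆ = M.f 8 := by
    rw [M.lie_f 1 7 (by norm_num) (by norm_num), show dCoef 1 7 = 1 by decide,
      show wCoef 1 7 = 0 by decide]; simp
  have b24 : ⁅M.f 2, M.f 4⁆ = 0 := by
    rw [M.lie_f 2 4 (by norm_num) (by norm_num), show dCoef 2 4 = 0 by decide,
      show wCoef 2 4 = 0 by decide]; simp
  have b25 : ⁅M.f 2, M.f 5⁆ = M.f 7 := by
    rw [M.lie_f 2 5 (by norm_num) (by norm_num), show dCoef 2 5 = 1 by decide,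
      show wCoef 2 5 = 0 by decide]; simp
  have b26 : ⁅M.f 2, M.f 6⁆ = -M.f 8 := by
    rw [M.lie_f 2 6 (by norm_num) (by norm_num), show dCoef 2 6 = -1 by decide,
      show wCoef 2 6 = 0 by decide]; simp
  have b27 : ⁅M.f 2, M.f 7⁆ = 0 := by
    rw [M.lie_f 2 7 (by norm_num) (by norm_num), show dCoef 2 7 = 0 by decide,
      show wCoef 2 7 = 0 by decide]; simp
  have b23 := M.lie_f_two_three
  have h3 : Ψ (M.f 3) = quotMk J' ((a * b - c * b') • M.f 3) := by
    rw [← b12, LieHom.map_lie, hX, hY, ← LieHom.map_lie]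
    congr 1
    simp only [lie_add, add_lie, lie_smul, smul_lie, lie_self, b12, b21]
    module
  -- The determinant of `Ψ` in degree 1; if it were zero, the vector `f_3`, which spans degree 2,
  -- would not be in the image.
  have hD : a * b - c * b' ≠ 0 := by
    intro h0
    rw [h0, zero_smul, map_zero] at h3
    have h32 : M.f 3 ∈ M.sp (· = 1 + 1) := M.f_mem_sp (by norm_num) (by decide)
    obtain ⟨g, hg1, hg2⟩ := M.exists_homog_preimage hA hΨ (fun k g h => (hg k g h).1)
      (k := 1) (y := quotMk J' (M.f 3)) ⟨_, h32, rfl⟩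
    have hd2 : ∀ j, natDeg j = 1 + 1 ↔ j = 3 := fun j => by
      rw [natDeg]; split_ifs <;> omega
    rw [M.mem_sp_single (by norm_num) hd2 (by norm_num) hg1, map_smul, h3, smul_zero] at hg2
    exact M.f_notMem_sp (by norm_num) (by rw [show natDeg 3 = 2 by decide]; omega)
      (hlow _ (quotMk_eq_zero.mp hg2.symm))
  -- Applying `Ψ` to `⁅f_2, ⁅f_2, f_3⁆⁆ = 0` leaves a multiple of `f_5`. One more bracket than in
  -- the Serre relation is taken, since `⁅f_2, f_3⁆ = z` need not vanish in `𝔫₂³`.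
  have hb' : b' = 0 := by
    have h : quotMk J' ((-3 * (a * b - c * b') * b' * b') • M.f 5) = 0 := by
      have e : Ψ ⁅M.f 2, ⁅M.f 2, M.f 3⁆⁆ = 0 := by rw [b23, M.lie_z, map_zero]
      rw [← e, LieHom.map_lie, LieHom.map_lie, h3, hY, ← LieHom.map_lie, ← LieHom.map_lie]
      congr 1
      simp only [lie_add, add_lie, lie_smul, smul_lie, b13, b23, b14, b24, M.lie_z]
      module
    have := M.smul_f_mem_sp (by norm_num) (by rw [show natDeg 5 = 4 by decide]; omega)
      (hlow _ (quotMk_eq_zero.mp h))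
    simpa [hD] using this
  subst hb'
  rw [mul_zero, sub_zero] at hD h3
  have ha := left_ne_zero_of_mul hD
  have hb := right_ne_zero_of_mul hD
  -- Applying `Ψ` to the Serre relation `(ad f_1)^5 f_2 = 0` leaves a multiple of `f_8`, of degree 6
  -- and thus not in `J'`.
  have hc : c = 0 := by
    have h : quotMk J' ((9 * a * a * a * a * b * c) • M.f 8) = 0 := by
      have e : Ψ ⁅M.f 1, ⁅M.f 1, ⁅M.f 1, ⁅M.f 1, M.f 3⁆⁆⁆⁆ = 0 := by
        rw [b13, b14, lie_smul, b15, lie_smul, lie_smul, b16, smul_zero, smul_zero, map_zero]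
      rw [← neg_zero, ← e]
      simp only [LieHom.map_lie Ψ, h3, hX]
      simp only [← LieHom.map_lie (quotMk J')]
      rw [← map_neg]
      congr 1
      simp only [lie_add, add_lie, lie_smul, smul_lie, b13, b23, b14, b24, b15, b16, b17, b25, b26,
        b27, M.lie_z, smul_zero, zero_add, add_zero]
      module
    have := M.smul_f_mem_sp (by norm_num) (by rw [show natDeg 8 = 6 by decide]; omega)
      (hlow _ (quotMk_eq_zero.mp h))
    simpa [ha, hb] using this
  subst hc
  have hscal (j : ℕ) : 1 ≤ j → ∃ u : K, u ≠ 0 ∧ Ψ (M.f j) = quotMk J' (u • M.f j) := by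
    induction j using Nat.strong_induction_on with
    | _ j ih =>
      intro hj
      have hx1 : Ψ (M.f 1) = quotMk J' (a • M.f 1) := by rw [hX, zero_smul, add_zero]
      have hx2 : Ψ (M.f 2) = quotMk J' (b • M.f 2) := by rw [hY, zero_smul, zero_add]
      obtain rfl | rfl | h3 : j = 1 ∨ j = 2 ∨ 3 ≤ j := by omega
      · exact ⟨a, ha, hx1⟩
      · exact ⟨b, hb, hx2⟩
      obtain ⟨i, l, hi, hl, hlj, -, -, -, e⟩ := M.f_eq_lie h3
      obtain ⟨v, hv, hv'⟩ := ih l hlj hl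
      have : ∃ r : K, r ≠ 0 ∧ Ψ (M.f i) = quotMk J' (r • M.f i) := by
        rcases hi with rfl | rfl
        · exact ⟨a, ha, hx1⟩
        · exact ⟨b, hb, hx2⟩
      obtain ⟨r, hr, hr'⟩ := this
      refine ⟨r * v, mul_ne_zero hr hv, ?_⟩
      rw [e, map_smul, LieHom.map_lie, hr', hv', ← LieHom.map_lie, ← map_smul]
      congr 1
      simp only [lie_smul, smul_lie]
      module
  choose! u hu0 hu using hscal
  refine ⟨u, hu0, fun i j a b hi hj di dj hab => ?_⟩
  have hmem : a • M.f i + b • M.f j ∈ M.sp (· = n + 1) :=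
    add_mem (Submodule.smul_mem _ _ (M.f_mem_sp hi di)) (Submodule.smul_mem _ _ (M.f_mem_sp hj dj))
  have h0 := (hg _ _ hmem).eq_zero hA hid hker le_rfl (by
    rw [LieHom.comp_apply, quotMk_eq_zero.mpr hab, map_zero])
  rw [map_add, map_smul, map_smul, hu i hi, hu j hj, ← map_smul, ← map_smul, ← map_add,
    quotMk_eq_zero, smul_smul, smul_smul] at h0
  exact h0

variable {M} in
theorem IsTop.comb_mem_iff {N : ℕ} (hN : N % 6 = 1 ∨ N % 6 = 5) {w : G} {J : LieIdeal K G}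
    (h : M.IsTop N w J) (a b : K) :
    a • M.f (firstIdx N) + b • M.f (firstIdx N + 1) ∈ J ↔
      a • M.f (firstIdx N) + b • M.f (firstIdx N + 1) ∈ Submodule.span K {w} := by
  obtain ⟨n, rfl⟩ : ∃ n, N = n + 1 := ⟨N - 1, by omega⟩
  have hdeg := natDeg_eq_iff_double hN
  have hp := one_le_firstIdx (n + 1)
  have hmem : a • M.f (firstIdx (n + 1)) + b • M.f (firstIdx (n + 1) + 1) ∈ M.sp (· = n + 1) :=
    add_mem (Submodule.smul_mem _ _ (M.f_mem_sp hp ((hdeg _).mpr (Or.inl rfl))))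
      (Submodule.smul_mem _ _ (M.f_mem_sp (by omega) ((hdeg _).mpr (Or.inr rfl))))
  rw [h.mem_iff, M.proj_eq_self hmem]
  exact and_iff_right (M.sp_mono (fun l hl => by omega) hmem)

/-- A vector of the killed line would be scaled by nonzero factors to a vector that is zero in the
truncation. -/
theorem isEmpty_equiv_lcs [CharZero K] {n : ℕ} (hn : 6 ≤ n) (h6 : n % 6 = 0 ∨ n % 6 = 4)
    {s : Fin 3} {J : LieIdeal K G} (hJ : M.IsTop (n + 1) (M.topVec (n + 1) s) J) :
    IsEmpty ((G ⧸ J) ≃ₗ⁅K⁆ G ⧸ LieModule.lowerCentralSeries K G G (n + 1)) := by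
  refine ⟨fun φ => ?_⟩
  obtain ⟨u, hu0, hu⟩ := M.exists_scalars_of_equiv hn J (M.isTop_lcs (n + 1))
    (M.exists_notMem_lcs (by omega)) φ
  have hN : (n + 1) % 6 = 1 ∨ (n + 1) % 6 = 5 := by omega
  have hdeg := natDeg_eq_iff_double hN
  have hp := one_le_firstIdx (n + 1)
  have key (a b : K) (h : topForm s a b = 0) :
      a * u (firstIdx (n + 1)) = 0 ∧ b * u (firstIdx (n + 1) + 1) = 0 := by
    have := hu _ _ a b hp (by omega) ((hdeg _).mpr (Or.inl rfl)) ((hdeg _).mpr (Or.inr rfl))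
      ((hJ.comb_mem_iff hN a b).mpr ((M.comb_mem_span_topVec (n + 1) s a b).mpr h))
    rw [(M.isTop_lcs (n + 1)).comb_mem_iff hN, Submodule.span_zero_singleton,
      Submodule.mem_bot] at this
    exact M.comb_eq_zero hp this
  have h1 := hu0 _ hp
  have h2 := hu0 (firstIdx (n + 1) + 1) (by omega)
  fin_cases s
  · exact h2 (by simpa using (key 0 1 rfl).2)
  · exact h1 (by simpa using (key 1 0 rfl).1)
  · exact h1 (by simpa using (key 1 (-1) (add_neg_cancel 1)).1)

/-- A diagonal invertible map preserves both coordinate axes of the plane, and the third line is not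
an axis. -/
theorem isEmpty_equiv_of_ne [CharZero K] {n : ℕ} (hn : 6 ≤ n) (h6 : n % 6 = 0 ∨ n % 6 = 4)
    {s s' : Fin 3} (hs : s ≠ s') {J J' : LieIdeal K G}
    (hJ : M.IsTop (n + 1) (M.topVec (n + 1) s) J)
    (hJ' : M.IsTop (n + 1) (M.topVec (n + 1) s') J') (hN' : ∃ x ∈ M.sp (· = n + 1), x ∉ J') :
    IsEmpty ((G ⧸ J) ≃ₗ⁅K⁆ G ⧸ J') := by
  refine ⟨fun φ => ?_⟩
  obtain ⟨u, hu0, hu⟩ := M.exists_scalars_of_equiv hn J hJ' hN' φ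
  have hN : (n + 1) % 6 = 1 ∨ (n + 1) % 6 = 5 := by omega
  have hdeg := natDeg_eq_iff_double hN
  have hp := one_le_firstIdx (n + 1)
  have key (a b : K) (h : topForm s a b = 0) :
      topForm s' (a * u (firstIdx (n + 1))) (b * u (firstIdx (n + 1) + 1)) = 0 := by
    have := hu _ _ a b hp (by omega) ((hdeg _).mpr (Or.inl rfl)) ((hdeg _).mpr (Or.inr rfl))
      ((hJ.comb_mem_iff hN a b).mpr ((M.comb_mem_span_topVec (n + 1) s a b).mpr h))
    rwa [hJ'.comb_mem_iff hN, M.comb_mem_span_topVec] at this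
  have h1 := hu0 _ hp
  have h2 := hu0 (firstIdx (n + 1) + 1) (by omega)
  have k0 := key 0 1
  have k1 := key 1 0
  have k2 := key 1 (-1)
  fin_cases s <;> fin_cases s' <;> simp [topForm] at hs k0 k1 k2 <;> contradiction

theorem exists_notMem_of_topVec {n : ℕ} (h6 : n % 6 = 0 ∨ n % 6 = 4) {s : Fin 3}
    {J : LieIdeal K G} (hJ : M.IsTop (n + 1) (M.topVec (n + 1) s) J) :
    ∃ x ∈ M.sp (· = n + 1), x ∉ J := by
  have hN : (n + 1) % 6 = 1 ∨ (n + 1) % 6 = 5 := by omega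
  have hdeg := natDeg_eq_iff_double hN
  have hp := one_le_firstIdx (n + 1)
  have hmem (a b : K) :
      a • M.f (firstIdx (n + 1)) + b • M.f (firstIdx (n + 1) + 1) ∈ M.sp (· = n + 1) :=
    add_mem (Submodule.smul_mem _ _ (M.f_mem_sp hp ((hdeg _).mpr (Or.inl rfl))))
      (Submodule.smul_mem _ _ (M.f_mem_sp (by omega) ((hdeg _).mpr (Or.inr rfl))))
  obtain ⟨a, b, h⟩ : ∃ a b : K, topForm s a b ≠ 0 := by
    fin_cases s
    · exact ⟨1, 0, one_ne_zero⟩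
    · exact ⟨0, 1, one_ne_zero⟩
    · exact ⟨1, 0, by simp [topForm]⟩
  exact ⟨_, hmem a b, fun h' =>
    h ((M.comb_mem_span_topVec (n + 1) s a b).mp ((hJ.comb_mem_iff hN a b).mp h'))⟩

end NTwoModel
end Rigidity

/-! ### The algebras `𝔫₂` and `𝔫₂³` as models -/

section Instances

open Polynomial

attribute [local instance] LieRing.ofAssociativeRing

namespace NTwoModel

variable {K : Type u} [Field K] [CharZero K] {G : Type u} [LieRing G] [LieAlgebra K G]

theorem main (M : NTwoModel K G) (n : ℕ) (hn : 7 ≤ n)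
    (I : n % 6 = 0 ∨ n % 6 = 4 → Fin 3 → LieIdeal K G)
    (hI : ∀ h s, M.IsTop (n + 1) (M.topVec (n + 1) s) (I h s)) :
    IsCarnot K (G ⧸ LieModule.lowerCentralSeries K G G n) n ∧
      ((n % 6 ≠ 0 ∧ n % 6 ≠ 4) →
        IsCarnotExtension K (G ⧸ LieModule.lowerCentralSeries K G G n) n
          (G ⧸ LieModule.lowerCentralSeries K G G (n + 1)) ∧
        ∀ (E : Type v) [LieRing E] [LieAlgebra K E],
          IsCarnotExtension K (G ⧸ LieModule.lowerCentralSeries K G G n) n E →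
          Nonempty (E ≃ₗ⁅K⁆ G ⧸ LieModule.lowerCentralSeries K G G (n + 1))) ∧
      (∀ h : n % 6 = 0 ∨ n % 6 = 4,
        IsCarnotExtension K (G ⧸ LieModule.lowerCentralSeries K G G n) n
          (G ⧸ LieModule.lowerCentralSeries K G G (n + 1)) ∧
        (∀ s, IsCarnotExtension K (G ⧸ LieModule.lowerCentralSeries K G G n) n (G ⧸ I h s)) ∧
        (∀ (E : Type v) [LieRing E] [LieAlgebra K E],
          IsCarnotExtension K (G ⧸ LieModule.lowerCentralSeries K G G n) n E →
          Nonempty (E ≃ₗ⁅K⁆ G ⧸ LieModule.lowerCentralSeries K G G (n + 1)) ∨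
          ∃ s, Nonempty (E ≃ₗ⁅K⁆ G ⧸ I h s)) ∧
        (∀ s, IsEmpty ((G ⧸ I h s) ≃ₗ⁅K⁆ G ⧸ LieModule.lowerCentralSeries K G G (n + 1))) ∧
        (∀ s s', s ≠ s' → IsEmpty ((G ⧸ I h s) ≃ₗ⁅K⁆ G ⧸ I h s')) ∧
        (∀ s, ∀ N > n + 1, ∀ (E : Type v) [LieRing E] [LieAlgebra K E],
          ¬ CarnotExtends K (G ⧸ I h s) (n + 1) N E)) := by
  refine ⟨M.isCarnot_lcs (by omega), fun h => ⟨M.isCarnotExtension_lcs n, fun E _ _ hE =>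
    M.extension_unique (by omega) h hE⟩, fun h => ⟨M.isCarnotExtension_lcs n, fun s =>
    (hI h s).isCarnotExtension (M.exists_notMem_of_topVec h (hI h s)), fun E _ _ hE =>
    M.extension_classification (by omega) h (I h) (hI h) hE, fun s =>
    M.isEmpty_equiv_lcs (by omega) h (hI h s), fun s s' hs =>
    M.isEmpty_equiv_of_ne (by omega) h hs (hI h s) (hI h s')
      (M.exists_notMem_of_topVec h (hI h s')), fun s N hN E _ _ =>
    M.not_carnotExtends (by omega) h s (hI h s) hN⟩⟩

end NTwoModel

variable (K : Type u) [Field K]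

/-- The vectors `f_j` as elements of `𝔫₂`. -/
noncomputable def n2f (j : ℕ) : n2 K :=
  if h : 1 ≤ j then ⟨fMat K j, Submodule.subset_span ⟨j, h, rfl⟩⟩ else 0

theorem n2f_val {j : ℕ} (h : 1 ≤ j) : (n2f K j).1 = fMat K j := by rw [n2f, dif_pos h]

theorem n2f_eq {j : ℕ} (h : 1 ≤ j) :
    n2f K j = ⟨fMat K j, Submodule.subset_span ⟨j, h, rfl⟩⟩ := by rw [n2f, dif_pos h]

/-- The matrix entry in which `f_j` has the coefficient `1`. -/
def fEntry : Fin 8 → Fin 3 × Fin 3 :=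
  ![(0, 0), (0, 1), (2, 0), (1, 0), (0, 0), (0, 1), (0, 2), (1, 0)]

/-- The coordinate functional of `f_j`. -/
noncomputable def fCoord (j : ℕ) : n2 K →ₗ[K] K :=
  entryCoeff K (fEntry (Fin.ofNat 8 j)).1 (fEntry (Fin.ofNat 8 j)).2 (fExp j)

theorem fCoord_n2f (i j : ℕ) (hi : 1 ≤ i) :
    fCoord K j (n2f K i) = if i = j then 1 else 0 := by
  change ((n2f K i).1 _ _).coeff _ = _
  rw [n2f_val K hi, coeff_fMat]
  -- Coordinates of different residues are separated either by a zero matrix entry or by the parity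
  -- of the exponent of `t`; equal residues are separated by the exponent itself.
  have key : ∀ s t : Fin 8, (s = t ∧ fBase s (fEntry t).1 (fEntry t).2 = 1) ∨
      (s ≠ t ∧ fBase s (fEntry t).1 (fEntry t).2 = 0) ∨
      (s ≠ t ∧ fShift s % 2 ≠ fShift t % 2) := by decide
  rcases key (Fin.ofNat 8 i) (Fin.ofNat 8 j) with ⟨h1, h2⟩ | ⟨h1, h2⟩ | ⟨h1, h2⟩
  · rw [h2, Int.cast_one, fExp, fExp, h1]
    have h3 : i % 8 = j % 8 := congrArg Fin.val h1
    by_cases h : i = j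
    · rw [if_pos h, if_pos (by rw [h])]
    · rw [if_neg h, if_neg (by omega)]
  · rw [h2, Int.cast_zero, ite_self, if_neg (by rintro rfl; exact h1 rfl)]
  · rw [if_neg (by rw [fExp, fExp]; omega), if_neg (by rintro rfl; exact h1 rfl)]

theorem linearIndependent_n2f : LinearIndependent K (fun i => n2f K (i + 1)) := by
  rw [linearIndependent_iff']
  intro s g hg i hi
  have := congrArg (fCoord K (i + 1)) hg
  rw [map_sum, map_zero] at this
  simpa [fCoord_n2f, hi] using this

theorem span_n2f : ⊤ ≤ Submodule.span K (Set.range fun i => n2f K (i + 1)) := by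
  rintro ⟨x, hx⟩ -
  have hx' : x ∈ Submodule.span K {x | ∃ j, 1 ≤ j ∧ fMat K j = x} := hx
  have : Submodule.span K {x | ∃ j, 1 ≤ j ∧ fMat K j = x} ≤
      (Submodule.span K (Set.range fun i => n2f K (i + 1))).map (n2 K).toSubmodule.subtype := by
    refine Submodule.span_le.mpr ?_
    rintro _ ⟨j, hj, rfl⟩
    refine ⟨n2f K j, Submodule.subset_span ⟨j - 1, ?_⟩, n2f_val K hj⟩
    simp only
    rw [Nat.sub_add_cancel hj]
  obtain ⟨y, hy, e⟩ := this hx'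
  rwa [show (⟨x, hx⟩ : n2 K) = y from Subtype.ext e.symm]

/-- The basis `f_1, f_2, …` of `𝔫₂`. -/
noncomputable def n2Basis : Module.Basis ℕ K (n2 K) :=
  Module.Basis.mk (linearIndependent_n2f K) (span_n2f K)

theorem n2Basis_apply (i : ℕ) : n2Basis K i = n2f K (i + 1) := by
  rw [n2Basis, Module.Basis.mk_apply]

/-- The coordinates with respect to `f_1, f_2, …`. -/
noncomputable def n2Coord : n2 K →ₗ[K] ℕ →₀ K :=
  Finsupp.lmapDomain K K Nat.succ ∘ₗ (n2Basis K).repr.toLinearMap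

theorem n2Coord_n2f {j : ℕ} (hj : 1 ≤ j) : n2Coord K (n2f K j) = Finsupp.single j 1 := by
  obtain ⟨i, rfl⟩ : ∃ i, j = i + 1 := ⟨j - 1, by omega⟩
  rw [← n2Basis_apply]
  simp [n2Coord]

theorem n2Coord_zero (x : n2 K) : n2Coord K x 0 = 0 := by
  change Finsupp.mapDomain Nat.succ ((n2Basis K).repr x) 0 = 0
  exact Finsupp.mapDomain_of_notMem_range _ _ (by simp)

theorem n2_eq_sum (x : n2 K) : x = Finsupp.linearCombination K (n2f K) (n2Coord K x) := by
  change x = Finsupp.linearCombination K (n2f K) (Finsupp.mapDomain Nat.succ ((n2Basis K).repr x))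
  rw [Finsupp.linearCombination_mapDomain]
  conv_lhs => rw [← (n2Basis K).linearCombination_repr x]
  congr 1
  congr 1
  funext i
  exact n2Basis_apply K i

theorem lie_n2f {q l : ℕ} (hq : 1 ≤ q) (hl : 1 ≤ l) :
    ⁅n2f K q, n2f K l⁆ = (dCoef q l : K) • n2f K (q + l) := by
  apply Subtype.ext
  change ⁅(n2f K q).1, (n2f K l).1⁆ = (dCoef q l : K) • (n2f K (q + l)).1
  rw [n2f_val K hq, n2f_val K hl, n2f_val K (by omega), lie_fMat]

/-- The basis of `𝔫₂`. -/
noncomputable def n2Model : NTwoModel K (n2 K) where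
  f := n2f K
  z := 0
  C := n2Coord K
  cz := 0
  C_f _ hj := n2Coord_n2f K hj
  C_z := map_zero _
  cz_f _ _ := rfl
  z_or := Or.inr ⟨rfl, fun _ => rfl⟩
  C_zero := n2Coord_zero K
  eq_sum x := by rw [smul_zero, add_zero]; exact n2_eq_sum K x
  lie_f q l hq hl := by rw [LieRel, smul_zero, add_zero]; exact lie_n2f K hq hl
  lie_z x := lie_zero x

/-- The projection `𝔫₂³ → 𝔫₂`. -/
noncomputable def n2CubeFst : n2Cube K →ₗ[K] n2 K where
  toFun x := ((LieAlgebra.ofProd (n2Cocycle K)).symm x).1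
  map_add' _ _ := rfl
  map_smul' _ _ := rfl

/-- The coefficient of `z` in an element of `𝔫₂³`. -/
noncomputable def n2CubeSnd : n2Cube K →ₗ[K] K where
  toFun x := TrivialLieModule.equiv K (n2 K) K ((LieAlgebra.ofProd (n2Cocycle K)).symm x).2
  map_add' _ _ := rfl
  map_smul' _ _ := rfl

/-- The central element of `𝔫₂³`. -/
noncomputable def n2CubeZ : n2Cube K :=
  LieAlgebra.ofProd (n2Cocycle K) (0, (TrivialLieModule.equiv K (n2 K) K).symm 1)

theorem n2Cube_ext {x y : n2Cube K} (h : n2CubeFst K x = n2CubeFst K y)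
    (h' : n2CubeSnd K x = n2CubeSnd K y) : x = y :=
  (LieAlgebra.ofProd (n2Cocycle K)).symm.injective
    (Prod.ext h ((TrivialLieModule.equiv K (n2 K) K).injective h'))

theorem n2CubeFst_section (x : n2 K) : n2CubeFst K (n2Section K x) = x := rfl

theorem n2CubeSnd_section (x : n2 K) : n2CubeSnd K (n2Section K x) = 0 := rfl

theorem n2CubeFst_z : n2CubeFst K (n2CubeZ K) = 0 := rfl

theorem n2CubeSnd_z : n2CubeSnd K (n2CubeZ K) = 1 := rfl

theorem n2CubeFst_lie (x y : n2Cube K) :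
    n2CubeFst K ⁅x, y⁆ = ⁅n2CubeFst K x, n2CubeFst K y⁆ := by
  rw [LieAlgebra.bracket_ofTwoCocycle]; rfl

theorem n2CubeSnd_lie (x y : n2Cube K) :
    n2CubeSnd K ⁅x, y⁆ = fDual2 K (n2CubeFst K x) * fDual3 K (n2CubeFst K y) -
      fDual3 K (n2CubeFst K x) * fDual2 K (n2CubeFst K y) := by
  rw [LieAlgebra.bracket_ofTwoCocycle]
  change (fDual2 K (n2CubeFst K x) * fDual3 K (n2CubeFst K y) -
      fDual3 K (n2CubeFst K x) * fDual2 K (n2CubeFst K y)) + 0 - 0 = _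
  rw [add_zero, sub_zero]

theorem fDual_n2f {j : ℕ} (hj : 1 ≤ j) : fDual2 K (n2f K j) = (if j = 2 then 1 else 0) ∧
    fDual3 K (n2f K j) = (if j = 3 then 1 else 0) := by
  rw [n2f_eq K hj]
  exact (fDual_fMat K j hj _).2

/-- The basis of `𝔫₂³`. -/
noncomputable def n2CubeModel : NTwoModel K (n2Cube K) where
  f j := n2Section K (n2f K j)
  z := n2CubeZ K
  C := n2Coord K ∘ₗ n2CubeFst K
  cz := n2CubeSnd K
  C_f _ hj := n2Coord_n2f K hj
  C_z := by rw [LinearMap.comp_apply, n2CubeFst_z, map_zero]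
  cz_f _ _ := rfl
  z_or := Or.inl rfl
  C_zero x := n2Coord_zero K _
  eq_sum x := by
    have : Finsupp.linearCombination K (fun j => n2Section K (n2f K j))
        (n2Coord K (n2CubeFst K x)) = n2Section K (n2CubeFst K x) := by
      conv_rhs => rw [n2_eq_sum K (n2CubeFst K x)]
      rw [Finsupp.apply_linearCombination]
      rfl
    rw [LinearMap.comp_apply, this]
    apply n2Cube_ext
    · rw [map_add, map_smul, n2CubeFst_section, n2CubeFst_z, smul_zero, add_zero]
    · rw [map_add, map_smul, n2CubeSnd_section, n2CubeSnd_z, zero_add, smul_eq_mul, mul_one]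
  lie_f q l hq hl := by
    apply n2Cube_ext
    · rw [n2CubeFst_lie, map_add, map_smul, map_smul, n2CubeFst_section, n2CubeFst_section,
        n2CubeFst_section, n2CubeFst_z, smul_zero, add_zero, lie_n2f K hq hl]
    · rw [n2CubeSnd_lie, map_add, map_smul, map_smul, n2CubeFst_section, n2CubeFst_section,
        n2CubeSnd_section, n2CubeSnd_z, (fDual_n2f K hq).1, (fDual_n2f K hq).2, (fDual_n2f K hl).1,
        (fDual_n2f K hl).2, wCoef]
      split_ifs <;> first | omega | simp
  lie_z x := by
    apply n2Cube_ext
    · rw [n2CubeFst_lie, n2CubeFst_z, lie_zero, map_zero]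
    · rw [n2CubeSnd_lie, n2CubeFst_z, map_zero, map_zero, mul_zero, mul_zero, sub_zero, map_zero]

/-- Matches the ideals, which are given by indices `j ≥ p + 2`, with the degree filtration. -/
theorem lt_natDeg_iff {N : ℕ} (hN : N % 6 = 1 ∨ N % 6 = 5) (j : ℕ) :
    N < natDeg j ↔ firstIdx N + 2 ≤ j := by
  rw [natDeg, firstIdx]
  split_ifs <;> omega

theorem topVec_n2Model_val (N : ℕ) (s : Fin 3) : ((n2Model K).topVec N s).1 =
    ![fMat K (firstIdx N + 1), fMat K (firstIdx N),
      fMat K (firstIdx N) - fMat K (firstIdx N + 1)] s := by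
  have h1 := n2f_val K (one_le_firstIdx N)
  have h2 := n2f_val K (j := firstIdx N + 1) (by omega)
  fin_cases s
  · exact h2
  · exact h1
  · change (n2f K (firstIdx N)).1 - (n2f K (firstIdx N + 1)).1 = _
    rw [h1, h2]; rfl

theorem NTwoModel.topVec_mem {G : Type*} [LieRing G] [LieAlgebra K G] (M : NTwoModel K G) {N : ℕ}
    (hN : N % 6 = 1 ∨ N % 6 = 5) (s : Fin 3) : M.topVec N s ∈ M.sp (· = N) := by
  have h0 : M.f (firstIdx N) ∈ M.sp (· = N) :=
    M.f_mem_sp (one_le_firstIdx N) ((natDeg_eq_iff_double hN _).mpr (Or.inl rfl))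
  have h1 : M.f (firstIdx N + 1) ∈ M.sp (· = N) :=
    M.f_mem_sp (by omega) ((natDeg_eq_iff_double hN _).mpr (Or.inr rfl))
  fin_cases s
  · exact h1
  · exact h0
  · exact sub_mem h0 h1

theorem isTop_n2Ideal (N : ℕ) (hN : 7 ≤ N ∧ (N % 6 = 1 ∨ N % 6 = 5)) (s : Fin 3) :
    (n2Model K).IsTop N ((n2Model K).topVec N s) (n2Ideal K N hN s) := by
  refine ⟨(n2Model K).topVec_mem K hN.2 s, le_antisymm ?_ (sup_le ?_ ?_)⟩
  · intro x hx
    have hx' : x.1 ∈ Submodule.span K (idealGen K N s) := hx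
    have : Submodule.span K (idealGen K N s) ≤
        (Submodule.span K {(n2Model K).topVec N s} ⊔ (n2Model K).sp (N < ·)).map
          (n2 K).toSubmodule.subtype := by
      refine Submodule.span_le.mpr ?_
      rintro y (hy | ⟨j, hj, rfl⟩)
      · rw [Set.mem_singleton_iff] at hy
        exact ⟨_, Submodule.mem_sup_left (Submodule.mem_span_singleton_self _),
          (topVec_n2Model_val K N s).trans hy.symm⟩
      · exact ⟨n2f K j, Submodule.mem_sup_right
          ((n2Model K).f_mem_sp (by omega) ((lt_natDeg_iff hN.2 j).mpr hj)), n2f_val K (by omega)⟩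
    obtain ⟨y, hy, e⟩ := this hx'
    rwa [show x = y from Subtype.ext e.symm]
  · rw [Submodule.span_le, Set.singleton_subset_iff]
    change ((n2Model K).topVec N s).1 ∈ Submodule.span K (idealGen K N s)
    rw [topVec_n2Model_val]
    exact Submodule.subset_span (Or.inl rfl)
  · refine (n2Model K).sp_le (fun j hj h => ?_) (fun _ => zero_mem _)
    change (n2f K j).1 ∈ Submodule.span K (idealGen K N s)
    rw [n2f_val K hj]
    exact Submodule.subset_span (Or.inr ⟨j, (lt_natDeg_iff hN.2 j).mp h, rfl⟩)

theorem isTop_n2CubeIdeal (N : ℕ) (hN : 7 ≤ N ∧ (N % 6 = 1 ∨ N % 6 = 5)) (s : Fin 3) :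
    (n2CubeModel K).IsTop N ((n2CubeModel K).topVec N s) (n2CubeIdeal K N hN s) := by
  refine ⟨(n2CubeModel K).topVec_mem K hN.2 s, ?_⟩
  change (n2Ideal K N hN s).toSubmodule.map (n2Section K) = _
  rw [(isTop_n2Ideal K N hN s).2, Submodule.map_sup, Submodule.map_span, Set.image_singleton]
  congr 1
  · have : n2Section K ((n2Model K).topVec N s) = (n2CubeModel K).topVec N s := by
      fin_cases s
      · rfl
      · rfl
      · exact map_sub _ _ _
    rw [this]
  · refine le_antisymm (Submodule.map_le_iff_le_comap.mpr ?_) ?_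
    · exact (n2Model K).sp_le (fun j hj h => (n2CubeModel K).f_mem_sp hj h) (fun _ => zero_mem _)
    -- The vector `z` has degree 3 and `N` is at least 7, so `z` is not among the vectors of degree
    -- above `N`.
    · exact (n2CubeModel K).sp_le (fun j hj h => ⟨_, (n2Model K).f_mem_sp hj h, rfl⟩)
        (fun h => by omega)

end Instances

theorem mainTheorem11 (K : Type u) [Field K] [CharZero K] (n : ℕ) (hn : 7 ≤ n) :
    (IsCarnot K (n2Quot K n) n ∧
      ((n % 6 ≠ 0 ∧ n % 6 ≠ 4) →
        IsCarnotExtension K (n2Quot K n) n (n2Quot K (n + 1)) ∧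
        ∀ (E : Type v) [LieRing E] [LieAlgebra K E], IsCarnotExtension K (n2Quot K n) n E →
          Nonempty (E ≃ₗ⁅K⁆ n2Quot K (n + 1))) ∧
      (∀ h : n % 6 = 0 ∨ n % 6 = 4,
        IsCarnotExtension K (n2Quot K n) n (n2Quot K (n + 1)) ∧
        (∀ s, IsCarnotExtension K (n2Quot K n) n (n2S K (n + 1) (succ_deg hn h) s)) ∧
        (∀ (E : Type v) [LieRing E] [LieAlgebra K E], IsCarnotExtension K (n2Quot K n) n E →
          Nonempty (E ≃ₗ⁅K⁆ n2Quot K (n + 1)) ∨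
          ∃ s, Nonempty (E ≃ₗ⁅K⁆ n2S K (n + 1) (succ_deg hn h) s)) ∧
        (∀ s, IsEmpty (n2S K (n + 1) (succ_deg hn h) s ≃ₗ⁅K⁆ n2Quot K (n + 1))) ∧
        (∀ s s', s ≠ s' → IsEmpty
          (n2S K (n + 1) (succ_deg hn h) s ≃ₗ⁅K⁆ n2S K (n + 1) (succ_deg hn h) s')) ∧
        (∀ s, ∀ N > n + 1, ∀ (E : Type v) [LieRing E] [LieAlgebra K E],
          ¬ CarnotExtends K (n2S K (n + 1) (succ_deg hn h) s) (n + 1) N E))) ∧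
    (IsCarnot K (n2CubeQuot K n) n ∧
      ((n % 6 ≠ 0 ∧ n % 6 ≠ 4) →
        IsCarnotExtension K (n2CubeQuot K n) n (n2CubeQuot K (n + 1)) ∧
        ∀ (E : Type v) [LieRing E] [LieAlgebra K E], IsCarnotExtension K (n2CubeQuot K n) n E →
          Nonempty (E ≃ₗ⁅K⁆ n2CubeQuot K (n + 1))) ∧
      (∀ h : n % 6 = 0 ∨ n % 6 = 4,
        IsCarnotExtension K (n2CubeQuot K n) n (n2CubeQuot K (n + 1)) ∧
        (∀ s, IsCarnotExtension K (n2CubeQuot K n) n (n2CubeS K (n + 1) (succ_deg hn h) s)) ∧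
        (∀ (E : Type v) [LieRing E] [LieAlgebra K E], IsCarnotExtension K (n2CubeQuot K n) n E →
          Nonempty (E ≃ₗ⁅K⁆ n2CubeQuot K (n + 1)) ∨
          ∃ s, Nonempty (E ≃ₗ⁅K⁆ n2CubeS K (n + 1) (succ_deg hn h) s)) ∧
        (∀ s, IsEmpty (n2CubeS K (n + 1) (succ_deg hn h) s ≃ₗ⁅K⁆ n2CubeQuot K (n + 1))) ∧
        (∀ s s', s ≠ s' → IsEmpty
          (n2CubeS K (n + 1) (succ_deg hn h) s ≃ₗ⁅K⁆ n2CubeS K (n + 1) (succ_deg hn h) s')) ∧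
        (∀ s, ∀ N > n + 1, ∀ (E : Type v) [LieRing E] [LieAlgebra K E],
          ¬ CarnotExtends K (n2CubeS K (n + 1) (succ_deg hn h) s) (n + 1) N E))) := by
  exact ⟨(n2Model K).main n hn (fun h s => n2Ideal K (n + 1) (succ_deg hn h) s)
      (fun h s => isTop_n2Ideal K (n + 1) (succ_deg hn h) s),
    (n2CubeModel K).main n hn (fun h s => n2CubeIdeal K (n + 1) (succ_deg hn h) s)
      (fun h s => isTop_n2CubeIdeal K (n + 1) (succ_deg hn h) s)⟩
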